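/- Let $p$ be a prime, $k$ a field of characteristic $p$ (with the discrete topology) and $G$ a profinite group. Let $k[[G]]=\varprojlim_N k[G/N]$ be the completed group algebra ($N$ running over the open normal subgroups of $G$), with the inverse limit topology and canonical projections $\varphi_N:k[[G]]\to k[G/N]$. Let $B=k[[G]]e$ be a block of $G$ with block idempotent $e$, that is, $e$ is a primitive idempotent of the center of $k[[G]]$. Notation. Groups act on group algebras by conjugation ${}^g x=gxg^{-1}$, and $A^H$ denotes the $H$-fixed points. For closed subgroups $H\le L$ of $G$ with $H$ open in $L$, $\mathrm{Tr}_H^L(a)=\sum_{g\in L/H}{}^g a$ for $a\in k[[G]]^H$ (and similarly for finite group algebras). * For a closed subgroup $D$, $\mathrm{oTr}_D^G(k[[G]]^D)=\bigcap_{N}\mathrm{Tr}_{DN}^G(k[[G]]^{DN})$, the intersection over all open normal subgroups $N$ of $G$. * $|G:D|_p$ is the $p$-part of the supernatural number $|G:D|$. If $|G:D|_p$ is finite, the modified trace $\widetilde{\mathrm{Tr}}_D^G(x)$ of $x\in k[[G]]^D$ is the element of $k[[G]]$ with components $\varphi_N\big(\widetilde{\mathrm{Tr}}_D^G(x)\big)=\frac{1}{|G:DN|_{p'}}\mathrm{Tr}_{DN/N}^{G/N}(\varphi_N(x))$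 for all open normal $N$ with $|G:DN|_p=|G:D|_p$. * $k[[G]]$ is a $k[[G\times G]]$-module through $(g_1,g_2)\cdot x=g_1xg_2^{-1}$, $B$ is a submodule of it, and $\delta(D)=\{(d,d):d\in D\}$. A pseudocompact module $U$ over $k[[\Gamma]]$, $\Gamma$ profinite, is relatively $H$-projective ($H\le\Gamma$ closed) if for every continuous surjective homomorphism $\beta:V\to W$ and continuous homomorphism $\varphi:U\to W$ of pseudocompact $k[[\Gamma]]$-modules such that $\varphi=\beta\psi$ for some continuous $k[[H]]$-homomorphism $\psi:U\to V$, there is a continuous $k[[\Gamma]]$-homomorphism $\psi':U\to V$ with $\varphi=\beta\psi'$. A vertex of $U$ is a closed subgroup $Q$ such that $U$ is relatively $Q$-projective but not relatively $R$-projective for any proper closed subgroup $R$ of $Q$. * For a closed pro-$p$ subgroup $D$, $\mathrm{Br}_D$ is the natural projection of $k[[G]]^D$ onto its quotient by the closure of $\sum_{Q}\mathrm{Tr}_Q^D(k[[G]]^Q)$, where $Q$ runs over the proper open subgroups of $D$. Theorem. The following are equivalent for a closed subgroup $D$ of $G$: 1. $e\in\mathrm{oTr}_D^G(k[[G]]^D)$,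 and $D$ is minimal among the closed subgroups of $G$ with this property; 2. $|G:D|_p<\infty$ and $e\in\widetilde{\mathrm{Tr}}_D^G(k[[G]]^D)$, and $D$ is minimal among the closed subgroups of $G$ having these two properties; 3. $\delta(D)$ is a vertex of $B$ as a $k[[G\times G]]$-module; 4. $D$ is pro-$p$, $e\in\mathrm{oTr}_D^G(k[[G]]^D)$ and $\mathrm{Br}_D(e)\neq 0$; 5. $D$ is pro-$p$, $\mathrm{Br}_D(e)\neq 0$, and $D$ is maximal among the closed pro-$p$ subgroups of $G$ with this property. -/

import Mathlib

open Topology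

universe u v w

noncomputable section

namespace ProfiniteBlock

/-! ## The completed group algebra -/

section CompletedGroupAlgebra

variable (k : Type v) [Field k] {G : Type u} [Group G] [TopologicalSpace G]

theorem mapDomain_mapDomain {X Y Z : Type*} [Group X] [Group Y] [Group Z] (f : X →* Y) (g : Y →* Z)
    (x : MonoidAlgebra k X) :
    MonoidAlgebra.mapDomainAlgHom k k g (MonoidAlgebra.mapDomainAlgHom k k f x) =
      MonoidAlgebra.mapDomainAlgHom k k (g.comp f) x := by
  rw [MonoidAlgebra.mapDomainAlgHom_comp, AlgHom.comp_apply]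

theorem mapDomain_of {X Y : Type*} [Group X] [Group Y] (f : X →* Y) (x : X) :
    MonoidAlgebra.mapDomainAlgHom k k f (MonoidAlgebra.of k X x) = MonoidAlgebra.of k Y (f x) := by
  simp

/-- The canonical projection `G/N → G/M` for open normal subgroups `N ≤ M`. -/
def quotientMap {N M : OpenNormalSubgroup G} (h : N ≤ M) :
    G ⧸ N.toSubgroup →* G ⧸ M.toSubgroup :=
  QuotientGroup.map N.toSubgroup M.toSubgroup (MonoidHom.id G) (fun _ hg => h hg)

/-- The canonical projection `k[G/N] → k[G/M]` for open normal subgroups `N ≤ M`. -/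
def transition {N M : OpenNormalSubgroup G} (h : N ≤ M) :
    MonoidAlgebra k (G ⧸ N.toSubgroup) →ₐ[k] MonoidAlgebra k (G ⧸ M.toSubgroup) :=
  MonoidAlgebra.mapDomainAlgHom k k (quotientMap h)

variable (G) in
/-- The compatible families in `∏ N, k[G/N]`, `N` running over the open normal subgroups. -/
def compatibleFamilies :
    Subalgebra k (∀ N : OpenNormalSubgroup G, MonoidAlgebra k (G ⧸ N.toSubgroup)) where
  carrier := {x | ∀ (N M : OpenNormalSubgroup G) (h : N ≤ M), transition k h (x N) = x M}
  mul_mem' := by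
    intro a b ha hb N M h
    rw [Pi.mul_apply, map_mul, ha N M h, hb N M h, Pi.mul_apply]
  add_mem' := by
    intro a b ha hb N M h
    rw [Pi.add_apply, map_add, ha N M h, hb N M h, Pi.add_apply]
  algebraMap_mem' := by
    intro r N M h
    rw [Pi.algebraMap_apply, AlgHom.commutes, Pi.algebraMap_apply]

variable (G) in
/-- The completed group algebra `k[[G]] = lim k[G/N]`, `N` running over the open normal
subgroups of `G`. -/
def CompletedGroupAlgebra : Type (max u v) := ↥(compatibleFamilies k G)

namespace CompletedGroupAlgebra

instance : Ring (CompletedGroupAlgebra k G) := inferInstanceAs (Ring ↥(compatibleFamilies k G))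

instance : Algebra k (CompletedGroupAlgebra k G) :=
  inferInstanceAs (Algebra k ↥(compatibleFamilies k G))

/-- The canonical projection `φ_N : k[[G]] → k[G/N]`. -/
def proj (N : OpenNormalSubgroup G) :
    CompletedGroupAlgebra k G →ₐ[k] MonoidAlgebra k (G ⧸ N.toSubgroup) :=
  (Pi.evalAlgHom k (fun N : OpenNormalSubgroup G => MonoidAlgebra k (G ⧸ N.toSubgroup)) N).comp
    (compatibleFamilies k G).val

/-- The inverse limit topology, each `k[G/N]` being discrete. -/
instance : TopologicalSpace (CompletedGroupAlgebra k G) :=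
  ⨅ N : OpenNormalSubgroup G, TopologicalSpace.induced (proj k N) ⊥

variable {k}

@[ext]
theorem ext {x y : CompletedGroupAlgebra k G} (h : ∀ N, proj k N x = proj k N y) : x = y :=
  Subtype.ext (funext h)

theorem transition_proj (x : CompletedGroupAlgebra k G) {N M : OpenNormalSubgroup G} (h : N ≤ M) :
    transition k h (proj k N x) = proj k M x :=
  x.2 N M h

/-- The element of `k[[G]]` with given compatible components. -/
def mk (x : ∀ N : OpenNormalSubgroup G, MonoidAlgebra k (G ⧸ N.toSubgroup))
    (h : ∀ (N M : OpenNormalSubgroup G) (h : N ≤ M), transition k h (x N) = x M) :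
    CompletedGroupAlgebra k G := ⟨x, h⟩

@[simp]
theorem proj_mk (x : ∀ N : OpenNormalSubgroup G, MonoidAlgebra k (G ⧸ N.toSubgroup))
    (h : ∀ (N M : OpenNormalSubgroup G) (h : N ≤ M), transition k h (x N) = x M)
    (N : OpenNormalSubgroup G) : proj k N (mk x h) = x N := rfl

theorem continuous_iff_proj {X : Type w} [TopologicalSpace X] (f : X → CompletedGroupAlgebra k G) :
    Continuous f ↔ ∀ N, @Continuous _ _ _ ⊥ (fun a => proj k N (f a)) := by
  refine continuous_iInf_rng.trans (forall_congr' fun N => ?_)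
  exact continuous_induced_rng

theorem continuous_proj (N : OpenNormalSubgroup G) :
    @Continuous (CompletedGroupAlgebra k G) _ _ ⊥ (proj k N) :=
  (continuous_iff_proj _).1 continuous_id N

instance : IsTopologicalRing (CompletedGroupAlgebra k G) where
  continuous_add := by
    refine (continuous_iff_proj _).2 fun N => ?_
    let _ : TopologicalSpace (MonoidAlgebra k (G ⧸ N.toSubgroup)) := ⊥
    have : DiscreteTopology (MonoidAlgebra k (G ⧸ N.toSubgroup)) := ⟨rfl⟩
    have h := continuous_proj (k := k) N
    simp only [map_add]
    exact (h.comp continuous_fst).add (h.comp continuous_snd)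
  continuous_mul := by
    refine (continuous_iff_proj _).2 fun N => ?_
    let _ : TopologicalSpace (MonoidAlgebra k (G ⧸ N.toSubgroup)) := ⊥
    have : DiscreteTopology (MonoidAlgebra k (G ⧸ N.toSubgroup)) := ⟨rfl⟩
    have h := continuous_proj (k := k) N
    simp only [map_mul]
    exact (h.comp continuous_fst).mul (h.comp continuous_snd)
  continuous_neg := by
    refine (continuous_iff_proj _).2 fun N => ?_
    let _ : TopologicalSpace (MonoidAlgebra k (G ⧸ N.toSubgroup)) := ⊥
    have : DiscreteTopology (MonoidAlgebra k (G ⧸ N.toSubgroup)) := ⟨rfl⟩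
    have h := continuous_proj (k := k) N
    simp only [map_neg]
    exact continuous_of_discreteTopology.comp h

variable (k) in
/-- The canonical map `G → k[[G]]`. -/
def of : G →* CompletedGroupAlgebra k G where
  toFun g := mk (fun N => MonoidAlgebra.of k (G ⧸ N.toSubgroup) (g : G ⧸ N.toSubgroup)) (by
    intro N M h
    exact mapDomain_of k (quotientMap h) _)
  map_one' := by ext N : 1; simp [MonoidAlgebra.one_def]
  map_mul' g h := by ext N : 1; simp [MonoidAlgebra.single_mul_single]

@[simp]
theorem proj_of (N : OpenNormalSubgroup G) (g : G) :
    proj k N (of k g) = MonoidAlgebra.of k (G ⧸ N.toSubgroup) (g : G ⧸ N.toSubgroup) := rfl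

variable (k) in
/-- The inverse image of an open normal subgroup of `G` in a subgroup `H`. -/
def restrict (H : Subgroup G) (N : OpenNormalSubgroup G) : OpenNormalSubgroup H where
  toOpenSubgroup := N.toOpenSubgroup.comap H.subtype continuous_subtype_val
  isNormal' := N.isNormal'.comap H.subtype

variable (k) in
/-- The algebra homomorphism `k[[H]] → k[[G]]` induced by the inclusion of a subgroup `H`. -/
def incl (H : Subgroup G) : CompletedGroupAlgebra k H →ₐ[k] CompletedGroupAlgebra k G :=
  let c (N : OpenNormalSubgroup G) :
      CompletedGroupAlgebra k H →ₐ[k] MonoidAlgebra k (G ⧸ N.toSubgroup) :=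
    (MonoidAlgebra.mapDomainAlgHom k k
      (QuotientGroup.map (restrict H N).toSubgroup N.toSubgroup H.subtype le_rfl)).comp
      (proj k (restrict H N))
  AlgHom.codRestrict (AlgHom.pi c) (compatibleFamilies k G) (by
    intro x N M h
    have h' : restrict H N ≤ restrict H M := fun g hg => h hg
    show transition k h (MonoidAlgebra.mapDomainAlgHom k k _ (proj k (restrict H N) x)) =
      MonoidAlgebra.mapDomainAlgHom k k _ (proj k (restrict H M) x)
    rw [← transition_proj x h']
    unfold transition
    rw [mapDomain_mapDomain, mapDomain_mapDomain]
    congr 2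
    ext g
    rfl)

theorem incl_of (H : Subgroup G) (g : H) : incl k H (of k g) = of k (g : G) := by
  ext N : 1
  exact mapDomain_of k (QuotientGroup.map (restrict H N).toSubgroup N.toSubgroup H.subtype le_rfl) _

end CompletedGroupAlgebra

end CompletedGroupAlgebra

open CompletedGroupAlgebra

/-! ## `k[[G]]` as a `k[[G × G]]`-module -/

section Bimodule

variable {k : Type v} [Field k] {G : Type u} [Group G] [TopologicalSpace G]

variable (k) in
/-- `k[Γ]` as a `k[Γ × Γ]`-module: `(g₁, g₂)` acts by `x ↦ g₁ x g₂⁻¹`. -/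
def groupBimodule (Γ : Type u) [Group Γ] :
    MonoidAlgebra k (Γ × Γ) →ₐ[k] Module.End k (MonoidAlgebra k Γ) :=
  MonoidAlgebra.lift k (Module.End k (MonoidAlgebra k Γ)) (Γ × Γ)
    { toFun := fun g =>
        LinearMap.mulLeft k (MonoidAlgebra.of k Γ g.1) *
          LinearMap.mulRight k (MonoidAlgebra.of k Γ g.2⁻¹)
      map_one' := by
        refine LinearMap.ext fun x => ?_
        simp only [Prod.fst_one, Prod.snd_one, inv_one, map_one, LinearMap.mulLeft_one,
          LinearMap.mulRight_one]
        rfl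
      map_mul' := by
        intro g h
        refine LinearMap.ext fun x => ?_
        simp only [Prod.fst_mul, Prod.snd_mul, mul_inv_rev, map_mul, Module.End.mul_apply,
          LinearMap.mulLeft_apply, LinearMap.mulRight_apply, mul_assoc] }

theorem groupBimodule_of (Γ : Type u) [Group Γ] (g : Γ × Γ) (x : MonoidAlgebra k Γ) :
    groupBimodule k Γ (MonoidAlgebra.of k _ g) x =
      MonoidAlgebra.of k Γ g.1 * x * MonoidAlgebra.of k Γ g.2⁻¹ := by
  unfold groupBimodule
  rw [MonoidAlgebra.lift_of]
  simp only [MonoidHom.coe_mk, OneHom.coe_mk, Module.End.mul_apply, LinearMap.mulLeft_apply,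
    LinearMap.mulRight_apply, mul_assoc]

theorem groupBimodule_map {Γ Δ : Type u} [Group Γ] [Group Δ] (f : Γ →* Δ)
    (a : MonoidAlgebra k (Γ × Γ)) (x : MonoidAlgebra k Γ) :
    MonoidAlgebra.mapDomainAlgHom k k f (groupBimodule k Γ a x) =
      groupBimodule k Δ (MonoidAlgebra.mapDomainAlgHom k k (f.prodMap f) a)
        (MonoidAlgebra.mapDomainAlgHom k k f x) := by
  induction a using MonoidAlgebra.induction_on with
  | of g =>
    rw [groupBimodule_of, map_mul, map_mul]
    rw [mapDomain_of, mapDomain_of, mapDomain_of, groupBimodule_of, map_inv]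
    rfl
  | add a b ha hb => simp only [map_add, LinearMap.add_apply, ha, hb]
  | smul r a ha => simp only [map_smul, LinearMap.smul_apply, ha]

/-- Multiplication by central elements commutes with the two-sided action. -/
theorem groupBimodule_mul (Γ : Type u) [Group Γ] (a : MonoidAlgebra k (Γ × Γ))
    (x z : MonoidAlgebra k Γ) (hz : ∀ g : Γ, Commute z (MonoidAlgebra.of k Γ g)) :
    groupBimodule k Γ a (x * z) = groupBimodule k Γ a x * z := by
  induction a using MonoidAlgebra.induction_on with
  | of g =>
    rw [groupBimodule_of, groupBimodule_of]
    simp only [mul_assoc]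
    rw [(hz _).eq]
  | add a b ha hb => simp only [map_add, LinearMap.add_apply, ha, hb, add_mul]
  | smul r a ha => simp only [map_smul, LinearMap.smul_apply, ha, smul_mul_assoc]

/-- The open normal subgroup `N × N` of `G × G`. -/
def square (N : OpenNormalSubgroup G) : OpenNormalSubgroup (G × G) where
  toOpenSubgroup := N.toOpenSubgroup.prod N.toOpenSubgroup
  isNormal' := Subgroup.prod_normal N.toSubgroup N.toSubgroup

/-- The canonical map `(G × G)/(N × N) → G/N × G/N`. -/
def squareQuotient (N : OpenNormalSubgroup G) :
    (G × G) ⧸ (square N).toSubgroup →* (G ⧸ N.toSubgroup) × (G ⧸ N.toSubgroup) :=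
  QuotientGroup.lift (square N).toSubgroup
    ((QuotientGroup.mk' N.toSubgroup).prodMap (QuotientGroup.mk' N.toSubgroup)) (by
      rintro ⟨g, h⟩ ⟨hg, hh⟩
      exact Prod.ext ((QuotientGroup.eq_one_iff g).2 hg) ((QuotientGroup.eq_one_iff h).2 hh))

variable (k) in
/-- The canonical map `k[[G × G]] → k[G/N × G/N]`. -/
def squareProj (N : OpenNormalSubgroup G) :
    CompletedGroupAlgebra k (G × G) →ₐ[k]
      MonoidAlgebra k ((G ⧸ N.toSubgroup) × (G ⧸ N.toSubgroup)) :=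
  (MonoidAlgebra.mapDomainAlgHom k k (squareQuotient N)).comp (proj k (square N))

theorem squareProj_transition {N M : OpenNormalSubgroup G} (h : N ≤ M)
    (a : CompletedGroupAlgebra k (G × G)) :
    MonoidAlgebra.mapDomainAlgHom k k
        ((quotientMap h).prodMap (quotientMap h)) (squareProj k N a) = squareProj k M a := by
  have h' : square N ≤ square M := fun g hg => ⟨h hg.1, h hg.2⟩
  unfold squareProj
  rw [AlgHom.comp_apply, AlgHom.comp_apply, ← transition_proj a h']
  unfold transition
  rw [mapDomain_mapDomain, mapDomain_mapDomain]
  congr 2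
  ext g <;> rfl

/-- `k[[G]]` as a `k[[G × G]]`-module: `(g₁, g₂)` acts by `x ↦ g₁ x g₂⁻¹`. -/
instance bimodule : Module (CompletedGroupAlgebra k (G × G)) (CompletedGroupAlgebra k G) where
  smul a x := CompletedGroupAlgebra.mk
    (fun N => groupBimodule k (G ⧸ N.toSubgroup) (squareProj k N a) (proj k N x)) (by
      intro N M h
      show MonoidAlgebra.mapDomainAlgHom k k _ _ = _
      rw [groupBimodule_map, squareProj_transition, ← transition_proj x h]
      rfl)
  one_smul x := by
    ext N : 1
    show groupBimodule k _ (squareProj k N 1) (proj k N x) = _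
    simp
  mul_smul a b x := by
    ext N : 1
    show groupBimodule k _ (squareProj k N (a * b)) (proj k N x) =
      groupBimodule k _ (squareProj k N a) (groupBimodule k _ (squareProj k N b) (proj k N x))
    simp
  smul_zero a := by
    ext N : 1
    show groupBimodule k _ (squareProj k N a) (proj k N 0) = _
    simp
  smul_add a x y := by
    ext N : 1
    show groupBimodule k _ (squareProj k N a) (proj k N (x + y)) =
      groupBimodule k _ (squareProj k N a) (proj k N x) +
        groupBimodule k _ (squareProj k N a) (proj k N y)
    simp
  add_smul a b x := by
    ext N : 1
    show groupBimodule k _ (squareProj k N (a + b)) (proj k N x) =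
      groupBimodule k _ (squareProj k N a) (proj k N x) +
        groupBimodule k _ (squareProj k N b) (proj k N x)
    simp
  zero_smul x := by
    ext N : 1
    show groupBimodule k _ (squareProj k N 0) (proj k N x) = _
    simp

theorem proj_smul (N : OpenNormalSubgroup G) (a : CompletedGroupAlgebra k (G × G))
    (x : CompletedGroupAlgebra k G) :
    proj k N (a • x) = groupBimodule k (G ⧸ N.toSubgroup) (squareProj k N a) (proj k N x) := rfl

theorem of_smul (g₁ g₂ : G) (x : CompletedGroupAlgebra k G) :
    of k (g₁, g₂) • x = of k g₁ * x * of k g₂⁻¹ := by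
  ext N : 1
  have h : squareProj k N (of k (g₁, g₂)) =
      MonoidAlgebra.of k _ ((g₁ : G ⧸ N.toSubgroup), (g₂ : G ⧸ N.toSubgroup)) := by
    unfold squareProj
    rw [AlgHom.comp_apply, proj_of]
    simp [squareQuotient]
  rw [proj_smul, h, groupBimodule_of, map_mul, map_mul]
  rfl

end Bimodule

/-! ## Blocks -/

section Blocks

/-- `e` is a centrally primitive idempotent of `A`: a non-zero idempotent of the center `Z(A)`
that is not the sum of two non-zero orthogonal idempotents of `Z(A)`. -/
structure IsBlockIdempotent {A : Type w} [Ring A] (e : A) : Prop where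
  mem_center : e ∈ Subring.center A
  idem : IsIdempotentElem e
  ne_zero : e ≠ 0
  primitive : ∀ f ∈ Subring.center A, ∀ f' ∈ Subring.center A, IsIdempotentElem f →
    IsIdempotentElem f' → f * f' = 0 → f' * f = 0 → e = f + f' → f = 0 ∨ f' = 0

variable {k : Type v} [Field k] {G : Type u} [Group G] [TopologicalSpace G]

/-- The block `B = k[[G]] e` as a `k[[G × G]]`-submodule of `k[[G]]`; as a topological space it
carries the subspace topology. -/
def block (e : CompletedGroupAlgebra k G) (he : IsBlockIdempotent e) :
    Submodule (CompletedGroupAlgebra k (G × G)) (CompletedGroupAlgebra k G) where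
  carrier := {x | ∃ a, x = a * e}
  add_mem' := by
    rintro _ _ ⟨a, rfl⟩ ⟨b, rfl⟩
    exact ⟨a + b, (add_mul a b e).symm⟩
  zero_mem' := ⟨0, (zero_mul e).symm⟩
  smul_mem' := by
    rintro c _ ⟨a, rfl⟩
    refine ⟨c • a, ?_⟩
    ext N : 1
    rw [proj_smul, map_mul (proj k N) a e, map_mul (proj k N) (c • a) e, proj_smul]
    refine groupBimodule_mul _ _ _ _ fun g => ?_
    obtain ⟨g, rfl⟩ := QuotientGroup.mk_surjective g
    have h := Subring.mem_center_iff.1 he.mem_center (of k g)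
    have h' := congrArg (proj k N) h
    rw [map_mul, map_mul, proj_of] at h'
    exact h'.symm

end Blocks

/-! ## Fixed points and traces -/

section Trace

variable (k : Type v) [Field k] {Γ : Type u} [Group Γ] {A : Type w} [Ring A] [Algebra k A]

/-- The subalgebra `A^H` of fixed points of `H` acting on `A` by conjugation through `ι`. -/
def fixedPoints (ι : Γ →* A) (H : Subgroup Γ) : Subalgebra k A where
  carrier := {a | ∀ h ∈ H, ι h * a * ι h⁻¹ = a}
  mul_mem' := by
    intro a b ha hb h hh
    have h1 : ι h⁻¹ * ι h = 1 := by rw [← map_mul, inv_mul_cancel, map_one]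
    calc ι h * (a * b) * ι h⁻¹ = (ι h * a * 1) * b * ι h⁻¹ := by simp only [mul_one, mul_assoc]
      _ = (ι h * a * ι h⁻¹) * (ι h * b * ι h⁻¹) := by rw [← h1]; simp only [mul_assoc]
      _ = a * b := by rw [ha h hh, hb h hh]
  add_mem' := by
    intro a b ha hb h hh
    rw [mul_add, add_mul, ha h hh, hb h hh]
  algebraMap_mem' := by
    intro r h _
    rw [← Algebra.commutes, mul_assoc, ← map_mul, mul_inv_cancel, map_one, mul_one]

variable {k} in
theorem IsBlockIdempotent.mem_fixedPoints {e : A} (he : IsBlockIdempotent e) (ι : Γ →* A)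
    (H : Subgroup Γ) : e ∈ fixedPoints k ι H := by
  intro h _
  rw [Subring.mem_center_iff.1 he.mem_center, mul_assoc, ← map_mul, mul_inv_cancel, map_one,
    mul_one]

/-- The trace `Tr_H^L(a) = ∑ g a g⁻¹`, `g` running over representatives of the left cosets of `H`
in `L`, for `H ≤ L` of finite index and `a ∈ A^H`. -/
def trace (ι : Γ →* A) (H L : Subgroup Γ) (a : A) : A :=
  ∑ᶠ q : L ⧸ H.subgroupOf L, ι (q.out : Γ) * a * ι (q.out : Γ)⁻¹

end Trace

section ProfiniteTrace

variable {k : Type v} [Field k] {G : Type u} [Group G] [TopologicalSpace G]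

/-- The set `oTr_D^G(k[[G]]^D) = ⋂ N, Tr_{DN}^G(k[[G]]^{DN})`, `N` running over the open normal
subgroups of `G`. -/
def oTr (D : Subgroup G) : Set (CompletedGroupAlgebra k G) :=
  ⋂ N : OpenNormalSubgroup G,
    trace (of k) (D ⊔ N.toSubgroup) ⊤ '' (fixedPoints k (of k) (D ⊔ N.toSubgroup) : Set _)

/-- The exponent of `p` in the supernatural number `|G : H| = lcm |G : HN|`, `N` running over the
open normal subgroups of `G`. Thus `|G : H|_p` is finite iff this is not `⊤`. -/
def indexExponent (p : ℕ) (H : Subgroup G) : ℕ∞ :=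
  ⨆ N : OpenNormalSubgroup G, ((H ⊔ N.toSubgroup).index.factorization p : ℕ∞)

/-- `y` is the modified trace of `x ∈ k[[G]]^H`: for every open normal subgroup `N` of `G` with
`|G : HN|_p = |G : H|_p`, the component of `y` in `k[G/N]` is
`|G : HN|_{p'}⁻¹ Tr_{HN/N}^{G/N}(φ_N x)`. When `|G : H|_p` is finite these `N` are cofinal among the
open normal subgroups, so there is at most one such `y`. -/
def IsModifiedTrace (p : ℕ) (H : Subgroup G) (x y : CompletedGroupAlgebra k G) : Prop :=
  ∀ N : OpenNormalSubgroup G,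
    ((H ⊔ N.toSubgroup).index.factorization p : ℕ∞) = indexExponent p H →
      proj k N y = ((ordCompl[p] (H ⊔ N.toSubgroup).index : ℕ) : k)⁻¹ •
        trace (MonoidAlgebra.of k (G ⧸ N.toSubgroup)) (H.map (QuotientGroup.mk' N.toSubgroup)) ⊤
          (proj k N x)

/-- The image of `k[[G]]^H` under the modified trace, for `|G : H|_p` finite. -/
def modifiedTraceImage (p : ℕ) (H : Subgroup G) : Set (CompletedGroupAlgebra k G) :=
  {y | ∃ x ∈ fixedPoints k (of k) H, IsModifiedTrace p H x y}

end ProfiniteTrace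

/-! ## The Brauer homomorphism -/

section Brauer

/-- A profinite group is pro-`p` if its quotients by open normal subgroups are `p`-groups. -/
def IsProP (p : ℕ) (P : Type u) [Group P] [TopologicalSpace P] : Prop :=
  ∀ N : OpenNormalSubgroup P, IsPGroup p (P ⧸ N.toSubgroup)

variable {k : Type v} [Field k] {G : Type u} [Group G] [TopologicalSpace G]

variable (k) in
/-- The union of the sets `Tr_Q^D(k[[G]]^Q)`, `Q` running over the proper open subgroups of the
closed subgroup `D`. Each of these sets is an ideal of `k[[G]]^D`. -/
def properTraces (D : ClosedSubgroup G) : Set (fixedPoints k (of k) D.toSubgroup) :=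
  {y | ∃ Q : Subgroup G, Q < D.toSubgroup ∧ IsOpen (Q.subgroupOf D.toSubgroup : Set D.toSubgroup) ∧
    ∃ a ∈ fixedPoints k (of k) Q,
      (y : CompletedGroupAlgebra k G) = trace (of k) Q D.toSubgroup a}

theorem properTraces_mul [IsTopologicalGroup G] [CompactSpace G] (D : ClosedSubgroup G)
    {y : fixedPoints k (of k) D.toSubgroup} (hy : y ∈ properTraces k D)
    (b : fixedPoints k (of k) D.toSubgroup) : y * b ∈ properTraces k D := by
  obtain ⟨Q, hQ, hopen, a, ha, hya⟩ := hy
  refine ⟨Q, hQ, hopen, a * b, (fixedPoints k (of k) Q).mul_mem ha fun h hh => b.2 h (hQ.le hh), ?_⟩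
  have : CompactSpace D.toSubgroup := isCompact_iff_compactSpace.mp D.isClosed'.isCompact
  have : Finite (D.toSubgroup ⧸ Q.subgroupOf D.toSubgroup) :=
    Subgroup.quotient_finite_of_isOpen _ hopen
  show (y : CompletedGroupAlgebra k G) * b = _
  rw [hya, trace, trace, finsum_mul' _ _ (Set.toFinite _)]
  refine finsum_congr fun q => ?_
  have hb := b.2 (q.out : G) q.out.2
  have h1 : of k (q.out : G)⁻¹ * of k (q.out : G) = 1 := by
    rw [← map_mul, inv_mul_cancel, map_one]
  conv_lhs => rw [← hb]
  simp only [mul_assoc]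
  rw [← mul_assoc (of k (q.out : G)⁻¹) (of k (q.out : G)), h1, one_mul]

instance (H : Subgroup G) : IsTopologicalRing (fixedPoints k (of k) H) :=
  { (inferInstance : IsTopologicalSemiring (fixedPoints k (of k) H)) with
    continuous_neg := continuous_induced_rng.2 (continuous_neg.comp continuous_subtype_val) }

variable (k) in
/-- The ideal of `k[[G]]^D` that is the closure of `∑ Tr_Q^D(k[[G]]^Q)`, `Q` running over the proper
open subgroups of `D`. -/
def brauerIdeal (D : ClosedSubgroup G) : Ideal (fixedPoints k (of k) D.toSubgroup) :=
  (Ideal.span (properTraces k D)).closure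

instance brauerIdeal_isTwoSided [IsTopologicalGroup G] [CompactSpace G] (D : ClosedSubgroup G) :
    (brauerIdeal k D).IsTwoSided where
  mul_mem_of_left {a} b ha := by
    have ha' : a ∈ closure (Ideal.span (properTraces k D) : Set _) := ha
    have key : a * b ∈ closure (Ideal.span (properTraces k D) : Set _) := by
      refine map_mem_closure (f := fun x => x * b) (continuous_mul_const b) ha' fun x hx => ?_
      refine Submodule.span_induction (p := fun x _ => x * b ∈ Ideal.span (properTraces k D))
        ?_ ?_ ?_ ?_ hx
      · exact fun y hy => Ideal.subset_span (properTraces_mul D hy b)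
      · rw [zero_mul]
        exact zero_mem _
      · intro y z _ _ hy hz
        rw [add_mul]
        exact add_mem hy hz
      · intro c y _ hy
        rw [smul_eq_mul, mul_assoc]
        exact Ideal.mul_mem_left _ c hy
    exact key

variable (k) in
/-- The Brauer homomorphism `Br_D`: the projection of `k[[G]]^D` onto the Brauer quotient
`k[[G]]^[D]`. -/
def brauerHom [IsTopologicalGroup G] [CompactSpace G] (D : ClosedSubgroup G) :
    fixedPoints k (of k) D.toSubgroup →+* fixedPoints k (of k) D.toSubgroup ⧸ brauerIdeal k D :=
  Ideal.Quotient.mk (brauerIdeal k D)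

/-- The image `Br_D(e)` of a block idempotent. -/
def brauer [IsTopologicalGroup G] [CompactSpace G] (D : ClosedSubgroup G)
    {e : CompletedGroupAlgebra k G} (he : IsBlockIdempotent e) :
    fixedPoints k (of k) D.toSubgroup ⧸ brauerIdeal k D :=
  brauerHom k D ⟨e, he.mem_fixedPoints (of k) D.toSubgroup⟩

end Brauer

/-! ## Relative projectivity and vertices -/

section Vertex

/-- `O` is an open submodule of finite codimension. -/
def IsOpenCofinite (k : Type v) [Field k] {A : Type u} [Ring A] [Algebra k A]
    {V : Type w} [AddCommGroup V] [Module k V] [Module A V] [IsScalarTower k A V]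
    [TopologicalSpace V] (O : Submodule A V) : Prop :=
  IsOpen (O : Set V) ∧ Module.Finite k (V ⧸ O)

/-- A pseudocompact module over a topological `k`-algebra `A`: a topological `A`-module `V` in which
the open submodules of finite codimension form a basis of neighborhoods of `0` and intersect in `0`,
and which is the inverse limit of its quotients by them. -/
structure IsPseudocompactModule (k : Type v) [Field k] (A : Type u) [Ring A] [Algebra k A]
    [TopologicalSpace A] (V : Type w) [AddCommGroup V] [Module k V] [Module A V]
    [IsScalarTower k A V] [TopologicalSpace V] : Prop where
  isTopologicalAddGroup : IsTopologicalAddGroup V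
  continuousSMul : ContinuousSMul A V
  basis : ∀ s ∈ 𝓝 (0 : V), ∃ O : Submodule A V, IsOpenCofinite k O ∧ (O : Set V) ⊆ s
  separated : ∀ y : V, (∀ O : Submodule A V, IsOpenCofinite k O → y ∈ O) → y = 0
  complete : ∀ x : (∀ O : Submodule A V, V ⧸ O),
    (∀ (O O' : Submodule A V) (h : O ≤ O'), IsOpenCofinite k O → IsOpenCofinite k O' →
      Submodule.factor h (x O) = x O') →
    ∃ y : V, ∀ O : Submodule A V, IsOpenCofinite k O → Submodule.Quotient.mk y = x O

variable (k : Type v) [Field k] {G : Type u} [Group G] [TopologicalSpace G]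
  (U : Type w) [AddCommGroup U] [Module (CompletedGroupAlgebra k G) U] [TopologicalSpace U]

/-- A pseudocompact `k[[G]]`-module `U` is relatively `H`-projective if every diagram
`U → W ↞ V` of pseudocompact `k[[G]]`-modules and continuous homomorphisms that can be completed to
a commuting triangle by a continuous `k[[H]]`-module homomorphism `U → V` can be completed to one by
a continuous `k[[G]]`-module homomorphism `U → V`. -/
def IsRelativelyProjective (H : ClosedSubgroup G) : Prop :=
  ∀ (V W : Type (max u v)) [AddCommGroup V] [Module k V] [Module (CompletedGroupAlgebra k G) V]
    [IsScalarTower k (CompletedGroupAlgebra k G) V] [TopologicalSpace V]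
    [AddCommGroup W] [Module k W] [Module (CompletedGroupAlgebra k G) W]
    [IsScalarTower k (CompletedGroupAlgebra k G) W] [TopologicalSpace W],
    IsPseudocompactModule k (CompletedGroupAlgebra k G) V →
    IsPseudocompactModule k (CompletedGroupAlgebra k G) W →
    ∀ (β : V →L[CompletedGroupAlgebra k G] W) (φ : U →L[CompletedGroupAlgebra k G] W),
      Function.Surjective β →
      (∃ ψ : U →+ V, Continuous ψ ∧
        (∀ (a : CompletedGroupAlgebra k H.toSubgroup) (x : U),
          ψ (incl k H.toSubgroup a • x) = incl k H.toSubgroup a • ψ x) ∧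
        ∀ x, β (ψ x) = φ x) →
      ∃ ψ : U →L[CompletedGroupAlgebra k G] V, ∀ x, β (ψ x) = φ x

/-- `Q` is a vertex of the `k[[G]]`-module `U`. -/
def IsVertex (Q : ClosedSubgroup G) : Prop :=
  IsRelativelyProjective k U Q ∧ ∀ R : ClosedSubgroup G, R < Q → ¬ IsRelativelyProjective k U R

/-- The image `δ(D)` of `D` under the diagonal map `δ : G → G × G`. -/
def diagonal [T2Space G] (D : ClosedSubgroup G) : ClosedSubgroup (G × G) where
  toSubgroup := D.toSubgroup.map ((MonoidHom.id G).prod (MonoidHom.id G))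
  isClosed' := by
    have h : ((D.toSubgroup.map ((MonoidHom.id G).prod (MonoidHom.id G)) : Subgroup (G × G)) :
        Set (G × G)) = {z | z.1 = z.2} ∩ Prod.fst ⁻¹' (D.toSubgroup : Set G) := by
      ext ⟨a, b⟩
      constructor
      · rintro ⟨x, hx, h⟩
        obtain ⟨rfl, rfl⟩ := Prod.ext_iff.1 h
        exact ⟨rfl, hx⟩
      · rintro ⟨h, ha⟩
        exact ⟨a, ha, Prod.ext rfl h⟩
    show IsClosed ((D.toSubgroup.map ((MonoidHom.id G).prod (MonoidHom.id G)) : Subgroup (G × G)) :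
      Set (G × G))
    rw [h]
    exact (isClosed_eq continuous_fst continuous_snd).inter (D.isClosed'.preimage continuous_fst)

end Vertex

end ProfiniteBlock

end

open ProfiniteBlock

/-! Everything is reduced to the single condition $e\in\mathrm{oTr}_R^G$ and to the subgroups that
are minimal for it.

Two tools carry the proof. The first is linear compactness (`exists_forall_mem_of_complete`): affine
conditions at finite-dimensional levels that are solvable at each level, compatibly with the
transition maps, are solvable in the limit. It replaces the compactness of $k[[G]]$, which fails for
infinite $k$. The second is a Rosenberg-type lemma (`IsBlockIdempotent.exists_mul_eq_of_sum`): if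
$e$ is, up to an element vanishing at a level where $e$ survives, a finite sum of central elements,
then one of the summands divides $e$ in the center.

Modified traces. At level $N\ge M$ a trace from $RM$ is $|RN:RM|$ times a trace from $RN$. If
$z\in\mathrm{oTr}_R^G$ is non-zero at level $N$, this index is therefore prime to $p$. So $|G:R|_p$
is finite, and dividing by the $p'$-parts of the indices makes the traces compatible. For $z\ne 0$
the conditions behind (1) and (2) then agree (`mem_oTr_iff_mem_modifiedTraceImage`).

Vertices. A homomorphism from $B$ is given by a $\delta(G)$-fixed image of $e$. If $e$ is a trace
from each $DN$, averaging turns a $\delta(D)$-fixed vector into a $\delta(G)$-fixed one modulo any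
open submodule, and linear compactness removes the error. Conversely, testing projectivity on
$k[[G]]$-valued functions on $G/DN$ writes $e$ as a trace from $DN$. Hence $B$ is relatively
$\delta(D)$-projective exactly when $e\in\mathrm{oTr}_D^G$.

Brauer homomorphism. By Mackey, if $e\in\mathrm{oTr}_R^G$ and $\mathrm{Br}_P(e)\ne0$, then $P$ is
conjugate into $RN$ for every $N$ (`exists_conj_mem_of_brauer_ne_zero`), and compactness of $G$
yields the comparisons between (1), (4) and (5). The remaining point is `brauer_ne_zero_of_minimal`:
if $\mathrm{Br}_D(e)=0$, then $e$ is already a trace from $QM$ for all small $M$ and one proper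
$Q<D$, which contradicts minimality. -/

noncomputable section
namespace ProfiniteBlock

/-! ## Linear compactness -/

section LinearCompactness

/-- Linear compactness: in an inverse limit of finite-dimensional vector spaces, a directed family
of non-empty affine subspaces defined at finite levels has non-empty intersection. -/
theorem exists_forall_mem_of_complete {k V I : Type*} [Field k] [AddCommGroup V] [Module k V]
    [Preorder I] [Nonempty I] (hdir : ∀ i j : I, ∃ l, l ≤ i ∧ l ≤ j) {X : I → Type*}
    [∀ i, AddCommGroup (X i)] [∀ i, Module k (X i)] [∀ i, Module.Finite k (X i)]
    (π : ∀ i, V →ₗ[k] X i) (hπ : ∀ i, Function.Surjective (π i))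
    (hker : ∀ i j, i ≤ j → LinearMap.ker (π i) ≤ LinearMap.ker (π j))
    (complete : ∀ x : ∀ i, X i, (∀ i j, i ≤ j → ∀ v, π i v = x i → π j v = x j) →
      ∃ y, ∀ i, π i y = x i)
    (S : I → Set V) (hne : ∀ i, (S i).Nonempty)
    (haff : ∀ i, ∀ x ∈ S i, ∀ y ∈ S i, ∀ z ∈ S i, ∀ c : k, x + c • (y - z) ∈ S i)
    (hS : ∀ i, ∀ x ∈ S i, ∀ y, π i y = π i x → y ∈ S i)
    (hanti : ∀ i j, i ≤ j → S i ⊆ S j) :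
    ∃ y, ∀ i, y ∈ S i := by
  have huniq : ∀ (f : Module.Dual k V) (a b : k), (∃ i, ∀ x ∈ S i, f x = a) →
      (∃ i, ∀ x ∈ S i, f x = b) → a = b := by
    rintro f a b ⟨i, hi⟩ ⟨j, hj⟩
    obtain ⟨l, hli, hlj⟩ := hdir i j
    obtain ⟨x, hx⟩ := hne l
    rw [← hi x (hanti _ _ hli hx), hj x (hanti _ _ hlj hx)]
  have hadd : ∀ (f g : Module.Dual k V) (a b : k), (∃ i, ∀ x ∈ S i, f x = a) →
      (∃ i, ∀ x ∈ S i, g x = b) → ∃ i, ∀ x ∈ S i, (f + g) x = a + b := by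
    rintro f g a b ⟨i, hi⟩ ⟨j, hj⟩
    obtain ⟨l, hli, hlj⟩ := hdir i j
    refine ⟨l, fun x hx => ?_⟩
    rw [LinearMap.add_apply, hi x (hanti _ _ hli hx), hj x (hanti _ _ hlj hx)]
  have hsmul : ∀ (c : k) (f : Module.Dual k V) (a : k), (∃ i, ∀ x ∈ S i, f x = a) →
      ∃ i, ∀ x ∈ S i, (c • f) x = c * a := by
    rintro c f a ⟨i, hi⟩
    refine ⟨i, fun x hx => ?_⟩
    rw [LinearMap.smul_apply, hi x hx, smul_eq_mul]
  -- `P` consists of the functionals that are constant on some `S i`. Their value is linear on `P`,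
  -- and an extension `F` of it to the whole dual plays the role of evaluation at the point sought.
  let P : Submodule k (Module.Dual k V) :=
    { carrier := {f | ∃ a, ∃ i, ∀ x ∈ S i, f x = a}
      add_mem' := by
        rintro f g ⟨a, ha⟩ ⟨b, hb⟩
        exact ⟨a + b, hadd f g a b ha hb⟩
      zero_mem' := ⟨0, Classical.arbitrary I, fun x _ => rfl⟩
      smul_mem' := by
        rintro c f ⟨a, ha⟩
        exact ⟨c * a, hsmul c f a ha⟩ }
  choose val hval using fun f : P => f.2
  let c : P →ₗ[k] k :=
    { toFun := val
      map_add' := fun f g => huniq _ _ _ (hval (f + g)) (hadd _ _ _ _ (hval f) (hval g))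
      map_smul' := fun r f => huniq _ _ _ (hval (r • f)) (hsmul _ _ _ (hval f)) }
  obtain ⟨F, hF⟩ := LinearMap.exists_extend c
  have hFval : ∀ (f : Module.Dual k V) (a : k), (∃ i, ∀ x ∈ S i, f x = a) → F f = a := by
    intro f a h
    have h1 : F f = val ⟨f, a, h⟩ := LinearMap.congr_fun hF ⟨f, a, h⟩
    rw [h1]
    exact huniq f _ _ (hval ⟨f, a, h⟩) h
  -- Since `X i` is finite-dimensional, hence reflexive, `F` restricted to functionals factoring
  -- through `X i` is evaluation at a vector.
  have hy : ∀ i, ∃ y : X i, ∀ g : Module.Dual k (X i), F (g ∘ₗ π i) = g y := by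
    intro i
    refine ⟨(Module.evalEquiv k (X i)).symm (F ∘ₗ (π i).dualMap), fun g => ?_⟩
    rw [Module.apply_evalEquiv_symm_apply]
    rfl
  choose y hy using hy
  obtain ⟨v, hv⟩ := complete y (by
    intro i j hij v hv
    rw [← sub_eq_zero, ← Module.forall_dual_apply_eq_zero_iff k]
    intro g
    obtain ⟨s, hs⟩ := (π i).exists_rightInverse_of_surjective (LinearMap.range_eq_top.2 (hπ i))
    have key : ∀ w, π j (s (π i w)) = π j w := by
      intro w
      rw [← sub_eq_zero, ← map_sub]
      refine hker i j hij ?_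
      rw [LinearMap.mem_ker, map_sub, ← LinearMap.comp_apply (π i) s, hs, LinearMap.id_apply,
        sub_self]
    have h1 : g ∘ₗ π j = (g ∘ₗ π j ∘ₗ s) ∘ₗ π i := by
      ext w
      simp [key]
    rw [map_sub, ← hy j g, h1, hy i, ← hv]
    simp [key])
  refine ⟨v, fun i => ?_⟩
  obtain ⟨s, hs⟩ := hne i
  -- The direction space of the affine space `S i` at its point `s`.
  let Dir : Submodule k V :=
    { carrier := {u | s + u ∈ S i}
      add_mem' := by
        intro a b ha hb
        have := haff i _ ha _ hb _ hs 1
        simpa [add_assoc] using this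
      zero_mem' := by simpa using hs
      smul_mem' := by
        intro r a ha
        have := haff i _ hs _ ha _ hs r
        simpa using this }
  -- Otherwise a functional `f` vanishes on `Dir` but not on `v - s`. It is constant on `S i`, so `F
  -- f = f s`; it also factors through `X i`, because `Dir` contains the kernel of `π i`, so `F f =
  -- f v`.
  by_contra hvS
  have hvD : v - s ∉ Dir := fun h => hvS (by simpa [Dir] using h)
  obtain ⟨f, hf, hfD⟩ := Submodule.exists_le_ker_of_notMem hvD
  have hconst : ∀ x ∈ S i, f x = f s := by
    intro x hx
    have : x - s ∈ Dir := by simpa [Dir] using hx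
    have := hfD this
    rwa [LinearMap.mem_ker, map_sub, sub_eq_zero] at this
  obtain ⟨t, ht⟩ := (π i).exists_rightInverse_of_surjective (LinearMap.range_eq_top.2 (hπ i))
  have hft : f = (f ∘ₗ t) ∘ₗ π i := by
    ext w
    have : t (π i w) - w ∈ Dir := by
      show s + (t (π i w) - w) ∈ S i
      refine hS i s hs _ ?_
      rw [map_add, map_sub, ← LinearMap.comp_apply (π i) t, ht, LinearMap.id_apply, sub_self,
        add_zero]
    have := hfD this
    rw [LinearMap.mem_ker, map_sub, sub_eq_zero] at this
    exact this.symm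
  apply hf
  rw [map_sub, sub_eq_zero, ← hFval f (f s) ⟨i, hconst⟩]
  conv_lhs => rw [hft]
  conv_rhs => rw [hft]
  rw [hy i, ← hv]
  rfl

end LinearCompactness

/-! ## Generalities on `k[[G]]` -/

namespace CompletedGroupAlgebra

section General

variable {k : Type v} [Field k] {G : Type u} [Group G] [TopologicalSpace G]

variable (k) in
/-- The canonical map `G → k[G/N]`. -/
def ofQ (N : OpenNormalSubgroup G) : G →* MonoidAlgebra k (G ⧸ N.toSubgroup) :=
  (proj k N : CompletedGroupAlgebra k G →* _).comp (of k)

theorem proj_of' (N : OpenNormalSubgroup G) (g : G) : proj k N (of k g) = ofQ k N g := rfl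

theorem ofQ_apply (N : OpenNormalSubgroup G) (g : G) :
    ofQ k N g = MonoidAlgebra.of k (G ⧸ N.toSubgroup) (g : G ⧸ N.toSubgroup) := rfl

theorem ofQ_eq_one {N : OpenNormalSubgroup G} {g : G} (h : g ∈ N) : ofQ k N g = 1 := by
  rw [ofQ_apply, (QuotientGroup.eq_one_iff g).2 h, map_one]

theorem transition_ofQ {N M : OpenNormalSubgroup G} (h : N ≤ M) (g : G) :
    transition k h (ofQ k N g) = ofQ k M g := by
  rw [← proj_of', transition_proj, proj_of']

theorem induction_ofQ {N : OpenNormalSubgroup G} {P : MonoidAlgebra k (G ⧸ N.toSubgroup) → Prop}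
    (x : MonoidAlgebra k (G ⧸ N.toSubgroup)) (hof : ∀ g, P (ofQ k N g))
    (hadd : ∀ x y, P x → P y → P (x + y)) (hsmul : ∀ (r : k) x, P x → P (r • x)) : P x := by
  induction x using MonoidAlgebra.induction_on with
  | of g => obtain ⟨g, rfl⟩ := QuotientGroup.mk_surjective g; exact hof g
  | add a b ha hb => exact hadd a b ha hb
  | smul r a ha => exact hsmul r a ha

theorem exists_mem_span_of (N : OpenNormalSubgroup G) (x : MonoidAlgebra k (G ⧸ N.toSubgroup)) :
    ∃ y ∈ Submodule.span k (Set.range (of k : G → CompletedGroupAlgebra k G)), proj k N y = x := by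
  induction x using induction_ofQ with
  | hof g => exact ⟨of k g, Submodule.subset_span ⟨g, rfl⟩, rfl⟩
  | hadd a b ha hb =>
    obtain ⟨x, hx, rfl⟩ := ha
    obtain ⟨y, hy, rfl⟩ := hb
    exact ⟨x + y, add_mem hx hy, map_add _ _ _⟩
  | hsmul r a ha =>
    obtain ⟨x, hx, rfl⟩ := ha
    exact ⟨r • x, Submodule.smul_mem _ r hx, map_smul _ _ _⟩

theorem proj_surjective (N : OpenNormalSubgroup G) : Function.Surjective (proj k N) := fun x =>
  let ⟨y, _, hy⟩ := exists_mem_span_of N x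
  ⟨y, hy⟩

theorem transition_surjective {N M : OpenNormalSubgroup G} (h : N ≤ M) :
    Function.Surjective (transition k h) := fun x =>
  let ⟨y, hy⟩ := proj_surjective (k := k) M x
  ⟨proj k N y, by rw [transition_proj, hy]⟩

instance : Nonempty (OpenNormalSubgroup G) :=
  ⟨{ (⊤ : OpenSubgroup G) with isNormal' := inferInstanceAs (⊤ : Subgroup G).Normal }⟩

theorem directed_openNormalSubgroup (N M : OpenNormalSubgroup G) : ∃ L, L ≤ N ∧ L ≤ M :=
  ⟨N ⊓ M, inf_le_left, inf_le_right⟩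

/-- The neighborhoods of `0` for the initial topology of a directed family of maps to discrete
groups. -/
theorem hasBasis_nhds_zero_of_induced {V I : Type*} [AddCommGroup V] [Nonempty I]
    {X : I → Type*} [∀ i, AddCommGroup (X i)] (π : ∀ i, V →+ X i)
    (hdir : ∀ i j : I, ∃ l, (∀ v, π l v = 0 → π i v = 0) ∧ (∀ v, π l v = 0 → π j v = 0)) :
    (@nhds V (⨅ i, TopologicalSpace.induced (π i) ⊥) 0).HasBasis (fun _ => True)
      (fun i : I => {v | π i v = 0}) := by
  have h : @nhds V (⨅ i, TopologicalSpace.induced (π i) ⊥) 0 = ⨅ i, Filter.principal {v | π i v = 0} := by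
    rw [nhds_iInf]
    refine iInf_congr fun i => ?_
    rw [@nhds_induced _ _ ⊥, map_zero, show @nhds (X i) ⊥ 0 = pure 0 from congrFun (@nhds_discrete (X i) ⊥ (@DiscreteTopology.mk _ ⊥ rfl)) 0, Filter.comap_pure]
    rfl
  rw [h]
  refine Filter.hasBasis_iInf_principal fun i j => ?_
  obtain ⟨l, hi, hj⟩ := hdir i j
  exact ⟨l, hi, hj⟩

theorem hasBasis_nhds_zero : (𝓝 (0 : CompletedGroupAlgebra k G)).HasBasis (fun _ => True)
    (fun N : OpenNormalSubgroup G => {x | proj k N x = 0}) := by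
  refine hasBasis_nhds_zero_of_induced (fun N => (proj k N).toRingHom.toAddMonoidHom)
    fun N M => ⟨N ⊓ M, fun v hv => ?_, fun v hv => ?_⟩
  · show proj k N v = 0
    rw [← transition_proj v (inf_le_left : N ⊓ M ≤ N), show proj k (N ⊓ M) v = 0 from hv, map_zero]
  · show proj k M v = 0
    rw [← transition_proj v (inf_le_right : N ⊓ M ≤ M), show proj k (N ⊓ M) v = 0 from hv, map_zero]

theorem dense_span_of :
    Dense (Submodule.span k (Set.range (of k : G → CompletedGroupAlgebra k G)) :
      Set (CompletedGroupAlgebra k G)) := by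
  intro x
  rw [mem_closure_iff_nhds]
  intro t ht
  have : (fun y => x + y) ⁻¹' t ∈ 𝓝 (0 : CompletedGroupAlgebra k G) := by
    apply (continuous_const_add x).continuousAt
    simpa using ht
  obtain ⟨N, -, hN⟩ := hasBasis_nhds_zero.mem_iff.1 this
  obtain ⟨y, hy, hyx⟩ := exists_mem_span_of N (proj k N x)
  refine ⟨y, ?_, hy⟩
  have : y - x ∈ (fun y => x + y) ⁻¹' t := hN (by simp [hyx])
  simpa using this

/-- Group elements span a dense subspace, so identities between continuous linear maps need checking
on them only. -/
theorem linearMap_ext {V : Type*} [AddCommGroup V] [Module k V] [TopologicalSpace V] [T2Space V]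
    (f g : CompletedGroupAlgebra k G →ₗ[k] V) (hf : Continuous f) (hg : Continuous g)
    (h : ∀ x : G, f (of k x) = g (of k x)) (x : CompletedGroupAlgebra k G) : f x = g x := by
  refine congrFun (Continuous.ext_on dense_span_of hf hg fun y hy => ?_) x
  exact LinearMap.eqOn_span (by rintro _ ⟨x, rfl⟩; exact h x) hy

instance : T2Space (CompletedGroupAlgebra k G) := by
  refine ⟨fun x y hxy => ?_⟩
  obtain ⟨N, hN⟩ : ∃ N, proj k N x ≠ proj k N y := by
    by_contra! h
    exact hxy (ext h)
  let _ : TopologicalSpace (MonoidAlgebra k (G ⧸ N.toSubgroup)) := ⊥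
  have : DiscreteTopology (MonoidAlgebra k (G ⧸ N.toSubgroup)) := ⟨rfl⟩
  have hopen : ∀ z, IsOpen (proj k N ⁻¹' {z}) := fun z =>
    (isOpen_discrete _).preimage (continuous_proj N)
  refine ⟨_, _, hopen (proj k N x), hopen (proj k N y), rfl, rfl, ?_⟩
  rw [Set.disjoint_left]
  intro z hx hz
  exact hN (hx.symm.trans hz)

theorem mem_center_of_commute_of {z : CompletedGroupAlgebra k G}
    (h : ∀ g, of k g * z = z * of k g) : z ∈ Subring.center (CompletedGroupAlgebra k G) := by
  refine Subring.mem_center_iff.2 fun x => ?_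
  exact linearMap_ext (LinearMap.mulRight k z) (LinearMap.mulLeft k z) (continuous_mul_const z)
    (continuous_const_mul z) h x

theorem fixedPoints_le_center {z : CompletedGroupAlgebra k G}
    (h : z ∈ fixedPoints k (of k) (⊤ : Subgroup G)) :
    z ∈ Subring.center (CompletedGroupAlgebra k G) := by
  refine mem_center_of_commute_of fun g => ?_
  conv_rhs => rw [← h g trivial]
  rw [mul_assoc (_ * _), ← map_mul, inv_mul_cancel, map_one, mul_one]

theorem continuous_of [IsTopologicalGroup G] :
    Continuous (of k : G → CompletedGroupAlgebra k G) := by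
  refine (continuous_iff_proj _).2 fun N => ?_
  let _ : TopologicalSpace (MonoidAlgebra k (G ⧸ N.toSubgroup)) := ⊥
  have : DiscreteTopology (G ⧸ N.toSubgroup) :=
    QuotientGroup.discreteTopology N.toOpenSubgroup.isOpen'
  exact (continuous_of_discreteTopology (f := MonoidAlgebra.of k (G ⧸ N.toSubgroup))).comp
    QuotientGroup.continuous_mk

variable [IsTopologicalGroup G] [CompactSpace G]

instance (N : OpenNormalSubgroup G) : Finite (G ⧸ N.toSubgroup) :=
  Subgroup.quotient_finite_of_isOpen _ N.isOpen'

instance {Γ : Type*} [Finite Γ] : Module.Finite k (MonoidAlgebra k Γ) :=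
  Module.Finite.equiv (MonoidAlgebra.coeffLinearEquiv k).symm

/-- A finite system of unknowns in `k[[G]]` subject to affine conditions at the finite levels can be
solved if it can be solved at each level. -/
theorem exists_forall_proj_mem {T : Type*} [Finite T]
    (S : ∀ N : OpenNormalSubgroup G, Set (T → MonoidAlgebra k (G ⧸ N.toSubgroup)))
    (hne : ∀ N, (S N).Nonempty)
    (haff : ∀ N, ∀ x ∈ S N, ∀ y ∈ S N, ∀ z ∈ S N, ∀ c : k, x + c • (y - z) ∈ S N)
    (hanti : ∀ (N M : OpenNormalSubgroup G) (h : N ≤ M), ∀ x ∈ S N,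
      (fun t => transition k h (x t)) ∈ S M) :
    ∃ x : T → CompletedGroupAlgebra k G, ∀ N, (fun t => proj k N (x t)) ∈ S N := by
  let π (N : OpenNormalSubgroup G) : (T → CompletedGroupAlgebra k G) →ₗ[k]
      (T → MonoidAlgebra k (G ⧸ N.toSubgroup)) := (proj k N).toLinearMap.compLeft T
  have hπ : ∀ N, Function.Surjective (π N) := fun N x => by
    choose y hy using fun t => proj_surjective (k := k) N (x t)
    exact ⟨y, funext hy⟩
  have htr : ∀ (N M : OpenNormalSubgroup G) (h : N ≤ M) x t,
      transition k h (π N x t) = π M x t := fun N M h x t => transition_proj (x t) h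
  refine exists_forall_mem_of_complete directed_openNormalSubgroup π hπ ?_ ?_
    (fun N => {x | π N x ∈ S N}) ?_ ?_ ?_ ?_
  · intro N M h x hx
    rw [LinearMap.mem_ker] at hx ⊢
    ext1 t
    rw [← htr N M h, hx]
    exact map_zero _
  · intro x hx
    refine ⟨fun t => mk (fun N => x N t) fun N M h => ?_, fun N => rfl⟩
    obtain ⟨y, hy⟩ := hπ N (x N)
    rw [← hy, htr, hx N M h y hy]
  · intro N
    obtain ⟨x, hx⟩ := hne N
    obtain ⟨y, rfl⟩ := hπ N x
    exact ⟨y, hx⟩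
  · intro N x hx y hy z hz c
    show π N _ ∈ S N
    rw [map_add, map_smul, map_sub]
    exact haff N _ hx _ hy _ hz c
  · intro N x hx y hy
    show π N y ∈ S N
    rw [hy]
    exact hx
  · intro N M h x hx
    have := hanti N M h _ hx
    simp only [htr] at this
    exact this

end General

end CompletedGroupAlgebra

open CompletedGroupAlgebra

/-! ## Traces -/

section TraceLemmas

variable {k : Type v} [Field k] {Γ : Type u} [Group Γ] {A : Type w} [Ring A] [Algebra k A]

theorem finite_quotient_of_relIndex {H L : Subgroup Γ} (h : H.relIndex L ≠ 0) :
    Finite (L ⧸ H.subgroupOf L) :=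
  have : (H.subgroupOf L).FiniteIndex := ⟨h⟩
  inferInstance

/-- Conjugation by the image of a group element. -/
def conj (ι : Γ →* A) (g : Γ) : A →+* A where
  toFun a := ι g * a * ι g⁻¹
  map_one' := by rw [mul_one, ← map_mul, mul_inv_cancel, map_one]
  map_zero' := by rw [mul_zero, zero_mul]
  map_add' a b := by rw [mul_add, add_mul]
  map_mul' a b := by
    have h : ι g⁻¹ * ι g = 1 := by rw [← map_mul, inv_mul_cancel, map_one]
    simp only [mul_assoc]
    rw [← mul_assoc (ι g⁻¹) (ι g), h, one_mul]

theorem conj_apply (ι : Γ →* A) (g : Γ) (a : A) : conj ι g a = ι g * a * ι g⁻¹ := rfl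

theorem conj_mul_apply (ι : Γ →* A) (g h : Γ) (a : A) :
    conj ι (g * h) a = conj ι g (conj ι h a) := by
  rw [conj_apply, conj_apply, conj_apply, mul_inv_rev, map_mul, map_mul]
  simp only [mul_assoc]

theorem conj_one_apply (ι : Γ →* A) (a : A) : conj ι 1 a = a := by
  simp [conj_apply]

theorem conj_inv_conj (ι : Γ →* A) (g : Γ) (a : A) : conj ι g⁻¹ (conj ι g a) = a := by
  rw [← conj_mul_apply, inv_mul_cancel, conj_one_apply]

theorem conj_smul (ι : Γ →* A) (g : Γ) (c : k) (a : A) : conj ι g (c • a) = c • conj ι g a := by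
  simp only [conj_apply, mul_smul_comm, smul_mul_assoc]

theorem mem_fixedPoints_iff {ι : Γ →* A} {H : Subgroup Γ} {a : A} :
    a ∈ fixedPoints k ι H ↔ ∀ h ∈ H, conj ι h a = a := Iff.rfl

theorem fixedPoints_anti {ι : Γ →* A} {H K : Subgroup Γ} (h : H ≤ K) :
    fixedPoints k ι K ≤ fixedPoints k ι H := fun _ ha x hx => ha x (h hx)

theorem conj_eq_of_mem_center {ι : Γ →* A} {a : A} (ha : a ∈ Subring.center A) (g : Γ) :
    conj ι g a = a := by
  rw [conj_apply, Subring.mem_center_iff.1 ha, mul_assoc, ← map_mul, mul_inv_cancel, map_one,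
    mul_one]

theorem center_le_fixedPoints (ι : Γ →* A) (H : Subgroup Γ) {a : A}
    (ha : a ∈ Subring.center A) : a ∈ fixedPoints k ι H := fun h _ => conj_eq_of_mem_center ha h

theorem map_conj {B : Type*} [Ring B] (π : A →+* B) {ι : Γ →* A} {ι' : Γ →* B}
    (hπ : ∀ g, π (ι g) = ι' g) (g : Γ) (a : A) : π (conj ι g a) = conj ι' g (π a) := by
  simp only [conj_apply, map_mul, hπ]

theorem map_mem_fixedPoints {B : Type*} [Ring B] [Algebra k B] (π : A →ₐ[k] B) {ι : Γ →* A}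
    {ι' : Γ →* B} (hπ : ∀ g, π (ι g) = ι' g) {H : Subgroup Γ} {a : A}
    (ha : a ∈ fixedPoints k ι H) : π a ∈ fixedPoints k ι' H := fun h hh => by
  have := map_conj (π : A →+* B) hπ h a
  rw [mem_fixedPoints_iff.1 ha h hh] at this
  exact this.symm

/-- The trace as a sum over an orbit. -/
theorem trace_eq_finsum_orbit (ι : Γ →* A) {X : Type*} [MulAction Γ X] (H L : Subgroup Γ) (x₀ : X)
    (F : X → A) (hF : ∀ l ∈ L, F (l • x₀) = conj ι l (F x₀))
    (hstab : ∀ l ∈ L, l • x₀ = x₀ ↔ l ∈ H) :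
    trace ι H L (F x₀) = ∑ᶠ x ∈ {x | ∃ l ∈ L, l • x₀ = x}, F x := by
  let f : L ⧸ H.subgroupOf L → X := fun q => (q.out : Γ) • x₀
  have key : ∀ l l' : L, ((l : Γ) • x₀ = (l' : Γ) • x₀) ↔
      (l : L ⧸ H.subgroupOf L) = (l' : L ⧸ H.subgroupOf L) := by
    intro l l'
    rw [QuotientGroup.eq, Subgroup.mem_subgroupOf, ← hstab _ (l⁻¹ * l').2, Subgroup.coe_mul,
      Subgroup.coe_inv, mul_smul, inv_smul_eq_iff, eq_comm]
  have hf : Function.Injective f := by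
    intro q q' h
    have := (key q.out q'.out).1 h
    rwa [QuotientGroup.out_eq', QuotientGroup.out_eq'] at this
  have hr : {x | ∃ l ∈ L, l • x₀ = x} = Set.range f := by
    ext x
    constructor
    · rintro ⟨l, hl, rfl⟩
      refine ⟨((⟨l, hl⟩ : L) : L ⧸ H.subgroupOf L), ?_⟩
      exact (key _ ⟨l, hl⟩).2 (QuotientGroup.out_eq' _)
    · rintro ⟨q, rfl⟩
      exact ⟨q.out, q.out.2, rfl⟩
  rw [hr, finsum_mem_range hf]
  exact finsum_congr fun q => (hF _ q.out.2).symm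

theorem trace_eq_finsum (ι : Γ →* A) {X : Type*} [MulAction Γ X] (H : Subgroup Γ) (x₀ : X)
    (F : X → A) (hF : ∀ l : Γ, F (l • x₀) = conj ι l (F x₀))
    (hstab : ∀ l : Γ, l • x₀ = x₀ ↔ l ∈ H) (htrans : ∀ x, ∃ l : Γ, l • x₀ = x) :
    trace ι H ⊤ (F x₀) = ∑ᶠ x, F x := by
  have hs : {x | ∃ l ∈ (⊤ : Subgroup Γ), l • x₀ = x} = Set.univ :=
    Set.eq_univ_of_forall fun x => by
      obtain ⟨l, hl⟩ := htrans x
      exact ⟨l, trivial, hl⟩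
  rw [trace_eq_finsum_orbit ι H ⊤ x₀ F (fun l _ => hF l) (fun l _ => hstab l), hs, finsum_mem_univ]

/-- The function `gH ↦ ᵍa` on `Γ/H`, for `a` fixed by `H`. -/
def cosetFun (ι : Γ →* A) (H : Subgroup Γ) (a : A) (x : Γ ⧸ H) : A := conj ι x.out a

theorem cosetFun_mk {ι : Γ →* A} {H : Subgroup Γ} {a : A} (ha : a ∈ fixedPoints k ι H) (g : Γ) :
    cosetFun ι H a (g : Γ ⧸ H) = conj ι g a := by
  obtain ⟨h, hh⟩ := QuotientGroup.mk_out_eq_mul H g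
  rw [cosetFun, hh, conj_mul_apply, mem_fixedPoints_iff.1 ha h h.2]

theorem cosetFun_smul {ι : Γ →* A} {H : Subgroup Γ} {a : A} (ha : a ∈ fixedPoints k ι H) (g : Γ)
    (x : Γ ⧸ H) : cosetFun ι H a (g • x) = conj ι g (cosetFun ι H a x) := by
  obtain ⟨x, rfl⟩ := QuotientGroup.mk_surjective x
  rw [MulAction.Quotient.smul_coe, cosetFun_mk ha, cosetFun_mk ha, smul_eq_mul, conj_mul_apply]

theorem smul_coset_one_eq_iff {H : Subgroup Γ} (g : Γ) :
    g • ((1 : Γ) : Γ ⧸ H) = ((1 : Γ) : Γ ⧸ H) ↔ g ∈ H := by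
  rw [MulAction.Quotient.smul_coe, smul_eq_mul, mul_one, eq_comm, QuotientGroup.eq, inv_one,
    one_mul]

theorem trace_eq_finsum_coset {ι : Γ →* A} {H : Subgroup Γ} {a : A} (ha : a ∈ fixedPoints k ι H)
    (Q L : Subgroup Γ) (hQ : ∀ l ∈ L, l ∈ Q ↔ l ∈ H) :
    trace ι Q L a = ∑ᶠ x ∈ {x : Γ ⧸ H | ∃ l ∈ L, (l : Γ ⧸ H) = x}, cosetFun ι H a x := by
  have h1 : cosetFun ι H a ((1 : Γ) : Γ ⧸ H) = a := by rw [cosetFun_mk ha, conj_one_apply]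
  have := trace_eq_finsum_orbit ι Q L ((1 : Γ) : Γ ⧸ H) (cosetFun ι H a)
    (fun l _ => cosetFun_smul ha l _) (fun l hl => (smul_coset_one_eq_iff l).trans (hQ l hl).symm)
  simpa only [h1, MulAction.Quotient.smul_coe, smul_eq_mul, mul_one] using this

/-- The hypotheses say that $D\cap Q=D\cap Q'$ and $D'\subseteq DQ'$, so both traces sum over the
same subset of $\Gamma/Q'$. -/
theorem trace_congr_subgroup {ι : Γ →* A} {Q Q' D D' : Subgroup Γ} {a : A}
    (ha : a ∈ fixedPoints k ι Q') (hD : D ≤ D') (hQ : ∀ d ∈ D, d ∈ Q ↔ d ∈ Q')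
    (hDQ : ∀ d' ∈ D', ∃ d ∈ D, d⁻¹ * d' ∈ Q') : trace ι Q D a = trace ι Q' D' a := by
  rw [trace_eq_finsum_coset ha Q D hQ, trace_eq_finsum_coset ha Q' D' fun _ _ => Iff.rfl]
  congr 1
  ext x
  have : (∃ l ∈ D, (l : Γ ⧸ Q') = x) ↔ ∃ l ∈ D', (l : Γ ⧸ Q') = x := by
    constructor
    · rintro ⟨l, hl, h⟩
      exact ⟨l, hD hl, h⟩
    · rintro ⟨l, hl, rfl⟩
      obtain ⟨d, hd, h⟩ := hDQ l hl
      exact ⟨d, hd, QuotientGroup.eq.2 h⟩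
  simp only [Set.mem_ofPred_eq, this]

theorem finite_cosets {H L : Subgroup Γ} (h : H.relIndex L ≠ 0) :
    {x : Γ ⧸ H | ∃ l ∈ L, (l : Γ ⧸ H) = x}.Finite := by
  have : Finite (L ⧸ H.subgroupOf L) := finite_quotient_of_relIndex h
  have h : {x : Γ ⧸ H | ∃ l ∈ L, (l : Γ ⧸ H) = x} ⊆
      Set.range fun q : L ⧸ H.subgroupOf L => ((q.out : Γ) : Γ ⧸ H) := by
    rintro _ ⟨l, hl, rfl⟩
    refine ⟨((⟨l, hl⟩ : L) : L ⧸ H.subgroupOf L), ?_⟩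
    have := QuotientGroup.out_eq' ((⟨l, hl⟩ : L) : L ⧸ H.subgroupOf L)
    rw [QuotientGroup.eq] at this
    exact QuotientGroup.eq.2 (by simpa [Subgroup.mem_subgroupOf] using this)
  exact (Set.finite_range _).subset h

theorem conj_trace_mem {ι : Γ →* A} {H L : Subgroup Γ} (hfin : H.relIndex L ≠ 0) {a : A}
    (ha : a ∈ fixedPoints k ι H) : trace ι H L a ∈ fixedPoints k ι L := by
  intro l hl
  show conj ι l _ = _
  rw [trace_eq_finsum_coset ha H L fun _ _ => Iff.rfl]
  show (conj ι l : A →+ A) _ = _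
  rw [AddMonoidHom.map_finsum_mem _ _ (finite_cosets hfin)]
  refine finsum_mem_eq_of_bijOn (fun x => l • x) ⟨?_, ?_, ?_⟩ fun x _ => (cosetFun_smul ha l x).symm
  · rintro _ ⟨m, hm, rfl⟩
    exact ⟨l * m, mul_mem hl hm, rfl⟩
  · exact (MulAction.injective l).injOn
  · rintro _ ⟨m, hm, rfl⟩
    refine ⟨((l⁻¹ * m : Γ) : Γ ⧸ H), ⟨_, mul_mem (inv_mem hl) hm, rfl⟩, ?_⟩
    show l • _ = _
    rw [MulAction.Quotient.smul_coe, smul_eq_mul, mul_inv_cancel_left]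

/-- The cosets of `H` in `L` are partitioned according to the coset $lK$ that contains them, and
translation by $l$ identifies the fibre over $lK$ with $K/H$. -/
theorem trace_trace {ι : Γ →* A} {H K L : Subgroup Γ} (hHK : H ≤ K) (hKL : K ≤ L)
    (hfin : H.relIndex L ≠ 0) {a : A} (ha : a ∈ fixedPoints k ι H) :
    trace ι K L (trace ι H K a) = trace ι H L a := by
  have hmul := Subgroup.relIndex_mul_relIndex H K L hHK hKL
  have hfin1 : H.relIndex K ≠ 0 := fun h => hfin (by rw [← hmul, h, zero_mul])
  have hfin2 : K.relIndex L ≠ 0 := fun h => hfin (by rw [← hmul, h, mul_zero])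
  have hb := conj_trace_mem (k := k) hfin1 ha
  let p : Γ ⧸ H → Γ ⧸ K := Subgroup.quotientMapOfLE hHK
  have hp : ∀ g : Γ, p (g : Γ ⧸ H) = (g : Γ ⧸ K) := fun g => rfl
  rw [trace_eq_finsum_coset hb K L fun _ _ => Iff.rfl, trace_eq_finsum_coset ha H L fun _ _ => Iff.rfl]
  have hset : {x : Γ ⧸ H | ∃ l ∈ L, (l : Γ ⧸ H) = x} =
      ⋃ y ∈ {y : Γ ⧸ K | ∃ l ∈ L, (l : Γ ⧸ K) = y},
        {x : Γ ⧸ H | (∃ l ∈ L, (l : Γ ⧸ H) = x) ∧ p x = y} := by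
    ext x
    simp only [Set.mem_ofPred_eq, Set.mem_iUnion, exists_prop]
    constructor
    · rintro ⟨l, hl, rfl⟩
      exact ⟨l, ⟨l, hl, rfl⟩, ⟨l, hl, rfl⟩, rfl⟩
    · rintro ⟨_, _, h, _⟩
      exact h
  rw [hset, finsum_mem_biUnion]
  · refine finsum_mem_congr rfl ?_
    rintro _ ⟨l, hl, rfl⟩
    rw [cosetFun_mk hb, trace_eq_finsum_coset ha H K fun _ _ => Iff.rfl]
    show (conj ι l : A →+ A) _ = _
    rw [AddMonoidHom.map_finsum_mem _ _ (finite_cosets hfin1)]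
    refine finsum_mem_eq_of_bijOn (fun x => l • x) ⟨?_, ?_, ?_⟩
      fun x _ => (cosetFun_smul ha l x).symm
    · rintro _ ⟨m, hm, rfl⟩
      refine ⟨⟨l * m, mul_mem hl (hKL hm), rfl⟩, ?_⟩
      show ((l * m : Γ) : Γ ⧸ K) = l
      rw [eq_comm, QuotientGroup.eq, inv_mul_cancel_left]
      exact hm
    · exact (MulAction.injective l).injOn
    · rintro _ ⟨⟨m, hm, rfl⟩, h⟩
      refine ⟨((l⁻¹ * m : Γ) : Γ ⧸ H), ⟨_, QuotientGroup.eq.1 (h.symm), rfl⟩, ?_⟩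
      show l • _ = _
      rw [MulAction.Quotient.smul_coe, smul_eq_mul, mul_inv_cancel_left]
  · intro y _ y' _ hne
    rw [Function.onFun, Set.disjoint_left]
    rintro x ⟨_, rfl⟩ ⟨_, h⟩
    exact hne h
  · exact finite_cosets hfin2
  · exact fun y _ => (finite_cosets hfin).subset fun x hx => hx.1

theorem trace_of_mem_fixedPoints {ι : Γ →* A} {H K : Subgroup Γ} (hfin : H.relIndex K ≠ 0) {a : A}
    (ha : a ∈ fixedPoints k ι K) : trace ι H K a = H.relIndex K • a := by
  have : Finite (K ⧸ H.subgroupOf K) := finite_quotient_of_relIndex hfin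
  have := Fintype.ofFinite (K ⧸ H.subgroupOf K)
  rw [trace, finsum_eq_sum_of_fintype, Finset.sum_congr rfl fun q _ => ha _ q.out.2,
    Finset.sum_const, Finset.card_univ, Subgroup.relIndex, Subgroup.index, Nat.card_eq_fintype_card]

theorem trace_add {ι : Γ →* A} {H L : Subgroup Γ} (hfin : H.relIndex L ≠ 0) (a b : A) :
    trace ι H L (a + b) = trace ι H L a + trace ι H L b := by
  have : Finite (L ⧸ H.subgroupOf L) := finite_quotient_of_relIndex hfin
  rw [trace, trace, trace, ← finsum_add_distrib (Set.toFinite _) (Set.toFinite _)]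
  exact finsum_congr fun q => map_add (conj ι (q.out : Γ)) a b

theorem trace_smul {ι : Γ →* A} {H L : Subgroup Γ} (c : k) (a : A) :
    trace ι H L (c • a) = c • trace ι H L a := by
  rw [trace, trace, smul_finsum]
  exact finsum_congr fun q => conj_smul ι (q.out : Γ) c a

/-- The source of all divisibility arguments below: tracing from a subgroup smaller than one already
fixing `a` costs the factor $|K:H|$, which is zero in `k` as soon as $p$ divides it. -/
theorem trace_eq_relIndex_smul {ι : Γ →* A} {H K L : Subgroup Γ} (hHK : H ≤ K) (hKL : K ≤ L)
    (hfin : H.relIndex L ≠ 0) {a : A} (ha : a ∈ fixedPoints k ι K) :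
    trace ι H L a = H.relIndex K • trace ι K L a := by
  have hmul := Subgroup.relIndex_mul_relIndex H K L hHK hKL
  have hfin1 : H.relIndex K ≠ 0 := fun h => hfin (by rw [← hmul, h, zero_mul])
  rw [← trace_trace hHK hKL hfin (fixedPoints_anti hHK ha), trace_of_mem_fixedPoints hfin1 ha,
    ← Nat.cast_smul_eq_nsmul k, trace_smul, Nat.cast_smul_eq_nsmul]

/-- The trace as a linear map. -/
def traceLinearMap (ι : Γ →* A) {H L : Subgroup Γ} (hfin : H.relIndex L ≠ 0) : A →ₗ[k] A where
  toFun := trace ι H L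
  map_add' := trace_add hfin
  map_smul' := trace_smul

theorem trace_mul {ι : Γ →* A} {H L : Subgroup Γ} (hfin : H.relIndex L ≠ 0) (a : A) {b : A}
    (hb : b ∈ fixedPoints k ι L) : trace ι H L (a * b) = trace ι H L a * b := by
  have : Finite (L ⧸ H.subgroupOf L) := finite_quotient_of_relIndex hfin
  rw [trace, trace, finsum_mul' _ _ (Set.toFinite _)]
  refine finsum_congr fun q => ?_
  rw [← conj_apply, map_mul, mem_fixedPoints_iff.1 hb _ q.out.2]
  rfl

theorem mul_trace {ι : Γ →* A} {H L : Subgroup Γ} (hfin : H.relIndex L ≠ 0) (a : A) {b : A}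
    (hb : b ∈ fixedPoints k ι L) : trace ι H L (b * a) = b * trace ι H L a := by
  have : Finite (L ⧸ H.subgroupOf L) := finite_quotient_of_relIndex hfin
  rw [trace, trace, mul_finsum' _ _ (Set.toFinite _)]
  refine finsum_congr fun q => ?_
  rw [← conj_apply, map_mul, mem_fixedPoints_iff.1 hb _ q.out.2]
  rfl

theorem map_trace {B : Type*} [Ring B] (π : A →+* B) {ι : Γ →* A} {ι' : Γ →* B}
    (hπ : ∀ g, π (ι g) = ι' g) {H L : Subgroup Γ} (hfin : H.relIndex L ≠ 0) (a : A) :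
    π (trace ι H L a) = trace ι' H L (π a) := by
  have : Finite (L ⧸ H.subgroupOf L) := finite_quotient_of_relIndex hfin
  have h := (π : A →+ B).map_finsum (Set.toFinite (Function.support
    (fun q : L ⧸ H.subgroupOf L => ι (q.out : Γ) * a * ι (q.out : Γ)⁻¹)))
  refine h.trans (finsum_congr fun q => ?_)
  exact map_conj π hπ _ _

theorem trace_conj {ι : Γ →* A} {H H' : Subgroup Γ} (g : Γ) (hH' : ∀ x, x ∈ H' ↔ g⁻¹ * x * g ∈ H)
    {a : A} (ha : a ∈ fixedPoints k ι H) : trace ι H' ⊤ (conj ι g a) = trace ι H ⊤ a := by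
  have h1 := trace_eq_finsum ι H' (g : Γ ⧸ H) (cosetFun ι H a) (fun l => cosetFun_smul ha l _)
    (fun l => by
      rw [MulAction.Quotient.smul_coe, smul_eq_mul, eq_comm, QuotientGroup.eq, ← mul_assoc, hH'])
    (fun x => by
      obtain ⟨x, rfl⟩ := QuotientGroup.mk_surjective x
      exact ⟨x * g⁻¹, by rw [MulAction.Quotient.smul_coe, smul_eq_mul, inv_mul_cancel_right]⟩)
  have h2 := trace_eq_finsum ι H ((1 : Γ) : Γ ⧸ H) (cosetFun ι H a)
    (fun l => cosetFun_smul ha l _) (fun l => smul_coset_one_eq_iff l)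
    (fun x => by
      obtain ⟨x, rfl⟩ := QuotientGroup.mk_surjective x
      exact ⟨x, by rw [MulAction.Quotient.smul_coe, smul_eq_mul, mul_one]⟩)
  rw [cosetFun_mk ha] at h1 h2
  rw [conj_one_apply] at h2
  rw [h1, h2]

/-- Mackey's formula: the trace from `K` is a sum of traces to `L` from the groups `L ∩ ᵍK`. -/
theorem trace_mem_of_mackey {ι : Γ →* A} {K : Subgroup Γ} [K.FiniteIndex] (L : Subgroup Γ) {a : A}
    (ha : a ∈ fixedPoints k ι K) (S : AddSubgroup A)
    (h : ∀ (g : Γ) (Q : Subgroup Γ), Q ≤ L → (∀ l ∈ L, l ∈ Q ↔ g⁻¹ * l * g ∈ K) →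
      trace ι Q L (conj ι g a) ∈ S) : trace ι K ⊤ a ∈ S := by
  classical
  have := Fintype.ofFinite (Γ ⧸ K)
  have h2 := trace_eq_finsum ι K ((1 : Γ) : Γ ⧸ K) (cosetFun ι K a)
    (fun l => cosetFun_smul ha l _) (fun l => smul_coset_one_eq_iff l)
    (fun x => by
      obtain ⟨x, rfl⟩ := QuotientGroup.mk_surjective x
      exact ⟨x, by rw [MulAction.Quotient.smul_coe, smul_eq_mul, mul_one]⟩)
  rw [cosetFun_mk ha, conj_one_apply] at h2
  have := Fintype.ofFinite (MulAction.orbitRel.Quotient L (Γ ⧸ K))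
  rw [h2, finsum_eq_sum_of_fintype,
    ← Finset.sum_fiberwise (Finset.univ : Finset (Γ ⧸ K))
      (fun x => (Quotient.mk'' x : MulAction.orbitRel.Quotient L (Γ ⧸ K)))]
  refine sum_mem fun ω _ => ?_
  induction ω using Quotient.inductionOn' with
  | h x =>
  obtain ⟨g, rfl⟩ := QuotientGroup.mk_surjective x
  let Q : Subgroup Γ := L ⊓ K.map (MulAut.conj g).toMonoidHom
  have hQ : ∀ l ∈ L, l ∈ Q ↔ g⁻¹ * l * g ∈ K := by
    intro l hl
    constructor
    · rintro ⟨-, x, hx, rfl⟩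
      have : g⁻¹ * (g * x * g⁻¹) * g = x := by group
      simpa [this] using hx
    · intro h
      exact ⟨hl, _, h, by simp [mul_assoc]⟩
  have h3 := trace_eq_finsum_orbit ι Q L (g : Γ ⧸ K) (cosetFun ι K a)
    (fun l _ => cosetFun_smul ha l _) (fun l hl => by
      rw [MulAction.Quotient.smul_coe, smul_eq_mul, eq_comm, QuotientGroup.eq, ← mul_assoc, hQ l hl])
  rw [cosetFun_mk ha] at h3
  have h4 := h g Q inf_le_left hQ
  rw [h3] at h4
  convert h4 using 1
  rw [← finsum_mem_coe_finset]
  refine finsum_mem_congr ?_ fun _ _ => rfl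
  ext x
  simp only [Finset.coe_filter, Finset.mem_univ, true_and, Set.mem_ofPred_eq]
  rw [Quotient.eq'', MulAction.orbitRel_apply, MulAction.mem_orbit_iff]
  constructor
  · rintro ⟨l, rfl⟩
    exact ⟨l, l.2, rfl⟩
  · rintro ⟨l, hl, rfl⟩
    exact ⟨⟨l, hl⟩, rfl⟩

end TraceLemmas

/-! ## The center of a block is local -/

section Local

/-- `f` is the Fitting idempotent of the central element `z`, and `w` is the inverse of `z` on the
image of `f`. -/
structure IsFittingPair {R : Type*} [Ring R] (z f w : R) : Prop where
  f_mem : f ∈ Subring.center R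
  w_mem : w ∈ Subring.center R
  mul_w : z * w = f
  f_mul_w : f * w = w
  idem : f * f = f
  nil : ∃ n, z ^ n * (1 - f) = 0

/-- The center is artinian, so the ideals generated by the powers of $z$ stabilize: $z^{n+1}y=z^n$
for some central $y$. -/
theorem exists_isFittingPair (k : Type*) [Field k] {R : Type*} [Ring R] [Algebra k R]
    [Module.Finite k R] {z : R} (hz : z ∈ Subring.center R) : ∃ f w, IsFittingPair z f w := by
  have : IsArtinianRing (Subalgebra.center k R) := IsArtinianRing.of_finite k _
  have hz' : z ∈ Subalgebra.center k R := hz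
  obtain ⟨n, y, hy⟩ := IsArtinian.exists_pow_succ_smul_dvd (⟨z, hz'⟩ : Subalgebra.center k R)
    (1 : Subalgebra.center k R)
  set c : Subalgebra.center k R := ⟨z, hz'⟩ with hc
  rw [smul_eq_mul, smul_eq_mul, mul_one] at hy
  have h1 : ∀ m, c ^ n * (c * y) ^ m = c ^ n := by
    intro m
    induction m with
    | zero => rw [pow_zero, mul_one]
    | succ m ih =>
      rw [pow_succ, ← mul_assoc, ih, ← mul_assoc, ← pow_succ]
      exact hy
  have h2 : ∀ m, (c * y) ^ n * (c * y) ^ m = (c * y) ^ n := by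
    intro m
    rw [mul_pow, mul_right_comm, h1]
  have hcoe : ∀ a b : Subalgebra.center k R, a = b → (a : R) = b := fun a b h => by rw [h]
  -- With $zy$ acting as the identity on $z^n$, its powers are constant from the exponent $n$ on.
  -- The exponent $n+1$ makes $f=zw$ hold on the nose for $w=y(zy)^n$.
  refine ⟨((c * y) ^ (n + 1) : Subalgebra.center k R), (y * (c * y) ^ n : Subalgebra.center k R),
    Subtype.prop _, Subtype.prop _, ?_, ?_, ?_, n, ?_⟩
  · refine hcoe (c * (y * (c * y) ^ n)) _ ?_
    ring
  · refine hcoe ((c * y) ^ (n + 1) * (y * (c * y) ^ n)) _ ?_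
    rw [mul_left_comm, mul_comm _ ((c * y) ^ n), h2]
  · refine hcoe ((c * y) ^ (n + 1) * (c * y) ^ (n + 1)) _ ?_
    rw [pow_add, h2, h2]
  · have h3 : z ^ n * ((c * y) ^ (n + 1) : Subalgebra.center k R) = z ^ n := hcoe _ _ (h1 (n + 1))
    rw [mul_sub, h3, mul_one, sub_self]

/-- Here $f=w^{m+1}z^{m+1}$ is killed by $1-f'$ once $z^m(1-f')=0$, so $f=ff'$, and symmetrically.
Uniqueness is what makes the pairs chosen at different levels compatible. -/
theorem IsFittingPair.unique {R : Type*} [Ring R] {z f w f' w' : R}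
    (h : IsFittingPair z f w) (h' : IsFittingPair z f' w') : f = f' ∧ w = w' := by
  have key : ∀ {f w f' w' : R}, IsFittingPair z f w → IsFittingPair z f' w' → f = f * f' := by
    intro f w f' w' h h'
    obtain ⟨m, hm⟩ := h'.nil
    have hcomm : Commute w z := ((Subring.mem_center_iff.1 h.w_mem) z).symm
    have h1 : f = w ^ (m + 1) * z ^ (m + 1) := by
      rw [← hcomm.mul_pow, hcomm.eq, h.mul_w]
      exact (IsIdempotentElem.pow_succ_eq m h.idem).symm
    have h2 : f * (1 - f') = 0 := by
      rw [h1, mul_assoc, pow_succ' z, mul_assoc z, hm, mul_zero, mul_zero]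
    rwa [mul_sub, mul_one, sub_eq_zero] at h2
  have hf : f = f' := by
    rw [key h h', Subring.mem_center_iff.1 h'.f_mem, ← key h' h]
  refine ⟨hf, ?_⟩
  subst hf
  calc w = f * w := h.f_mul_w.symm
    _ = z * w' * w := by rw [h'.mul_w]
    _ = w' * (z * w) := by
      rw [Subring.mem_center_iff.1 h'.w_mem z, mul_assoc]
    _ = f * w' := by rw [h.mul_w, Subring.mem_center_iff.1 h'.w_mem]
    _ = w' := h'.f_mul_w

theorem map_mem_center_of_surjective {R S F : Type*} [Ring R] [Ring S] [FunLike F R S]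
    [RingHomClass F R S] {φ : F} (hφ : Function.Surjective φ) {z : R}
    (hz : z ∈ Subring.center R) : φ z ∈ Subring.center S := by
  refine Subring.mem_center_iff.2 fun x => ?_
  obtain ⟨x, rfl⟩ := hφ x
  rw [← map_mul, Subring.mem_center_iff.1 hz, map_mul]

theorem IsFittingPair.map {R S F : Type*} [Ring R] [Ring S] [FunLike F R S]
    [RingHomClass F R S] {φ : F} (hφ : Function.Surjective φ) {z f w : R}
    (h : IsFittingPair z f w) : IsFittingPair (φ z) (φ f) (φ w) where
  f_mem := map_mem_center_of_surjective hφ h.f_mem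
  w_mem := map_mem_center_of_surjective hφ h.w_mem
  mul_w := by rw [← map_mul, h.mul_w]
  f_mul_w := by rw [← map_mul, h.f_mul_w]
  idem := by rw [← map_mul, h.idem]
  nil := by
    obtain ⟨n, hn⟩ := h.nil
    exact ⟨n, by rw [← map_one φ, ← map_sub, ← map_pow, ← map_mul, hn, map_zero]⟩

variable {k : Type v} [Field k] {G : Type u} [Group G] [TopologicalSpace G]

theorem mem_center_of_proj {z : CompletedGroupAlgebra k G}
    (h : ∀ N, proj k N z ∈ Subring.center (MonoidAlgebra k (G ⧸ N.toSubgroup))) :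
    z ∈ Subring.center (CompletedGroupAlgebra k G) := by
  refine Subring.mem_center_iff.2 fun x => ext fun N => ?_
  rw [map_mul, map_mul, Subring.mem_center_iff.1 (h N)]

variable [IsTopologicalGroup G] [CompactSpace G]

/-- This plays the role of locality of the center of the block. The Fitting idempotents of $z$ at
all levels glue to a central idempotent $f'$ of $k[[G]]$, and primitivity of $e$ leaves only
$ef'=0$, where $ze$ is nilpotent at each level, or $ef'=e$, where $z$ divides $e$. -/
theorem IsBlockIdempotent.exists_mul_eq_or_isNilpotent {e : CompletedGroupAlgebra k G}
    (he : IsBlockIdempotent e) {z : CompletedGroupAlgebra k G}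
    (hz : z ∈ Subring.center (CompletedGroupAlgebra k G)) :
    (∃ w ∈ Subring.center (CompletedGroupAlgebra k G), z * w = e) ∨
      ∀ N, IsNilpotent (proj k N (z * e)) := by
  have hzN : ∀ N, proj k N z ∈ Subring.center _ := fun N =>
    map_mem_center_of_surjective (proj_surjective N) hz
  choose f w hfw using fun N => exists_isFittingPair k (hzN N)
  have hcompat : ∀ (N M : OpenNormalSubgroup G) (h : N ≤ M),
      transition k h (f N) = f M ∧ transition k h (w N) = w M := by
    intro N M h
    have := (hfw N).map (transition_surjective h)
    rw [transition_proj] at this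
    exact this.unique (hfw M)
  let f' : CompletedGroupAlgebra k G := CompletedGroupAlgebra.mk f fun N M h => (hcompat N M h).1
  let w' : CompletedGroupAlgebra k G := CompletedGroupAlgebra.mk w fun N M h => (hcompat N M h).2
  have hf' : f' ∈ Subring.center (CompletedGroupAlgebra k G) := mem_center_of_proj fun N =>
    (hfw N).f_mem
  have hw' : w' ∈ Subring.center (CompletedGroupAlgebra k G) := mem_center_of_proj fun N =>
    (hfw N).w_mem
  have hff : f' * f' = f' := ext fun N => by
    rw [map_mul]
    exact (hfw N).idem
  have hzw : z * w' = f' := ext fun N => by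
    rw [map_mul]
    exact (hfw N).mul_w
  have hfe : f' * e = e * f' := (Subring.mem_center_iff.1 hf' e).symm
  have hee : e * e = e := he.idem
  have hefef : e * f' * (e * f') = e * f' := by
    rw [mul_assoc, ← mul_assoc f' e, hfe, mul_assoc e f' f', hff, ← mul_assoc, hee]
  have hefe : e * f' * e = e * f' := by rw [mul_assoc, hfe, ← mul_assoc, hee]
  have heef : e * (e * f') = e * f' := by rw [← mul_assoc, hee]
  rcases he.primitive (e * f') (mul_mem he.mem_center hf') (e - e * f')
    (sub_mem he.mem_center (mul_mem he.mem_center hf')) hefef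
    (by
      show (e - e * f') * (e - e * f') = _
      rw [sub_mul, mul_sub, mul_sub, hee, hefef, hefe, heef, sub_self, sub_zero])
    (by rw [mul_sub, hefe, hefef, sub_self]) (by rw [sub_mul, hefef, heef, sub_self])
    (by abel) with h | h
  · right
    intro N
    obtain ⟨n, hn⟩ := (hfw N).nil
    have h0 : proj k N e * f N = 0 := by
      rw [← map_zero (proj k N), ← h, map_mul]
      rfl
    refine ⟨n + 1, ?_⟩
    have hcomm : Commute (proj k N z) (proj k N e) := by
      have := Subring.mem_center_iff.1 (hzN N) (proj k N e)
      exact this.symm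
    rw [map_mul, hcomm.mul_pow]
    have h3 : proj k N e ^ (n + 1) = (1 - f N) * proj k N e := by
      have hidem : IsIdempotentElem (proj k N e) := by
        rw [IsIdempotentElem, ← map_mul, hee]
      rw [IsIdempotentElem.pow_succ_eq n hidem, sub_mul, one_mul,
        ← Subring.mem_center_iff.1 (hfw N).f_mem, h0, sub_zero]
    rw [h3, ← mul_assoc, pow_succ', mul_assoc (proj k N z), hn, mul_zero, zero_mul]
  · left
    refine ⟨w' * e, mul_mem hw' he.mem_center, ?_⟩
    rw [← mul_assoc, hzw, hfe]
    exact (sub_eq_zero.1 h).symm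

/-- A form of Rosenberg's lemma. If no $z_t$ divides $e$, every $z_te$ is nilpotent at level $N$;
these elements are central, so their sum is nilpotent too, yet it is the non-zero idempotent
$\varphi_N(e)$. -/
theorem IsBlockIdempotent.exists_mul_eq_of_sum {e : CompletedGroupAlgebra k G}
    (he : IsBlockIdempotent e) {N : OpenNormalSubgroup G} (hN : proj k N e ≠ 0) {T : Type*}
    [Fintype T] (z : T → CompletedGroupAlgebra k G)
    (hz : ∀ t, z t ∈ Subring.center (CompletedGroupAlgebra k G)) (y : CompletedGroupAlgebra k G)
    (hy : proj k N y = 0) (hsum : e = ∑ t, z t + y) :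
    ∃ t, ∃ w ∈ Subring.center (CompletedGroupAlgebra k G), z t * w = e := by
  by_contra! hcon
  have hnil : ∀ t, IsNilpotent (proj k N (z t * e)) := fun t => by
    rcases he.exists_mul_eq_or_isNilpotent (hz t) with ⟨w, hw, h⟩ | h
    · exact absurd h (hcon t w hw)
    · exact h N
  have hcen : ∀ t, proj k N (z t * e) ∈ Subring.center _ := fun t =>
    map_mem_center_of_surjective (proj_surjective N) (mul_mem (hz t) he.mem_center)
  have h1 : IsNilpotent (∑ t, proj k N (z t * e)) :=
    Commute.isNilpotent_sum (fun t _ => hnil t) fun t t' _ _ =>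
      (Subring.mem_center_iff.1 (hcen t) _).symm
  have hee : proj k N e * proj k N e = proj k N e := by rw [← map_mul, he.idem]
  have h2 : ∑ t, proj k N (z t * e) = proj k N e := by
    simp only [map_mul]
    rw [← Finset.sum_mul]
    conv_rhs => rw [← hee]
    conv_rhs => lhs; rw [hsum, map_add, hy, add_zero, map_sum]
  rw [h2] at h1
  obtain ⟨n, hn⟩ := h1
  apply hN
  have h3 : proj k N e ^ (n + 1) = proj k N e := IsIdempotentElem.pow_succ_eq n hee
  rw [← h3, pow_succ, hn, zero_mul]

end Local

/-! ## Solving linear equations in `k[[G]]` -/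

section Levels

variable {k : Type v} [Field k] {G : Type u} [Group G] [TopologicalSpace G]

theorem transition_transition {N M L : OpenNormalSubgroup G} (h : N ≤ M) (h' : M ≤ L)
    (x : MonoidAlgebra k (G ⧸ N.toSubgroup)) :
    transition k h' (transition k h x) = transition k (h.trans h') x := by
  obtain ⟨y, rfl⟩ := proj_surjective N x
  simp only [transition_proj]

theorem mem_fixedPoints_sup {k : Type*} [Field k] {Γ : Type*} [Group Γ] {A : Type*} [Ring A]
    [Algebra k A] {ι : Γ →* A} {H K : Subgroup Γ}
    {a : A} (hH : a ∈ fixedPoints k ι H) (hK : a ∈ fixedPoints k ι K) :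
    a ∈ fixedPoints k ι (H ⊔ K) := by
  let S : Subgroup Γ :=
    { carrier := {g | conj ι g a = a}
      one_mem' := conj_one_apply ι a
      mul_mem' := by
        intro g h hg hh
        show conj ι (g * h) a = a
        rw [conj_mul_apply, show conj ι h a = a from hh, show conj ι g a = a from hg]
      inv_mem' := by
        intro g hg
        show conj ι g⁻¹ a = a
        conv_lhs => rw [← show conj ι g a = a from hg]
        exact conj_inv_conj ι g a }
  have h : H ⊔ K ≤ S := sup_le hH hK
  exact h

theorem mem_fixedPoints_ofQ (N : OpenNormalSubgroup G) (a : MonoidAlgebra k (G ⧸ N.toSubgroup)) :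
    a ∈ fixedPoints k (ofQ k N) N.toSubgroup := by
  intro n hn
  rw [ofQ_eq_one (N := N) hn, ofQ_eq_one (N := N) (inv_mem hn), one_mul, mul_one]

theorem mem_fixedPoints_ofQ_sup {N : OpenNormalSubgroup G} {H : Subgroup G}
    {a : MonoidAlgebra k (G ⧸ N.toSubgroup)} (ha : a ∈ fixedPoints k (ofQ k N) H) :
    a ∈ fixedPoints k (ofQ k N) (H ⊔ N.toSubgroup) :=
  mem_fixedPoints_sup ha (mem_fixedPoints_ofQ N a)

theorem proj_mem_fixedPoints (N : OpenNormalSubgroup G) {H : Subgroup G}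
    {a : CompletedGroupAlgebra k G} (ha : a ∈ fixedPoints k (of k) H) :
    proj k N a ∈ fixedPoints k (ofQ k N) H :=
  map_mem_fixedPoints (proj k N) (fun _ => rfl) ha

theorem transition_mem_fixedPoints {N M : OpenNormalSubgroup G} (h : N ≤ M) {H : Subgroup G}
    {a : MonoidAlgebra k (G ⧸ N.toSubgroup)} (ha : a ∈ fixedPoints k (ofQ k N) H) :
    transition k h a ∈ fixedPoints k (ofQ k M) H :=
  map_mem_fixedPoints (transition k h) (transition_ofQ h) ha

theorem mem_fixedPoints_of_proj {H : Subgroup G} {a : CompletedGroupAlgebra k G}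
    (h : ∀ N, proj k N a ∈ fixedPoints k (ofQ k N) H) : a ∈ fixedPoints k (of k) H := by
  intro g hg
  refine ext fun N => ?_
  rw [map_mul, map_mul]
  exact h N g hg

variable [IsTopologicalGroup G] [CompactSpace G]

theorem relIndex_ne_zero_of_openNormal (N : OpenNormalSubgroup G) {H : Subgroup G}
    (h : N.toSubgroup ≤ H) (L : Subgroup G) : H.relIndex L ≠ 0 := by
  have : N.toSubgroup.FiniteIndex := Subgroup.finiteIndex_of_finite_quotient
  have : H.FiniteIndex := Subgroup.finiteIndex_of_le h
  exact Subgroup.FiniteIndex.index_ne_zero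

/-- The solution sets at the finite levels are affine and are carried into one another by the
transition maps, so linear compactness applies. For the same reason solvability matters only below
some `N₀`. -/
theorem exists_linear_solution {T : Type*} [Finite T]
    (P : ∀ N : OpenNormalSubgroup G, Submodule k (T → MonoidAlgebra k (G ⧸ N.toSubgroup)))
    (Φ : ∀ N : OpenNormalSubgroup G, (T → MonoidAlgebra k (G ⧸ N.toSubgroup)) →ₗ[k]
      MonoidAlgebra k (G ⧸ N.toSubgroup))
    (hP : ∀ (N M : OpenNormalSubgroup G) (h : N ≤ M), ∀ x ∈ P N,
      (fun t => transition k h (x t)) ∈ P M)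
    (hΦ : ∀ (N M : OpenNormalSubgroup G) (h : N ≤ M), ∀ x ∈ P N,
      Φ M (fun t => transition k h (x t)) = transition k h (Φ N x))
    (z : CompletedGroupAlgebra k G) (N₀ : OpenNormalSubgroup G)
    (hne : ∀ N ≤ N₀, ∃ x ∈ P N, Φ N x = proj k N z) :
    ∃ x : T → CompletedGroupAlgebra k G,
      ∀ N, (fun t => proj k N (x t)) ∈ P N ∧ Φ N (fun t => proj k N (x t)) = proj k N z := by
  have hanti : ∀ (N M : OpenNormalSubgroup G) (h : N ≤ M), ∀ x ∈ P N, Φ N x = proj k N z →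
      (fun t => transition k h (x t)) ∈ P M ∧
        Φ M (fun t => transition k h (x t)) = proj k M z := fun N M h x hx hxz =>
    ⟨hP N M h x hx, by rw [hΦ N M h x hx, hxz, transition_proj]⟩
  refine exists_forall_proj_mem (fun N => {x | x ∈ P N ∧ Φ N x = proj k N z}) ?_ ?_ ?_
  · intro N
    obtain ⟨x, hx, hxz⟩ := hne (N ⊓ N₀) inf_le_right
    exact ⟨_, hanti _ N inf_le_left x hx hxz⟩
  · rintro N x ⟨hx, hxz⟩ y ⟨hy, hyz⟩ z' ⟨hz, hzz⟩ c
    refine ⟨add_mem hx (Submodule.smul_mem _ c (sub_mem hy hz)), ?_⟩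
    rw [map_add, map_smul, map_sub, hxz, hyz, hzz, sub_self, smul_zero, add_zero]
  · rintro N M h x ⟨hx, hxz⟩
    exact hanti N M h x hx hxz

theorem exists_trace_eq_of_levels {H : Subgroup G} (N₀ : OpenNormalSubgroup G)
    (hH : N₀.toSubgroup ≤ H) (z : CompletedGroupAlgebra k G)
    (h : ∀ N ≤ N₀, ∃ x ∈ fixedPoints k (ofQ k N) H, trace (ofQ k N) H ⊤ x = proj k N z) :
    ∃ a ∈ fixedPoints k (of k) H, trace (of k) H ⊤ a = z := by
  have hfin := relIndex_ne_zero_of_openNormal N₀ hH ⊤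
  have htr : ∀ (N M : OpenNormalSubgroup G) (h : N ≤ M) (x : MonoidAlgebra k (G ⧸ N.toSubgroup)),
      trace (ofQ k M) H ⊤ (transition k h x) = transition k h (trace (ofQ k N) H ⊤ x) :=
    fun N M h x => (map_trace (transition k h).toRingHom (transition_ofQ h) hfin x).symm
  let P (N : OpenNormalSubgroup G) : Submodule k (Unit → MonoidAlgebra k (G ⧸ N.toSubgroup)) :=
    (Subalgebra.toSubmodule (fixedPoints k (ofQ k N) H)).comap (LinearMap.proj ())
  let Φ (N : OpenNormalSubgroup G) : (Unit → MonoidAlgebra k (G ⧸ N.toSubgroup)) →ₗ[k]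
      MonoidAlgebra k (G ⧸ N.toSubgroup) := traceLinearMap (ofQ k N) hfin ∘ₗ LinearMap.proj ()
  obtain ⟨x, hx⟩ := exists_linear_solution P Φ
    (fun N M h x hx => transition_mem_fixedPoints (a := x ()) h hx)
    (fun N M h x _ => htr N M h (x ()))
    z N₀ (fun N hN => by
      obtain ⟨x, hx, hxz⟩ := h N hN
      exact ⟨fun _ => x, hx, hxz⟩)
  refine ⟨x (), mem_fixedPoints_of_proj fun N => (hx N).1, ext fun N => ?_⟩
  rw [← (hx N).2]
  exact map_trace (proj k N).toRingHom (fun _ => rfl) hfin (x ())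

end Levels

/-! ## Trace ideals -/

section TraceIdeals

variable {k : Type v} [Field k] {G : Type u} [Group G] [TopologicalSpace G]

theorem mem_oTr_iff {D : Subgroup G} {z : CompletedGroupAlgebra k G} :
    z ∈ oTr D ↔ ∀ N : OpenNormalSubgroup G, ∃ a ∈ fixedPoints k (of k) (D ⊔ N.toSubgroup),
      trace (of k) (D ⊔ N.toSubgroup) ⊤ a = z := Set.mem_iInter

/-- The trace from the image of `H` in a quotient is the trace from its preimage. -/
theorem trace_map_of_surjective {k : Type*} [Field k] {Γ Γ' : Type*} [Group Γ] [Group Γ']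
    {A : Type*} [Ring A] [Algebra k A] (f : Γ →* Γ') (hf : Function.Surjective f) (ι : Γ' →* A)
    {H : Subgroup Γ} {y : A} (hy : y ∈ fixedPoints k (ι.comp f) H) :
    trace ι (H.map f) ⊤ y = trace (ι.comp f) (H ⊔ f.ker) ⊤ y := by
  have hy' : y ∈ fixedPoints k ι (H.map f) := by
    rintro _ ⟨h, hh, rfl⟩
    have := hy h hh
    rwa [MonoidHom.comp_apply, MonoidHom.comp_apply, map_inv] at this
  have htrans : ∀ x : Γ' ⧸ H.map f, ∃ g : Γ', g • ((1 : Γ') : Γ' ⧸ H.map f) = x := fun x => by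
    obtain ⟨x, rfl⟩ := QuotientGroup.mk_surjective x
    exact ⟨x, by rw [MulAction.Quotient.smul_coe, smul_eq_mul, mul_one]⟩
  have h1 := trace_eq_finsum ι (H.map f) ((1 : Γ') : Γ' ⧸ H.map f) (cosetFun ι (H.map f) y)
    (fun l => cosetFun_smul hy' l _) (fun l => smul_coset_one_eq_iff l) htrans
  let _ : MulAction Γ (Γ' ⧸ H.map f) := MulAction.compHom _ f
  have h2 := trace_eq_finsum (ι.comp f) (H ⊔ f.ker) ((1 : Γ') : Γ' ⧸ H.map f)
    (cosetFun ι (H.map f) y)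
    (fun l => by
      have h := cosetFun_smul hy' (f l) ((1 : Γ') : Γ' ⧸ H.map f)
      rw [conj_apply] at h ⊢
      rw [MonoidHom.comp_apply, MonoidHom.comp_apply, map_inv]
      exact h)
    (fun l => by
      rw [← Subgroup.comap_map_eq]
      exact smul_coset_one_eq_iff (f l))
    (fun x => by
      obtain ⟨g, hg⟩ := htrans x
      obtain ⟨g, rfl⟩ := hf g
      exact ⟨g, hg⟩)
  rw [cosetFun_mk hy', conj_one_apply] at h1 h2
  rw [h1, h2]

theorem trace_quotient (N : OpenNormalSubgroup G) {H : Subgroup G}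
    {y : MonoidAlgebra k (G ⧸ N.toSubgroup)} (hy : y ∈ fixedPoints k (ofQ k N) H) :
    trace (MonoidAlgebra.of k (G ⧸ N.toSubgroup)) (H.map (QuotientGroup.mk' N.toSubgroup)) ⊤ y =
      trace (ofQ k N) (H ⊔ N.toSubgroup) ⊤ y := by
  have h := trace_map_of_surjective (QuotientGroup.mk' N.toSubgroup)
    (QuotientGroup.mk'_surjective _) (MonoidAlgebra.of k (G ⧸ N.toSubgroup)) hy
  rwa [QuotientGroup.ker_mk'] at h

theorem sup_mono_openNormal (R : Subgroup G) {N M : OpenNormalSubgroup G} (h : N ≤ M) :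
    R ⊔ N.toSubgroup ≤ R ⊔ M.toSubgroup :=
  sup_le_sup_left (show N.toSubgroup ≤ M.toSubgroup from h) R

theorem relIndex_sup_dvd (N : OpenNormalSubgroup G) (Q D : Subgroup G) :
    (Q ⊔ N.toSubgroup).relIndex (D ⊔ N.toSubgroup) ∣ Q.relIndex D := by
  have h1 : Q ⊔ N.toSubgroup =
      (Q.map (QuotientGroup.mk' N.toSubgroup)).comap (QuotientGroup.mk' N.toSubgroup) := by
    rw [Subgroup.comap_map_eq, QuotientGroup.ker_mk']
  have h2 : (D ⊔ N.toSubgroup).map (QuotientGroup.mk' N.toSubgroup) =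
      D.map (QuotientGroup.mk' N.toSubgroup) := by
    rw [Subgroup.map_sup, QuotientGroup.map_mk'_self, sup_bot_eq]
  have h3 : (Q ⊔ N.toSubgroup).relIndex (D ⊔ N.toSubgroup) = (Q ⊔ N.toSubgroup).relIndex D := by
    rw [h1, Subgroup.relIndex_comap, Subgroup.relIndex_comap, h2]
  rw [h3]
  exact Subgroup.relIndex_dvd_of_le_left _ le_sup_left

variable [IsTopologicalGroup G] [CompactSpace G]

theorem exists_trace_eq_of_le (N : OpenNormalSubgroup G) {H K : Subgroup G}
    (hN : N.toSubgroup ≤ H) (hHK : H ≤ K) {z : CompletedGroupAlgebra k G}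
    (h : ∃ a ∈ fixedPoints k (of k) H, trace (of k) H ⊤ a = z) :
    ∃ a ∈ fixedPoints k (of k) K, trace (of k) K ⊤ a = z := by
  obtain ⟨a, ha, rfl⟩ := h
  exact ⟨trace (of k) H K a, conj_trace_mem (relIndex_ne_zero_of_openNormal N hN K) ha,
    trace_trace hHK le_top (relIndex_ne_zero_of_openNormal N hN ⊤) ha⟩

theorem oTr_mono {R D : Subgroup G} (h : R ≤ D) {z : CompletedGroupAlgebra k G}
    (hz : z ∈ oTr R) : z ∈ oTr D :=
  mem_oTr_iff.2 fun N => exists_trace_eq_of_le N le_sup_right (sup_le_sup_right h _)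
    (mem_oTr_iff.1 hz N)

/-- The components of a trace from `RM` at a level `N₀ ≥ M`. -/
theorem proj_trace_eq_relIndex_smul {R : Subgroup G} {N M : OpenNormalSubgroup G} (h : M ≤ N)
    {a : CompletedGroupAlgebra k G} (ha : a ∈ fixedPoints k (of k) (R ⊔ M.toSubgroup)) :
    proj k N (trace (of k) (R ⊔ M.toSubgroup) ⊤ a) =
      (R ⊔ M.toSubgroup).relIndex (R ⊔ N.toSubgroup) •
        trace (ofQ k N) (R ⊔ N.toSubgroup) ⊤ (proj k N a) := by
  have hfin := relIndex_ne_zero_of_openNormal M (le_sup_right (a := R)) ⊤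
  refine (map_trace (ι' := ofQ k N) (proj k N).toRingHom (fun _ => rfl) hfin a).trans ?_
  exact trace_eq_relIndex_smul (k := k) (sup_mono_openNormal R h) le_top hfin
    (mem_fixedPoints_ofQ_sup (proj_mem_fixedPoints N (fixedPoints_anti le_sup_left ha)))

variable {p : ℕ}

theorem not_dvd_relIndex_of_mem_oTr [CharP k p] {R : Subgroup G} {z : CompletedGroupAlgebra k G}
    (hz : z ∈ oTr R) {N M : OpenNormalSubgroup G} (hN : proj k N z ≠ 0) (h : M ≤ N) :
    ¬ p ∣ (R ⊔ M.toSubgroup).relIndex (R ⊔ N.toSubgroup) := by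
  intro hdvd
  obtain ⟨a, ha, rfl⟩ := mem_oTr_iff.1 hz M
  apply hN
  rw [proj_trace_eq_relIndex_smul h ha, ← Nat.cast_smul_eq_nsmul k,
    (CharP.cast_eq_zero_iff k p _).2 hdvd, zero_smul]

theorem index_ne_zero_of_openNormal (R : Subgroup G) (N : OpenNormalSubgroup G) :
    (R ⊔ N.toSubgroup).index ≠ 0 := by
  rw [← Subgroup.relIndex_top_right]
  exact relIndex_ne_zero_of_openNormal N le_sup_right ⊤

theorem factorization_index_mono (p : ℕ) (R : Subgroup G) {N M : OpenNormalSubgroup G}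
    (h : M ≤ N) : (R ⊔ N.toSubgroup).index.factorization p ≤
      (R ⊔ M.toSubgroup).index.factorization p :=
  (Nat.factorization_le_iff_dvd (index_ne_zero_of_openNormal R N)
    (index_ne_zero_of_openNormal R M)).2 (Subgroup.index_dvd_of_le (sup_mono_openNormal R h)) p

theorem factorization_eq_indexExponent {R : Subgroup G} {N M : OpenNormalSubgroup G}
    (h : ((R ⊔ N.toSubgroup).index.factorization p : ℕ∞) = indexExponent p R) (hMN : M ≤ N) :
    ((R ⊔ M.toSubgroup).index.factorization p : ℕ∞) = indexExponent p R := by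
  refine le_antisymm (le_iSup (fun N : OpenNormalSubgroup G =>
    ((R ⊔ N.toSubgroup).index.factorization p : ℕ∞)) M) ?_
  rw [← h]
  exact_mod_cast factorization_index_mono p R hMN

/-- Below a level $N$ where $z$ survives, all indices $|RN:RM|$ are prime to $p$, so the $p$-part of
$|G:RM|$ no longer grows. Finiteness of $|G:R|_p$ is thus automatic for $z\ne0$. -/
theorem factorization_eq_indexExponent_of_mem_oTr [CharP k p] {R : Subgroup G} {z : CompletedGroupAlgebra k G}
    (hz : z ∈ oTr R) {N : OpenNormalSubgroup G} (hN : proj k N z ≠ 0) :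
    ((R ⊔ N.toSubgroup).index.factorization p : ℕ∞) = indexExponent p R := by
  refine le_antisymm (le_iSup (fun N : OpenNormalSubgroup G =>
    ((R ⊔ N.toSubgroup).index.factorization p : ℕ∞)) N) (iSup_le fun M => ?_)
  have h1 := factorization_index_mono p R (inf_le_left : M ⊓ N ≤ M)
  have h2 := not_dvd_relIndex_of_mem_oTr (p := p) hz hN (inf_le_right : M ⊓ N ≤ N)
  have h3 := Subgroup.relIndex_mul_index (sup_mono_openNormal R (inf_le_right : M ⊓ N ≤ N))
  rw [← h3, Nat.factorization_mul
    (relIndex_ne_zero_of_openNormal (M ⊓ N) le_sup_right _) (index_ne_zero_of_openNormal R N),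
    Finsupp.add_apply, Nat.factorization_eq_zero_of_not_dvd h2, zero_add] at h1
  exact_mod_cast h1

/-- Once the $p$-part of the index is stable, $|RN:RM|$ is prime to $p$ and enters the $p'$-part in
full. It cancels the factor produced by `proj_trace_eq_relIndex_smul`, which is why the normalized
traces are compatible. -/
theorem ordCompl_index_eq {R : Subgroup G} {N M : OpenNormalSubgroup G} (h : M ≤ N)
    (hN : ((R ⊔ N.toSubgroup).index.factorization p : ℕ∞) = indexExponent p R) :
    ordCompl[p] (R ⊔ M.toSubgroup).index =
      (R ⊔ M.toSubgroup).relIndex (R ⊔ N.toSubgroup) * ordCompl[p] (R ⊔ N.toSubgroup).index := by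
  have hM := factorization_eq_indexExponent hN h
  have h3 := Subgroup.relIndex_mul_index (sup_mono_openNormal R h)
  have h4 : (R ⊔ M.toSubgroup).index.factorization p = (R ⊔ N.toSubgroup).index.factorization p := by
    exact_mod_cast hM.trans hN.symm
  have h5 : ((R ⊔ M.toSubgroup).relIndex (R ⊔ N.toSubgroup)).factorization p = 0 := by
    rw [← h3, Nat.factorization_mul
      (relIndex_ne_zero_of_openNormal M le_sup_right _) (index_ne_zero_of_openNormal R N),
      Finsupp.add_apply] at h4
    omega
  rw [← h3, Nat.ordCompl_mul, h5, pow_zero, Nat.div_one]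

/-- At each small level $M$ the component of $z$ is a trace from $RM$, hence by transitivity a trace
from the fixed open subgroup $R(N\cap N_0)$. Solvability at all these levels lifts to $k[[G]]$. -/
theorem mem_oTr_of_mem_modifiedTraceImage {R : Subgroup G} {z : CompletedGroupAlgebra k G}
    (hexp : indexExponent p R ≠ ⊤) (hz : z ∈ modifiedTraceImage p R) : z ∈ oTr R := by
  obtain ⟨x, hx, hxz⟩ := hz
  obtain ⟨N₀, hN₀⟩ : ∃ N : OpenNormalSubgroup G,
      ((R ⊔ N.toSubgroup).index.factorization p : ℕ∞) = indexExponent p R :=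
    ENat.exists_eq_iSup_of_lt_top (lt_top_iff_ne_top.2 hexp)
  refine mem_oTr_iff.2 fun N => ?_
  refine exists_trace_eq_of_le (N ⊓ N₀) le_sup_right (sup_mono_openNormal R inf_le_left) ?_
  refine exists_trace_eq_of_levels (N ⊓ N₀) le_sup_right z fun M hM => ?_
  have hfix := mem_fixedPoints_ofQ_sup (proj_mem_fixedPoints M hx)
  have h1 := hxz M (factorization_eq_indexExponent hN₀ (hM.trans inf_le_right))
  rw [trace_quotient M (proj_mem_fixedPoints M hx), ← trace_smul] at h1
  have hfix' := Subalgebra.smul_mem _ hfix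
    (((ordCompl[p] (R ⊔ M.toSubgroup).index : ℕ) : k)⁻¹)
  refine ⟨_, conj_trace_mem (relIndex_ne_zero_of_openNormal M le_sup_right _) hfix', ?_⟩
  rw [h1]
  exact trace_trace (sup_mono_openNormal R hM) le_top
    (relIndex_ne_zero_of_openNormal M le_sup_right _) hfix'

/-- The index $|DN:QN|$ divides $|D:Q|$ and is invertible in `k`, so dividing by it turns a trace
from $DN$ into one from $QN$. -/
theorem mem_oTr_of_not_dvd [CharP k p] {Q D : Subgroup G} (hQD : Q ≤ D) (h : ¬ p ∣ Q.relIndex D)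
    {z : CompletedGroupAlgebra k G} (hz : z ∈ oTr D) : z ∈ oTr Q := by
  refine mem_oTr_iff.2 fun N => ?_
  obtain ⟨a, ha, rfl⟩ := mem_oTr_iff.1 hz N
  have hle : Q ⊔ N.toSubgroup ≤ D ⊔ N.toSubgroup := sup_le_sup_right hQD _
  have hne : (((Q ⊔ N.toSubgroup).relIndex (D ⊔ N.toSubgroup) : ℕ) : k) ≠ 0 := fun h0 =>
    h (((CharP.cast_eq_zero_iff k p _).1 h0).trans (relIndex_sup_dvd N Q D))
  refine ⟨(((Q ⊔ N.toSubgroup).relIndex (D ⊔ N.toSubgroup) : ℕ) : k)⁻¹ • a,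
    Subalgebra.smul_mem _ (fixedPoints_anti hle ha) _, ?_⟩
  rw [trace_smul, trace_eq_relIndex_smul hle le_top
    (relIndex_ne_zero_of_openNormal N le_sup_right ⊤) ha, ← Nat.cast_smul_eq_nsmul k, smul_smul,
    inv_mul_cancel₀ hne, one_smul]

variable [CharP k p] [Fact p.Prime]

theorem ordCompl_cast_ne_zero {n : ℕ} (hn : n ≠ 0) : ((ordCompl[p] n : ℕ) : k) ≠ 0 := fun h =>
  Nat.not_dvd_ordCompl Fact.out hn ((CharP.cast_eq_zero_iff k p _).1 h)

/-- Linear compactness is applied to an unknown $x\in k[[G]]^R$ subject to the normalized trace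
equations at the levels where the $p$-part of the index is already maximal. -/
theorem exists_isModifiedTrace_of_mem_oTr {R : Subgroup G} {z : CompletedGroupAlgebra k G}
    (hz : z ∈ oTr R) (hz0 : z ≠ 0) :
    indexExponent p R ≠ ⊤ ∧ z ∈ modifiedTraceImage p R := by
  obtain ⟨N₀, hN₀⟩ : ∃ N, proj k N z ≠ 0 := by
    by_contra! h
    exact hz0 (ext fun N => by rw [h, map_zero])
  have hexp := factorization_eq_indexExponent_of_mem_oTr (p := p) hz hN₀
  refine ⟨fun h => ENat.natCast_ne_top _ (hexp.trans h), ?_⟩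
  let good (N : OpenNormalSubgroup G) : Prop :=
    ((R ⊔ N.toSubgroup).index.factorization p : ℕ∞) = indexExponent p R
  let Φ (N : OpenNormalSubgroup G) (x : MonoidAlgebra k (G ⧸ N.toSubgroup)) :
      MonoidAlgebra k (G ⧸ N.toSubgroup) :=
    ((ordCompl[p] (R ⊔ N.toSubgroup).index : ℕ) : k)⁻¹ •
      trace (ofQ k N) (R ⊔ N.toSubgroup) ⊤ x
  have hfin : ∀ N : OpenNormalSubgroup G, (R ⊔ N.toSubgroup).relIndex ⊤ ≠ 0 := fun N =>
    relIndex_ne_zero_of_openNormal N le_sup_right ⊤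
  have hΦ : ∀ N (x y z : MonoidAlgebra k (G ⧸ N.toSubgroup)) (c : k),
      Φ N (x + c • (y - z)) = Φ N x + c • (Φ N y - Φ N z) := by
    intro N x y z c
    have := (((ordCompl[p] (R ⊔ N.toSubgroup).index : ℕ) : k)⁻¹ •
      traceLinearMap (k := k) (ofQ k N) (hfin N)).map_add x (c • (y - z))
    rw [map_smul, map_sub] at this
    exact this
  -- The equation is imposed at level $N$ together with all coarser good levels $M$, so that passing
  -- to a coarser level preserves it trivially.
  obtain ⟨x, hx⟩ := exists_forall_proj_mem (T := Unit)
    (fun N => {x | x () ∈ fixedPoints k (ofQ k N) R ∧ ∀ (M : OpenNormalSubgroup G) (h : N ≤ M),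
      good M → Φ M (transition k h (x ())) = proj k M z})
    (by
      intro N
      obtain ⟨a, ha, haz⟩ := mem_oTr_iff.1 hz (N ⊓ N₀)
      have hRa := fixedPoints_anti le_sup_left ha
      -- If $z$ is the trace of $a$ from $R(N\cap N_0)$, the factor $|G:R(N\cap N_0)|_{p'}$
      -- compensates the normalization at every good $M\ge N$ at once.
      refine ⟨fun _ => ((ordCompl[p] (R ⊔ (N ⊓ N₀).toSubgroup).index : ℕ) : k) • proj k N a,
        Subalgebra.smul_mem _ (proj_mem_fixedPoints N hRa) _, fun M h hM => ?_⟩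
      show ((ordCompl[p] (R ⊔ M.toSubgroup).index : ℕ) : k)⁻¹ • trace (ofQ k M) (R ⊔ M.toSubgroup) ⊤
        (transition k h (((ordCompl[p] (R ⊔ (N ⊓ N₀).toSubgroup).index : ℕ) : k) • proj k N a)) = _
      have hle : N ⊓ N₀ ≤ M := inf_le_left.trans h
      rw [map_smul, transition_proj, trace_smul, ← haz, proj_trace_eq_relIndex_smul hle ha,
        ordCompl_index_eq hle hM, Nat.cast_mul, smul_smul, mul_comm ((Subgroup.relIndex _ _ : ℕ) : k),
        ← mul_assoc, inv_mul_cancel₀ (ordCompl_cast_ne_zero (index_ne_zero_of_openNormal R M)),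
        one_mul, Nat.cast_smul_eq_nsmul])
    (by
      rintro N x ⟨hx, hx'⟩ y ⟨hy, hy'⟩ z ⟨hz, hz'⟩ c
      refine ⟨add_mem hx (Subalgebra.smul_mem _ (sub_mem hy hz) c), fun M h hM => ?_⟩
      show Φ M (transition k h (x () + c • (y () - z ()))) = _
      rw [map_add, map_smul, map_sub, hΦ, hx' M h hM, hy' M h hM, hz' M h hM, sub_self, smul_zero,
        add_zero])
    (by
      rintro N M h x ⟨hx, hx'⟩
      refine ⟨transition_mem_fixedPoints h hx, fun L h' hL => ?_⟩
      show Φ L (transition k h' (transition k h (x ()))) = _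
      rw [transition_transition]
      exact hx' L (h.trans h') hL)
  refine ⟨x (), mem_fixedPoints_of_proj fun N => (hx N).1, fun N hN => ?_⟩
  have h1 := (hx N).2 N le_rfl hN
  rw [transition_proj] at h1
  rw [← h1, trace_quotient N (hx N).1]

theorem mem_oTr_iff_mem_modifiedTraceImage {R : Subgroup G} {z : CompletedGroupAlgebra k G}
    (hz : z ≠ 0) : z ∈ oTr R ↔ indexExponent p R ≠ ⊤ ∧ z ∈ modifiedTraceImage p R :=
  ⟨fun h => exists_isModifiedTrace_of_mem_oTr h hz,
    fun h => mem_oTr_of_mem_modifiedTraceImage h.1 h.2⟩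

/-- The preimage of a Sylow $p$-subgroup of a finite quotient of $D$ has index prime to $p$, so it
inherits the trace condition. Minimality forces it to be $D$. -/
theorem isProP_of_minimal {D : ClosedSubgroup G} {z : CompletedGroupAlgebra k G}
    (h : Minimal (fun R : ClosedSubgroup G => z ∈ oTr R.toSubgroup) D) :
    IsProP p D.toSubgroup := by
  intro M
  have : CompactSpace D.toSubgroup := isCompact_iff_compactSpace.mp D.isClosed'.isCompact
  let P : Sylow p (D.toSubgroup ⧸ M.toSubgroup) := default
  let Q₀ : Subgroup D.toSubgroup := P.toSubgroup.comap (QuotientGroup.mk' M.toSubgroup)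
  have hQopen : IsOpen (Q₀ : Set D.toSubgroup) :=
    Subgroup.isOpen_mono (H₁ := M.toSubgroup) (fun x hx => by
      have : (QuotientGroup.mk' M.toSubgroup) x = 1 := (QuotientGroup.eq_one_iff x).2 hx
      show _ ∈ P.toSubgroup
      rw [this]
      exact one_mem _) M.isOpen'
  let Q : ClosedSubgroup G :=
    { Q₀.map D.toSubgroup.subtype with
      isClosed' := by
        have := D.isClosed'.isClosedEmbedding_subtypeVal.isClosedMap _
          (Subgroup.isClosed_of_isOpen Q₀ hQopen)
        exact this }
  have hQ : Q.toSubgroup = Q₀.map D.toSubgroup.subtype := rfl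
  have hQD : Q.toSubgroup ≤ D.toSubgroup := by
    rw [hQ]
    exact Subgroup.map_subtype_le Q₀
  have hsub : Q.toSubgroup.subgroupOf D.toSubgroup = Q₀ :=
    Subgroup.comap_map_eq_self_of_injective D.toSubgroup.subtype_injective Q₀
  have hindex : ¬ p ∣ Q.toSubgroup.relIndex D.toSubgroup := by
    rw [Subgroup.relIndex, hsub, Subgroup.index_comap_of_surjective _ (QuotientGroup.mk'_surjective _)]
    exact P.not_dvd_index
  have hDQ : D ≤ Q := h.2 (mem_oTr_of_not_dvd hQD hindex h.1) hQD
  have htop : P.toSubgroup = ⊤ := by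
    refine eq_top_iff.2 fun x _ => ?_
    obtain ⟨x, rfl⟩ := QuotientGroup.mk_surjective x
    have : x ∈ Q₀ := by
      rw [← hsub]
      exact hDQ x.2
    exact this
  exact P.2.of_equiv ((MulEquiv.subgroupCongr htop).trans Subgroup.topEquiv)

end TraceIdeals

/-! ## Closed subgroups of profinite groups -/

section ClosedSubgroups

variable {G : Type u} [Group G] [TopologicalSpace G] [IsTopologicalGroup G]

/-- The conjugate `gRg⁻¹` of a closed subgroup. -/
def conjClosed (g : G) (R : ClosedSubgroup G) : ClosedSubgroup G where
  toSubgroup := R.toSubgroup.comap (MulAut.conj g⁻¹).toMonoidHom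
  isClosed' := by
    have h : Continuous fun x : G => g⁻¹ * x * (g⁻¹)⁻¹ := by fun_prop
    exact R.isClosed'.preimage h

theorem mem_conjClosed {g : G} {R : ClosedSubgroup G} {x : G} :
    x ∈ (conjClosed g R).toSubgroup ↔ g⁻¹ * x * g ∈ R.toSubgroup := by
  rw [conjClosed, Subgroup.mem_comap]
  simp

theorem mem_conjClosed_sup {g : G} {R : ClosedSubgroup G} (N : OpenNormalSubgroup G) {x : G} :
    x ∈ (conjClosed g R).toSubgroup ⊔ N.toSubgroup ↔
      g⁻¹ * x * g ∈ R.toSubgroup ⊔ N.toSubgroup := by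
  rw [Subgroup.mem_sup_of_normal_right, Subgroup.mem_sup_of_normal_right]
  constructor
  · rintro ⟨y, hy, n, hn, rfl⟩
    refine ⟨_, mem_conjClosed.1 hy, g⁻¹ * n * g, ?_, by group⟩
    simpa using N.isNormal'.conj_mem n hn g⁻¹
  · rintro ⟨y, hy, n, hn, h⟩
    refine ⟨g * y * g⁻¹, mem_conjClosed.2 (by simpa [mul_assoc] using hy), g * n * g⁻¹,
      N.isNormal'.conj_mem n hn g, ?_⟩
    have : x = g * (g⁻¹ * x * g) * g⁻¹ := by group
    rw [this, ← h]
    group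

variable [CompactSpace G]

theorem relIndex_ne_zero_of_isOpen (D : ClosedSubgroup G) {Q : Subgroup G}
    (hQ : IsOpen (Q.subgroupOf D.toSubgroup : Set D.toSubgroup)) :
    Q.relIndex D.toSubgroup ≠ 0 := by
  have : CompactSpace D.toSubgroup := isCompact_iff_compactSpace.mp D.isClosed'.isCompact
  have : Finite (D.toSubgroup ⧸ Q.subgroupOf D.toSubgroup) :=
    Subgroup.quotient_finite_of_isOpen _ hQ
  have : (Q.subgroupOf D.toSubgroup).FiniteIndex := Subgroup.finiteIndex_of_finite_quotient
  exact this.index_ne_zero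

variable [TotallyDisconnectedSpace G]

theorem mem_of_forall_mem_sup (R : ClosedSubgroup G) {x : G}
    (h : ∀ N : OpenNormalSubgroup G, x ∈ R.toSubgroup ⊔ N.toSubgroup) : x ∈ R.toSubgroup := by
  by_contra hx
  have hopen : IsOpen ((fun y : G => x * y) ⁻¹' (R.toSubgroup : Set G)ᶜ) :=
    R.isClosed'.isOpen_compl.preimage (continuous_const_mul x)
  obtain ⟨N, hN⟩ := ProfiniteGrp.exist_openNormalSubgroup_sub_open_nhds_of_one hopen
    (by simpa using hx)
  obtain ⟨r, hr, n, hn, hrn⟩ := Subgroup.mem_sup_of_normal_right.1 (h N)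
  have := hN (inv_mem hn : n⁻¹ ∈ N)
  apply this
  show x * n⁻¹ ∈ R.toSubgroup
  rwa [← hrn, mul_inv_cancel_right]

/-- The elements conjugating $P$ into $RN$ form a closed non-empty set, and these sets are directed
in $N$; compactness of $G$ provides a common element. -/
theorem exists_conj_le_of_forall (P R : ClosedSubgroup G)
    (h : ∀ N : OpenNormalSubgroup G, ∃ g : G, ∀ x ∈ P.toSubgroup,
      g⁻¹ * x * g ∈ R.toSubgroup ⊔ N.toSubgroup) :
    ∃ g : G, P ≤ conjClosed g R := by
  let C (N : OpenNormalSubgroup G) : Set G :=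
    ⋂ x ∈ P.toSubgroup, {g : G | g⁻¹ * x * g ∈ R.toSubgroup ⊔ N.toSubgroup}
  have hC : ∀ N, IsClosed (C N) := fun N => by
    refine isClosed_biInter fun x _ => ?_
    have hcont : Continuous fun g : G => g⁻¹ * x * g := by fun_prop
    exact (Subgroup.isClosed_of_isOpen _
      (Subgroup.isOpen_mono (le_sup_right : N.toSubgroup ≤ R.toSubgroup ⊔ N.toSubgroup)
        N.isOpen')).preimage hcont
  obtain ⟨g, hg⟩ := IsCompact.nonempty_iInter_of_directed_nonempty_isCompact_isClosed C
    (fun N M => ⟨N ⊓ M, Set.biInter_mono le_rfl fun x _ g hg =>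
        sup_mono_openNormal R.toSubgroup inf_le_left hg,
      Set.biInter_mono le_rfl fun x _ g hg => sup_mono_openNormal R.toSubgroup inf_le_right hg⟩)
    (fun N => by
      obtain ⟨g, hg⟩ := h N
      exact ⟨g, Set.mem_iInter₂.2 hg⟩)
    (fun N => (hC N).isCompact) hC
  refine ⟨g, fun x hx => mem_conjClosed.2 (mem_of_forall_mem_sup R fun N => ?_)⟩
  exact Set.mem_iInter₂.1 (Set.mem_iInter.1 hg N) x hx

/-- From $RN\le PN\le g(RN)g^{-1}$ the indices in $G$ agree, so $RN=PN$ for every $N$. In particular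
no closed subgroup is conjugate into a proper closed subgroup of itself. -/
theorem le_of_forall_exists_conj (P R : ClosedSubgroup G) (hRP : R ≤ P)
    (h : ∀ N : OpenNormalSubgroup G, ∃ g : G, ∀ x ∈ P.toSubgroup,
      g⁻¹ * x * g ∈ R.toSubgroup ⊔ N.toSubgroup) : P ≤ R := by
  intro x hx
  refine mem_of_forall_mem_sup R fun N => ?_
  obtain ⟨g, hg⟩ := h N
  have hle : R.toSubgroup ⊔ N.toSubgroup ≤ P.toSubgroup ⊔ N.toSubgroup := sup_le_sup_right hRP _
  have h1 := Subgroup.relIndex_mul_index hle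
  have hsub : P.toSubgroup ⊔ N.toSubgroup ≤
      (R.toSubgroup ⊔ N.toSubgroup).map (MulAut.conj g : G ≃* G).toMonoidHom := by
    refine sup_le (fun x hx => ⟨_, hg x hx, ?_⟩) fun n hn => ⟨g⁻¹ * n * g, ?_, ?_⟩
    · simp [mul_assoc]
    · exact Subgroup.mem_sup_right (by simpa using N.isNormal'.conj_mem n hn g⁻¹)
    · simp [mul_assoc]
  have h2 : (R.toSubgroup ⊔ N.toSubgroup).index ∣ (P.toSubgroup ⊔ N.toSubgroup).index := by
    rw [← Subgroup.index_map_equiv _ (MulAut.conj g : G ≃* G)]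
    exact Subgroup.index_dvd_of_le hsub
  have h3 : (R.toSubgroup ⊔ N.toSubgroup).relIndex (P.toSubgroup ⊔ N.toSubgroup) = 1 := by
    have hne := index_ne_zero_of_openNormal P.toSubgroup N
    rw [← h1] at h2
    have h4 : (R.toSubgroup ⊔ N.toSubgroup).relIndex (P.toSubgroup ⊔ N.toSubgroup) *
        (P.toSubgroup ⊔ N.toSubgroup).index ∣ 1 * (P.toSubgroup ⊔ N.toSubgroup).index := by
      rwa [one_mul]
    exact Nat.dvd_one.1 (Nat.dvd_of_mul_dvd_mul_right (Nat.pos_of_ne_zero hne) h4)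
  exact Subgroup.relIndex_eq_one.1 h3 (Subgroup.mem_sup_left hx)

/-- An open subgroup of $D$ contains an open normal subgroup of $D$, whose index is a power of $p$;
hence $|Q':Q|$ is such a power, different from 1. -/
theorem dvd_relIndex_of_isProP {p : ℕ} [Fact p.Prime] {D : ClosedSubgroup G}
    (hD : IsProP p D.toSubgroup) {Q Q' : Subgroup G}
    (hQ : IsOpen (Q.subgroupOf D.toSubgroup : Set D.toSubgroup)) (hQQ' : Q < Q')
    (hQ'D : Q' ≤ D.toSubgroup) : p ∣ Q.relIndex Q' := by
  have : CompactSpace D.toSubgroup := isCompact_iff_compactSpace.mp D.isClosed'.isCompact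
  obtain ⟨U, hU⟩ := ProfiniteGrp.exist_openNormalSubgroup_sub_open_nhds_of_one hQ (one_mem _)
  have hle : U.toSubgroup ≤ Q.subgroupOf D.toSubgroup := hU
  obtain ⟨n, hn⟩ := IsPGroup.iff_card.1 (hD U)
  have h1 : Q.relIndex Q' ∣ p ^ n := by
    rw [← hn]
    exact ((Dvd.intro _ (Subgroup.relIndex_mul_relIndex Q Q' D.toSubgroup hQQ'.le hQ'D)).trans
      (Subgroup.index_dvd_of_le hle))
  obtain ⟨m, -, hm⟩ := (Nat.dvd_prime_pow Fact.out).1 h1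
  rw [hm]
  refine dvd_pow_self p fun h => ?_
  rw [h, pow_zero, Subgroup.relIndex_eq_one] at hm
  exact hQQ'.not_ge hm

end ClosedSubgroups

/-! ## Defect groups and the Brauer homomorphism -/

section Defect

variable {k : Type v} [Field k] {G : Type u} [Group G] [TopologicalSpace G] [IsTopologicalGroup G]

theorem mem_oTr_conjClosed {z : CompletedGroupAlgebra k G} {R : ClosedSubgroup G} (g : G)
    (h : z ∈ oTr R.toSubgroup) : z ∈ oTr (conjClosed g R).toSubgroup := by
  refine mem_oTr_iff.2 fun N => ?_
  obtain ⟨a, ha, hza⟩ := mem_oTr_iff.1 h N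
  refine ⟨conj (of k) g a, fun x hx => ?_, ?_⟩
  · show conj (of k) x (conj (of k) g a) = _
    have h1 := mem_fixedPoints_iff.1 ha _ ((mem_conjClosed_sup N).1 hx)
    conv_rhs => rw [← h1]
    rw [← conj_mul_apply, ← conj_mul_apply]
    congr 2
    group
  · rw [trace_conj g (fun x => mem_conjClosed_sup N) ha, hza]

theorem minimal_conjClosed {z : CompletedGroupAlgebra k G} {D : ClosedSubgroup G} (g : G)
    (h : Minimal (fun R : ClosedSubgroup G => z ∈ oTr R.toSubgroup) D) :
    Minimal (fun R : ClosedSubgroup G => z ∈ oTr R.toSubgroup) (conjClosed g D) := by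
  refine ⟨mem_oTr_conjClosed g h.1, fun S hS hSD x hx => ?_⟩
  have h1 : conjClosed g⁻¹ S ≤ D := fun y hy => by
    have h2 : g⁻¹ * (g⁻¹⁻¹ * y * g⁻¹) * g = y := by group
    have h3 := mem_conjClosed.1 (hSD (mem_conjClosed.1 hy))
    rwa [h2] at h3
  have h2 := h.2 (mem_oTr_conjClosed g⁻¹ hS) h1 (mem_conjClosed.1 hx)
  have h3 := mem_conjClosed.1 h2
  have h4 : g⁻¹⁻¹ * (g⁻¹ * x * g) * g⁻¹ = x := by group
  rwa [h4] at h3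

variable [CompactSpace G]

theorem mem_oTr_top {z : CompletedGroupAlgebra k G}
    (hz : z ∈ Subring.center (CompletedGroupAlgebra k G)) : z ∈ oTr (⊤ : Subgroup G) := by
  refine mem_oTr_iff.2 fun N => ⟨z, center_le_fixedPoints _ _ hz, ?_⟩
  rw [top_sup_eq, trace_of_mem_fixedPoints (k := k) (relIndex_ne_zero_of_openNormal N le_top ⊤)
    (center_le_fixedPoints _ _ hz), Subgroup.relIndex_self, one_smul]

/-- Zorn's lemma, the lower bound of a chain being its intersection. -/
theorem exists_minimal_mem_oTr {z : CompletedGroupAlgebra k G}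
    (hz : z ∈ Subring.center (CompletedGroupAlgebra k G)) :
    ∃ D : ClosedSubgroup G, Minimal (fun R : ClosedSubgroup G => z ∈ oTr R.toSubgroup) D := by
  have H : ∀ c ⊆ {R : ClosedSubgroup G | z ∈ oTr R.toSubgroup}, IsChain (· ≤ ·) c → ∀ R ∈ c,
      ∃ L ∈ {R : ClosedSubgroup G | z ∈ oTr R.toSubgroup}, ∀ S ∈ c, L ≤ S := by
    intro c hc hchain R hR
    let L : ClosedSubgroup G :=
      { (⨅ S : c, (S.1 : ClosedSubgroup G).toSubgroup) with
        isClosed' := by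
          show IsClosed ((⨅ S : c, (S.1 : ClosedSubgroup G).toSubgroup : Subgroup G) : Set G)
          rw [Subgroup.coe_iInf]
          exact isClosed_iInter fun S => (S.1 : ClosedSubgroup G).isClosed' }
    have hL : L.toSubgroup = ⨅ S : c, (S.1 : ClosedSubgroup G).toSubgroup := rfl
    refine ⟨L, mem_oTr_iff.2 fun N => ?_, fun S hS => ?_⟩
    · have : Nonempty c := ⟨⟨R, hR⟩⟩
      -- By compactness some member $S$ of the chain lies in the open subgroup $LN$, and a trace
      -- from $SN$ is a trace from $LN$.
      obtain ⟨S, hS⟩ := exists_subset_nhds_of_compactSpace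
        (V := fun S : c => ((S.1 : ClosedSubgroup G).toSubgroup : Set G))
        (U := (L.toSubgroup ⊔ N.toSubgroup : Subgroup G))
        (fun S T => by
          rcases hchain.total S.2 T.2 with h | h
          · exact ⟨S, subset_rfl, h⟩
          · exact ⟨T, h, subset_rfl⟩)
        (fun S => (S.1 : ClosedSubgroup G).isClosed')
        (fun x hx => by
          refine (Subgroup.isOpen_mono (le_sup_right : N.toSubgroup ≤ L.toSubgroup ⊔ N.toSubgroup)
            N.isOpen').mem_nhds (Subgroup.mem_sup_left ?_)
          rw [hL, ← SetLike.mem_coe, Subgroup.coe_iInf]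
          exact hx)
      exact exists_trace_eq_of_le N le_sup_right (sup_le hS le_sup_right)
        (mem_oTr_iff.1 (hc S.2) N)
    · exact (iInf_le (fun S : c => (S.1 : ClosedSubgroup G).toSubgroup) ⟨S, hS⟩ : _)
  obtain ⟨D, -, hD⟩ := @zorn_le_nonempty₀ (ClosedSubgroup G)ᵒᵈ _
    {R : ClosedSubgroup G | z ∈ oTr R.toSubgroup} (fun c hc hchain => H c hc hchain.symm)
    ({ (⊤ : Subgroup G) with isClosed' := isClosed_univ } : ClosedSubgroup G) (mem_oTr_top hz)
  exact ⟨D, hD⟩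

/-- Mackey's formula expresses $e=\mathrm{Tr}_{RN}^G(a)$ by traces to $P$ from the open subgroups
$P\cap g(RN)g^{-1}$. If none of these were equal to $P$, then $\mathrm{Br}_P(e)$ would vanish. -/
theorem exists_conj_mem_of_brauer_ne_zero {e : CompletedGroupAlgebra k G}
    (he : IsBlockIdempotent e) {P R : ClosedSubgroup G} (hR : e ∈ oTr R.toSubgroup)
    (hP : brauer P he ≠ 0) (N : OpenNormalSubgroup G) :
    ∃ g : G, ∀ x ∈ P.toSubgroup, g⁻¹ * x * g ∈ R.toSubgroup ⊔ N.toSubgroup := by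
  by_contra! hcon
  apply hP
  obtain ⟨a, ha, hea⟩ := mem_oTr_iff.1 hR N
  let S : AddSubgroup (CompletedGroupAlgebra k G) :=
    (Ideal.span (properTraces k P)).toAddSubgroup.map
      (fixedPoints k (of k) P.toSubgroup).subtype.toAddMonoidHom
  have hindex : (R.toSubgroup ⊔ N.toSubgroup).FiniteIndex := ⟨index_ne_zero_of_openNormal _ N⟩
  have hS : trace (of k) (R.toSubgroup ⊔ N.toSubgroup) ⊤ a ∈ S := by
    refine trace_mem_of_mackey P.toSubgroup ha S fun g Q hQP hQ => ?_
    have hopen : IsOpen (Q.subgroupOf P.toSubgroup : Set P.toSubgroup) := by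
      have hcont : Continuous fun x : P.toSubgroup => g⁻¹ * (x : G) * g := by fun_prop
      have h1 := (Subgroup.isOpen_mono
        (le_sup_right : N.toSubgroup ≤ R.toSubgroup ⊔ N.toSubgroup) N.isOpen').preimage hcont
      convert h1 using 1
      ext x
      exact hQ x x.2
    have hfix : conj (of k) g a ∈ fixedPoints k (of k) Q := fun x hx => by
      show conj (of k) x (conj (of k) g a) = _
      have h1 := mem_fixedPoints_iff.1 ha _ ((hQ x (hQP hx)).1 hx)
      conv_rhs => rw [← h1]
      rw [← conj_mul_apply, ← conj_mul_apply]
      congr 2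
      group
    refine ⟨⟨_, conj_trace_mem (relIndex_ne_zero_of_isOpen P hopen) hfix⟩,
      Ideal.subset_span ⟨Q, lt_of_le_of_ne hQP ?_, hopen, _, hfix, rfl⟩, rfl⟩
    rintro rfl
    obtain ⟨x, hx, hx'⟩ := hcon g
    exact hx' ((hQ x hx).1 hx)
  rw [hea] at hS
  obtain ⟨s, hs, hse⟩ := hS
  have hs' : s = ⟨e, he.mem_fixedPoints (of k) P.toSubgroup⟩ := Subtype.ext hse
  rw [brauer, brauerHom, Ideal.Quotient.eq_zero_iff_mem, ← hs']
  exact subset_closure hs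

end Defect

/-! ### Non-vanishing of the Brauer homomorphism on minimal subgroups -/

section BrauerNonvanishing

variable {k : Type v} [Field k] {G : Type u} [Group G] [TopologicalSpace G]

theorem map_trace_proj (N : OpenNormalSubgroup G) {H L : Subgroup G} (hfin : H.relIndex L ≠ 0)
    (a : CompletedGroupAlgebra k G) :
    proj k N (trace (of k) H L a) = trace (ofQ k N) H L (proj k N a) :=
  map_trace (ι' := ofQ k N) (proj k N).toRingHom (fun _ => rfl) hfin a

theorem map_trace_transition {N M : OpenNormalSubgroup G} (h : N ≤ M) {H L : Subgroup G}
    (hfin : H.relIndex L ≠ 0) (a : MonoidAlgebra k (G ⧸ N.toSubgroup)) :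
    transition k h (trace (ofQ k N) H L a) = trace (ofQ k M) H L (transition k h a) :=
  map_trace (transition k h).toRingHom (transition_ofQ h) hfin a

variable [IsTopologicalGroup G] [CompactSpace G]

/-- If, at all small levels, the block idempotent `e` is the sum of traces from the groups `H t`
and of a fixed element vanishing at level `N`, where `e` does not vanish, then it is a trace
from one of them. -/
theorem IsBlockIdempotent.exists_trace_eq {e : CompletedGroupAlgebra k G}
    (he : IsBlockIdempotent e) {N : OpenNormalSubgroup G} (hN : proj k N e ≠ 0) {T : Type*}
    [Fintype T] (H : T → Subgroup G) (M : OpenNormalSubgroup G) (hM : ∀ t, M.toSubgroup ≤ H t)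
    (h : ∀ L ≤ M, proj k L e ∈
      (⨆ t, (Subalgebra.toSubmodule (fixedPoints k (ofQ k L) (H t))).map
        (traceLinearMap (ofQ k L) (relIndex_ne_zero_of_openNormal M (hM t) ⊤))) ⊔
      (Subalgebra.toSubmodule (fixedPoints k (ofQ k L) ⊤) ⊓
        ⨅ h : L ≤ N, LinearMap.ker (transition k h).toLinearMap)) :
    ∃ t, ∃ a ∈ fixedPoints k (of k) (H t), trace (of k) (H t) ⊤ a = e := by
  classical
  have hfin : ∀ t, (H t).relIndex ⊤ ≠ 0 := fun t => relIndex_ne_zero_of_openNormal M (hM t) ⊤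
  -- There is one unknown for each subgroup `H t`, and the unknown `none` stands for the remainder
  -- that vanishes at level `N`.
  let P (L : OpenNormalSubgroup G) : Submodule k (Option T → MonoidAlgebra k (G ⧸ L.toSubgroup)) :=
    { carrier := {x | (∀ t, x (some t) ∈ fixedPoints k (ofQ k L) (H t)) ∧
        x none ∈ fixedPoints k (ofQ k L) ⊤ ∧ ∀ h : L ≤ N, transition k h (x none) = 0}
      add_mem' := fun {x y} hx hy => ⟨fun t => add_mem (hx.1 t) (hy.1 t), add_mem hx.2.1 hy.2.1,
        fun h => by rw [Pi.add_apply, map_add, hx.2.2 h, hy.2.2 h, add_zero]⟩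
      zero_mem' := ⟨fun t => zero_mem _, zero_mem _, fun h => map_zero _⟩
      smul_mem' := fun c {x} hx => ⟨fun t => Subalgebra.smul_mem _ (hx.1 t) c,
        Subalgebra.smul_mem _ hx.2.1 c, fun h => by
          rw [Pi.smul_apply, map_smul, hx.2.2 h, smul_zero]⟩ }
  let Φ (L : OpenNormalSubgroup G) : (Option T → MonoidAlgebra k (G ⧸ L.toSubgroup)) →ₗ[k]
      MonoidAlgebra k (G ⧸ L.toSubgroup) :=
    { toFun := fun x => ∑ t, trace (ofQ k L) (H t) ⊤ (x (some t)) + x none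
      map_add' := fun x y => by
        simp only [Pi.add_apply, trace_add (hfin _), Finset.sum_add_distrib]
        abel
      map_smul' := fun c x => by
        simp only [Pi.smul_apply, trace_smul, smul_add, Finset.smul_sum, RingHom.id_apply] }
  have hΦ : ∀ L x, Φ L x = ∑ t, trace (ofQ k L) (H t) ⊤ (x (some t)) + x none := fun _ _ => rfl
  obtain ⟨x, hx⟩ := exists_linear_solution P Φ
    (fun L L' h x hx => ⟨fun t => transition_mem_fixedPoints h (hx.1 t),
      transition_mem_fixedPoints h hx.2.1, fun h' => by
        rw [transition_transition]
        exact hx.2.2 (h.trans h')⟩)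
    (fun L L' h x _ => by
      rw [hΦ, hΦ, map_add, map_sum]
      congr 1
      exact Finset.sum_congr rfl fun t _ => (map_trace_transition h (hfin t) _).symm)
    e M (fun L hL => by
      obtain ⟨s, hs, y, hy, hsy⟩ := Submodule.mem_sup.1 (h L hL)
      obtain ⟨x, hx, hxs⟩ := (Submodule.mem_iSup_iff_exists_finsupp _ _).1 hs
      choose z hz hzx using hx
      refine ⟨fun o => o.elim y z, ⟨fun t => hz t, hy.1, fun h => ?_⟩, ?_⟩
      · exact (Submodule.mem_iInf _).1 hy.2 h
      · rw [hΦ, ← hsy, ← hxs]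
        congr 1
        rw [Finsupp.sum_fintype _ _ fun _ => rfl]
        exact Finset.sum_congr rfl fun t _ => hzx t)
  have hfix : ∀ t, x (some t) ∈ fixedPoints k (of k) (H t) := fun t =>
    mem_fixedPoints_of_proj fun L => (hx L).1.1 t
  -- The traces to $G$ are central, so one of them divides $e$; the central cofactor `w` can be
  -- moved inside the trace.
  obtain ⟨t, w, hw, hte⟩ := he.exists_mul_eq_of_sum hN
    (fun t => trace (of k) (H t) ⊤ (x (some t)))
    (fun t => fixedPoints_le_center (conj_trace_mem (hfin t) (hfix t))) (x none)
    (by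
      have := (hx N).1.2.2 le_rfl
      rwa [transition_proj] at this)
    (ext fun L => by
      rw [map_add, map_sum, ← (hx L).2, hΦ]
      congr 1
      exact Finset.sum_congr rfl fun t _ => (map_trace_proj L (hfin t) _).symm)
  refine ⟨t, x (some t) * w, mul_mem (hfix t) (center_le_fixedPoints _ _ hw), ?_⟩
  rw [trace_mul (k := k) (hfin t) _ (center_le_fixedPoints _ _ hw), hte]

variable [TotallyDisconnectedSpace G] {p : ℕ} [Fact p.Prime] [CharP k p]

/-- At level $N$ the group $D\cap N$ acts trivially, so $x$ is fixed by the group generated by $Q$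
and $D\cap N$. This group is larger than $Q$, and its index over $Q$ is divisible by $p$. -/
theorem trace_trace_eq_zero {D : ClosedSubgroup G} (hD : IsProP p D.toSubgroup)
    {N : OpenNormalSubgroup G} {Q : Subgroup G} (hQD : Q ≤ D.toSubgroup)
    (hopen : IsOpen (Q.subgroupOf D.toSubgroup : Set D.toSubgroup))
    (hN : ¬ D.toSubgroup ⊓ N.toSubgroup ≤ Q) {x : MonoidAlgebra k (G ⧸ N.toSubgroup)}
    (hx : x ∈ fixedPoints k (ofQ k N) Q) : trace (ofQ k N) Q D.toSubgroup x = 0 := by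
  let Q' := Q ⊔ (D.toSubgroup ⊓ N.toSubgroup)
  have hQ'D : Q' ≤ D.toSubgroup := sup_le hQD inf_le_left
  have hQQ' : Q < Q' := lt_of_le_of_ne le_sup_left fun h => hN (by rw [h]; exact le_sup_right)
  have hx' : x ∈ fixedPoints k (ofQ k N) Q' :=
    mem_fixedPoints_sup hx (fixedPoints_anti inf_le_right (mem_fixedPoints_ofQ N x))
  rw [trace_eq_relIndex_smul hQQ'.le hQ'D (relIndex_ne_zero_of_isOpen D hopen) hx',
    ← Nat.cast_smul_eq_nsmul k,
    (CharP.cast_eq_zero_iff k p _).2 (dvd_relIndex_of_isProP hD hopen hQQ' hQ'D), zero_smul]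

/-- Such a $Q$ equals $D\cap QN$ and is determined by its image in $G/N$. Finiteness allows one $Q$
to be chosen for all levels in `brauer_ne_zero_of_minimal`. -/
theorem finite_subgroups_between {G : Type*} [Group G] (D N : Subgroup G) [N.Normal]
    [Finite (G ⧸ N)] : Finite {Q : Subgroup G // D ⊓ N ≤ Q ∧ Q < D} := by
  refine Finite.of_injective (β := Subgroup (G ⧸ N)) (fun Q => Q.1.map (QuotientGroup.mk' N)) ?_
  have key : ∀ Q Q' : {Q : Subgroup G // D ⊓ N ≤ Q ∧ Q < D},
      Q.1.map (QuotientGroup.mk' N) = Q'.1.map (QuotientGroup.mk' N) → Q.1 ≤ Q'.1 := by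
    intro Q Q' h x hx
    have h1 : QuotientGroup.mk' N x ∈ Q'.1.map (QuotientGroup.mk' N) := by
      rw [← h]
      exact ⟨x, hx, rfl⟩
    obtain ⟨y, hy, hyx⟩ := h1
    have h2 : y⁻¹ * x ∈ Q'.1 := Q'.2.1 ⟨mul_mem (D.inv_mem (Q'.2.2.le hy)) (Q.2.2.le hx),
      QuotientGroup.eq.1 hyx⟩
    have := mul_mem hy h2
    rwa [mul_inv_cancel_left] at this
  exact fun Q Q' h => Subtype.ext (le_antisymm (key Q Q' h) (key Q' Q h.symm))

/-- If $\mathrm{Br}_D(e)=0$, then at any level $L$ the idempotent $e$ agrees with a combination $s$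
of proper traces to $D$. With $e=\mathrm{Tr}_{DL}^G(a)$ one gets
$\varphi_L(e)=\mathrm{Tr}_{DL}^G(\varphi_L(as))$. The summands from $Q\ge D\cap N$ become traces
from $QM$ to $G$, and the others vanish at level $N$. So $e$ is a trace from $QM$ for one of
finitely many $Q<D$, and a single $Q$ serves all $M$. -/
theorem brauer_ne_zero_of_minimal {e : CompletedGroupAlgebra k G} (he : IsBlockIdempotent e)
    {D : ClosedSubgroup G} (hD : IsProP p D.toSubgroup)
    (hmin : Minimal (fun R : ClosedSubgroup G => e ∈ oTr R.toSubgroup) D) : brauer D he ≠ 0 := by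
  obtain ⟨N, hN⟩ : ∃ N, proj k N e ≠ 0 := by
    by_contra! h
    exact he.ne_zero (ext fun N => by rw [h, map_zero])
  intro h0
  rw [brauer, brauerHom, Ideal.Quotient.eq_zero_iff_mem] at h0
  have hclosure : (⟨e, he.mem_fixedPoints (of k) D.toSubgroup⟩ : fixedPoints k (of k) D.toSubgroup) ∈
      closure (Ideal.span (properTraces k D) : Set (fixedPoints k (of k) D.toSubgroup)) := h0
  let T := {Q : Subgroup G // D.toSubgroup ⊓ N.toSubgroup ≤ Q ∧ Q < D.toSubgroup}
  have : Finite T := finite_subgroups_between _ _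
  have := Fintype.ofFinite T
  have key : ∀ M : OpenNormalSubgroup G, M ≤ N → ∃ t : T,
      ∃ a ∈ fixedPoints k (of k) (t.1 ⊔ M.toSubgroup), trace (of k) (t.1 ⊔ M.toSubgroup) ⊤ a = e := by
    intro M hMN
    refine he.exists_trace_eq hN (fun t : T => t.1 ⊔ M.toSubgroup) M (fun t => le_sup_right)
      fun L hL => ?_
    set J := (⨆ t : T, (Subalgebra.toSubmodule (fixedPoints k (ofQ k L) (t.1 ⊔ M.toSubgroup))).map
        (traceLinearMap (ofQ k L) (relIndex_ne_zero_of_openNormal M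
          (le_sup_right : M.toSubgroup ≤ t.1 ⊔ M.toSubgroup) ⊤))) ⊔
      (Subalgebra.toSubmodule (fixedPoints k (ofQ k L) ⊤) ⊓
        ⨅ h : L ≤ N, LinearMap.ker (transition k h).toLinearMap) with hJ
    have hfinL : (D.toSubgroup ⊔ L.toSubgroup).relIndex ⊤ ≠ 0 :=
      relIndex_ne_zero_of_openNormal L le_sup_right ⊤
    -- The free factor `a` makes the claim stable under multiplication in the ideal: a coefficient
    -- of `s` is absorbed into `a`.
    have hmem : ∀ s ∈ Ideal.span (properTraces k D), ∀ a ∈ fixedPoints k (of k) D.toSubgroup,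
        trace (ofQ k L) (D.toSubgroup ⊔ L.toSubgroup) ⊤ (proj k L (a * s)) ∈ J := by
      intro s hs
      refine Submodule.span_induction (p := fun (s : fixedPoints k (of k) D.toSubgroup) _ => ∀ a ∈ fixedPoints k (of k) D.toSubgroup,
        trace (ofQ k L) (D.toSubgroup ⊔ L.toSubgroup) ⊤ (proj k L (a * s)) ∈ J) ?_ ?_ ?_ ?_ hs
      · rintro s ⟨Q, hQD, hopen, b, hb, hsb⟩ a ha
        have hfinQ := relIndex_ne_zero_of_isOpen D hopen
        rw [hsb, ← mul_trace (k := k) hfinQ b ha, map_trace_proj L hfinQ]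
        have hx := proj_mem_fixedPoints L (mul_mem (fixedPoints_anti hQD.le ha) hb)
        set x := proj k L (a * b) with hxdef
        have hxQ := mem_fixedPoints_ofQ_sup hx
        by_cases hQ : D.toSubgroup ⊓ N.toSubgroup ≤ Q
        -- As $D\cap N\le Q$ and $L\le N$, one has $D\cap QL=Q$, so $D/Q$ and $DL/QL$ are in
        -- bijection.
        · have h1 : trace (ofQ k L) Q D.toSubgroup x =
              trace (ofQ k L) (Q ⊔ L.toSubgroup) (D.toSubgroup ⊔ L.toSubgroup) x := by
            refine trace_congr_subgroup hxQ le_sup_left (fun d hd => ?_) fun d' hd' => ?_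
            · refine ⟨fun h => Subgroup.mem_sup_left h, fun h => ?_⟩
              obtain ⟨q, hq, l, hl, rfl⟩ := Subgroup.mem_sup_of_normal_right.1 h
              refine mul_mem hq (hQ ⟨?_, hMN (hL hl)⟩)
              have := mul_mem (inv_mem (hQD.le hq)) hd
              rwa [inv_mul_cancel_left] at this
            · obtain ⟨d, hd, l, hl, rfl⟩ := Subgroup.mem_sup_of_normal_right.1 hd'
              exact ⟨d, hd, by rw [inv_mul_cancel_left]; exact Subgroup.mem_sup_right hl⟩
          have hfinQL := relIndex_ne_zero_of_openNormal L
            (le_sup_right : L.toSubgroup ≤ Q ⊔ L.toSubgroup)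
          rw [h1, trace_trace (sup_le_sup_right hQD.le _) le_top (hfinQL ⊤) hxQ,
            ← trace_trace (sup_mono_openNormal Q hL) le_top (hfinQL ⊤) hxQ]
          refine Submodule.mem_sup_left (Submodule.mem_iSup_of_mem (⟨Q, hQ, hQD⟩ : T) ?_)
          exact ⟨_, conj_trace_mem (hfinQL _) hxQ, rfl⟩
        · refine Submodule.mem_sup_right ⟨conj_trace_mem hfinL
            (mem_fixedPoints_ofQ_sup (conj_trace_mem hfinQ hx)), (Submodule.mem_iInf _).2 fun h => ?_⟩
          show transition k h _ = 0
          rw [map_trace_transition h hfinL, map_trace_transition h hfinQ,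
            trace_trace_eq_zero hD hQD.le hopen hQ (transition_mem_fixedPoints h hx)]
          exact (traceLinearMap (k := k) (ofQ k N) hfinL).map_zero
      · intro a _
        have h1 : proj k L (a * ((0 : fixedPoints k (of k) D.toSubgroup) : _)) = 0 := by simp
        have h2 : trace (ofQ k L) (D.toSubgroup ⊔ L.toSubgroup) ⊤ 0 = 0 :=
          (traceLinearMap (k := k) (ofQ k L) hfinL).map_zero
        rw [h1, h2]
        exact zero_mem J
      · intro s s' _ _ hs hs' a ha
        have h1 : proj k L (a * ((s + s' : fixedPoints k (of k) D.toSubgroup) : _)) =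
            proj k L (a * s) + proj k L (a * s') := by
          rw [← map_add, ← mul_add]
          rfl
        rw [h1, trace_add hfinL]
        exact add_mem (hs a ha) (hs' a ha)
      · intro c s _ hs a ha
        have h1 : a * ((c • s : fixedPoints k (of k) D.toSubgroup) : CompletedGroupAlgebra k G) =
            a * c * s := by
          rw [mul_assoc]
          rfl
        rw [h1]
        exact hs _ (mul_mem ha c.2)
    obtain ⟨a, ha, hae⟩ := mem_oTr_iff.1 hmin.1 L
    -- Elements with the same component as $e$ at level $L$ form an open neighborhood of $e$, so it
    -- meets the ideal itself and not only its closure.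
    obtain ⟨s, hse, hs⟩ := mem_closure_iff.1 hclosure
      {s | proj k L (s : CompletedGroupAlgebra k G) = proj k L e}
      (by
        let _ : TopologicalSpace (MonoidAlgebra k (G ⧸ L.toSubgroup)) := ⊥
        have : DiscreteTopology (MonoidAlgebra k (G ⧸ L.toSubgroup)) := ⟨rfl⟩
        exact (isOpen_discrete {proj k L e}).preimage
          ((continuous_proj L).comp continuous_subtype_val)) rfl
    have h1 := hmem s hs a (fixedPoints_anti le_sup_left ha)
    have hse' : proj k L (s : CompletedGroupAlgebra k G) = proj k L e := hse
    rw [map_mul, hse', ← map_mul, ← map_trace_proj L hfinL,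
      trace_mul (k := k) hfinL a (he.mem_fixedPoints (of k) ⊤), hae, he.idem] at h1
    exact h1
  -- Otherwise each of the finitely many $Q$ fails at some level, and all fail at a common smaller
  -- level, contrary to `key`.
  have hQ : ∃ t : T, e ∈ oTr t.1 := by
    by_contra! hcon
    have h1 : ∀ t : T, ∃ M : OpenNormalSubgroup G, ¬ ∃ a ∈ fixedPoints k (of k) (t.1 ⊔ M.toSubgroup),
        trace (of k) (t.1 ⊔ M.toSubgroup) ⊤ a = e := fun t => by
      by_contra! h
      exact hcon t (mem_oTr_iff.2 h)
    choose M hM using h1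
    obtain ⟨M₀, hM₀⟩ := Finite.exists_ge M
    obtain ⟨t, ht⟩ := key (M₀ ⊓ N) inf_le_right
    exact hM t (exists_trace_eq_of_le (M₀ ⊓ N) le_sup_right
      (sup_mono_openNormal t.1 (inf_le_left.trans (hM₀ t))) ht)
  obtain ⟨⟨Q, hQN, hQD⟩, hQ⟩ := hQ
  have hopen : IsOpen (Q.subgroupOf D.toSubgroup : Set D.toSubgroup) := by
    refine Subgroup.isOpen_mono (H₁ := N.toSubgroup.subgroupOf D.toSubgroup)
      (fun x hx => hQN ⟨x.2, hx⟩) ?_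
    exact N.isOpen'.preimage continuous_subtype_val
  have hclosed : IsClosed (Q : Set G) := by
    have h1 := D.isClosed'.isClosedEmbedding_subtypeVal.isClosedMap _
      (Subgroup.isClosed_of_isOpen (Q.subgroupOf D.toSubgroup) hopen)
    convert h1 using 1
    ext x
    constructor
    · exact fun hx => ⟨⟨x, hQD.le hx⟩, hx, rfl⟩
    · rintro ⟨y, hy, rfl⟩
      exact hy
  have hle : D ≤ (⟨Q, hclosed⟩ : ClosedSubgroup G) := hmin.2 (y := ⟨Q, hclosed⟩) hQ hQD.le
  exact hQD.not_ge hle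

/-- Besides the lemmas above, the passage from a maximal $D$ back to the trace condition uses a
minimal $D'$: $D$ lies in a conjugate of $D'$, which is itself pro-$p$ with non-zero Brauer image,
so maximality makes them equal. -/
theorem tfae_brauer {e : CompletedGroupAlgebra k G} (he : IsBlockIdempotent e)
    (D : ClosedSubgroup G) :
    List.TFAE [
      Minimal (fun R : ClosedSubgroup G => e ∈ oTr R.toSubgroup) D,
      IsProP p D.toSubgroup ∧ e ∈ oTr D.toSubgroup ∧ brauer D he ≠ 0,
      Maximal (fun R : ClosedSubgroup G => IsProP p R.toSubgroup ∧ brauer R he ≠ 0) D] := by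
  have h12 : ∀ D : ClosedSubgroup G, Minimal (fun R : ClosedSubgroup G => e ∈ oTr R.toSubgroup) D →
      IsProP p D.toSubgroup ∧ e ∈ oTr D.toSubgroup ∧ brauer D he ≠ 0 := fun D h =>
    ⟨isProP_of_minimal h, h.1, brauer_ne_zero_of_minimal he (isProP_of_minimal (p := p) h) h⟩
  tfae_have 1 → 2 := h12 D
  tfae_have 2 → 1 := fun ⟨_, hD, hbr⟩ => ⟨hD, fun R hR hRD =>
    le_of_forall_exists_conj D R hRD fun N => exists_conj_mem_of_brauer_ne_zero he hR hbr N⟩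
  tfae_have 2 → 3 := fun ⟨hp, hD, hbr⟩ => ⟨⟨hp, hbr⟩, fun R hR hDR =>
    le_of_forall_exists_conj R D hDR fun N => exists_conj_mem_of_brauer_ne_zero he hD hR.2 N⟩
  tfae_have 3 → 2 := by
    intro h
    obtain ⟨D', hD'⟩ := exists_minimal_mem_oTr he.mem_center
    obtain ⟨g, hg⟩ := exists_conj_le_of_forall D D' fun N =>
      exists_conj_mem_of_brauer_ne_zero he hD'.1 h.1.2 N
    obtain ⟨hp, hO, hbr⟩ := h12 _ (minimal_conjClosed g hD')
    have h1 := h.2 ⟨hp, hbr⟩ hg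
    exact ⟨h.1.1, oTr_mono h1 hO, h.1.2⟩
  tfae_finish

end BrauerNonvanishing

/-! ## Functoriality and continuity -/

section Functoriality

variable {k : Type v} [Field k] {G : Type u} [Group G] [TopologicalSpace G]
  {Γ : Type u} [Group Γ] [TopologicalSpace Γ]

/-- The preimage of an open normal subgroup under a continuous homomorphism. -/
def comapOpenNormal (f : G →* Γ) (hf : Continuous f) (K : OpenNormalSubgroup Γ) :
    OpenNormalSubgroup G where
  toOpenSubgroup := K.toOpenSubgroup.comap f hf
  isNormal' := K.isNormal'.comap f

variable (k) in
/-- The homomorphism `k[[G]] → k[[Γ]]` induced by a continuous homomorphism `G → Γ`. -/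
def mapHom (f : G →* Γ) (hf : Continuous f) :
    CompletedGroupAlgebra k G →ₐ[k] CompletedGroupAlgebra k Γ :=
  let c (K : OpenNormalSubgroup Γ) :
      CompletedGroupAlgebra k G →ₐ[k] MonoidAlgebra k (Γ ⧸ K.toSubgroup) :=
    (MonoidAlgebra.mapDomainAlgHom k k
      (QuotientGroup.map (comapOpenNormal f hf K).toSubgroup K.toSubgroup f le_rfl)).comp
      (proj k (comapOpenNormal f hf K))
  AlgHom.codRestrict (AlgHom.pi c) (compatibleFamilies k Γ) (by
    intro x N M h
    have h' : comapOpenNormal f hf N ≤ comapOpenNormal f hf M := fun g hg => h hg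
    show transition k h (MonoidAlgebra.mapDomainAlgHom k k _ (proj k (comapOpenNormal f hf N) x)) =
      MonoidAlgebra.mapDomainAlgHom k k _ (proj k (comapOpenNormal f hf M) x)
    rw [← transition_proj x h']
    unfold transition
    rw [mapDomain_mapDomain, mapDomain_mapDomain]
    congr 2
    ext g
    rfl)

theorem mapHom_of (f : G →* Γ) (hf : Continuous f) (g : G) :
    mapHom k f hf (of k g) = of k (f g) := by
  ext K : 1
  exact mapDomain_of k
    (QuotientGroup.map (comapOpenNormal f hf K).toSubgroup K.toSubgroup f le_rfl) _

theorem continuous_mapHom (f : G →* Γ) (hf : Continuous f) : Continuous (mapHom k f hf) := by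
  refine (continuous_iff_proj _).2 fun K => ?_
  let _ : TopologicalSpace (MonoidAlgebra k (G ⧸ (comapOpenNormal f hf K).toSubgroup)) := ⊥
  have : DiscreteTopology (MonoidAlgebra k (G ⧸ (comapOpenNormal f hf K).toSubgroup)) := ⟨rfl⟩
  let _ : TopologicalSpace (MonoidAlgebra k (Γ ⧸ K.toSubgroup)) := ⊥
  exact (continuous_of_discreteTopology (f := MonoidAlgebra.mapDomainAlgHom k k
      (QuotientGroup.map (comapOpenNormal f hf K).toSubgroup K.toSubgroup f le_rfl))).comp
    (continuous_proj (comapOpenNormal f hf K))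

theorem incl_eq_mapHom (H : Subgroup G) :
    incl k H = mapHom k H.subtype continuous_subtype_val := rfl

theorem continuous_incl (H : Subgroup G) : Continuous (incl k H) := by
  rw [incl_eq_mapHom]
  exact continuous_mapHom _ _

instance : ContinuousSMul (CompletedGroupAlgebra k (G × G)) (CompletedGroupAlgebra k G) where
  continuous_smul := by
    refine (continuous_iff_proj _).2 fun N => ?_
    let _ : TopologicalSpace (MonoidAlgebra k ((G × G) ⧸ (square N).toSubgroup)) := ⊥
    have : DiscreteTopology (MonoidAlgebra k ((G × G) ⧸ (square N).toSubgroup)) := ⟨rfl⟩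
    let _ : TopologicalSpace (MonoidAlgebra k (G ⧸ N.toSubgroup)) := ⊥
    have : DiscreteTopology (MonoidAlgebra k (G ⧸ N.toSubgroup)) := ⟨rfl⟩
    let m (z : MonoidAlgebra k ((G × G) ⧸ (square N).toSubgroup) × MonoidAlgebra k (G ⧸ N.toSubgroup)) :
        MonoidAlgebra k (G ⧸ N.toSubgroup) :=
      groupBimodule k (G ⧸ N.toSubgroup) (MonoidAlgebra.mapDomainAlgHom k k (squareQuotient N) z.1) z.2
    have hm : Continuous m := continuous_of_discreteTopology
    have h₁ : Continuous (proj k (square N)) := continuous_proj (square N)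
    have h₂ : Continuous (proj k N) := continuous_proj N
    have h₃ : Continuous fun z : CompletedGroupAlgebra k (G × G) × CompletedGroupAlgebra k G =>
        m (proj k (square N) z.1, proj k N z.2) :=
      hm.comp ((h₁.comp continuous_fst).prodMk (h₂.comp continuous_snd))
    have h₄ : (fun z : CompletedGroupAlgebra k (G × G) × CompletedGroupAlgebra k G =>
        m (proj k (square N) z.1, proj k N z.2)) = fun z => proj k N (z.1 • z.2) := by
      funext z
      rw [proj_smul]
      rfl
    rw [h₄] at h₃
    exact h₃

instance : IsScalarTower k (CompletedGroupAlgebra k (G × G)) (CompletedGroupAlgebra k G) where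
  smul_assoc r a x := by
    ext N : 1
    rw [proj_smul, map_smul, map_smul, map_smul, LinearMap.smul_apply, proj_smul]

/-- A continuous `k`-linear map commuting with the group elements is `k[[G]]`-linear. -/
theorem map_smul_of_map_of_smul {V W : Type*} [AddCommGroup V] [Module k V]
    [Module (CompletedGroupAlgebra k G) V] [IsScalarTower k (CompletedGroupAlgebra k G) V]
    [TopologicalSpace V] [ContinuousSMul (CompletedGroupAlgebra k G) V]
    [AddCommGroup W] [Module k W]
    [Module (CompletedGroupAlgebra k G) W] [IsScalarTower k (CompletedGroupAlgebra k G) W]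
    [TopologicalSpace W] [ContinuousSMul (CompletedGroupAlgebra k G) W] [T2Space W]
    (β : V →ₗ[k] W) (hβ : Continuous β) (h : ∀ (g : G) (v : V), β (of k g • v) = of k g • β v)
    (a : CompletedGroupAlgebra k G) (v : V) : β (a • v) = a • β v := by
  let f₁ : CompletedGroupAlgebra k G →ₗ[k] W :=
    { toFun := fun a => β (a • v)
      map_add' := fun a b => by rw [add_smul, map_add]
      map_smul' := fun r a => by rw [smul_assoc, map_smul, RingHom.id_apply] }
  let f₂ : CompletedGroupAlgebra k G →ₗ[k] W :=
    { toFun := fun a => a • β v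
      map_add' := fun a b => by rw [add_smul]
      map_smul' := fun r a => by rw [smul_assoc, RingHom.id_apply] }
  exact linearMap_ext f₁ f₂ (hβ.comp (continuous_id.smul continuous_const))
    (continuous_id.smul continuous_const) (fun g => h g v) a

variable (k G) in
/-- The embedding `a ↦ a ⊗ 1` of `k[[G]]` into `k[[G × G]]`. -/
def leftIncl : CompletedGroupAlgebra k G →ₐ[k] CompletedGroupAlgebra k (G × G) :=
  mapHom k (MonoidHom.inl G G) (Continuous.prodMk continuous_id continuous_const)

theorem leftIncl_of (g : G) : leftIncl k G (of k g) = of k (g, 1) := mapHom_of _ _ g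

theorem continuous_leftIncl : Continuous (leftIncl k G) := continuous_mapHom _ _

theorem leftIncl_smul (a x : CompletedGroupAlgebra k G) : leftIncl k G a • x = a * x := by
  let f₁ : CompletedGroupAlgebra k G →ₗ[k] CompletedGroupAlgebra k G :=
    { toFun := fun a => leftIncl k G a • x
      map_add' := fun a b => by rw [map_add, add_smul]
      map_smul' := fun r a => by rw [map_smul, smul_assoc, RingHom.id_apply] }
  refine linearMap_ext f₁ (LinearMap.mulRight k x) (continuous_leftIncl.smul continuous_const)
    (continuous_mul_const x) (fun g => ?_) a
  show leftIncl k G (of k g) • x = of k g * x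
  rw [leftIncl_of, of_smul, inv_one, map_one, mul_one]

theorem of_mul_leftIncl (g : G) (a : CompletedGroupAlgebra k G) :
    of k ((1 : G), g) * leftIncl k G a = leftIncl k G a * of k ((1 : G), g) := by
  refine linearMap_ext (LinearMap.mulLeft k (of k ((1 : G), g)) ∘ₗ (leftIncl k G).toLinearMap)
    (LinearMap.mulRight k (of k ((1 : G), g)) ∘ₗ (leftIncl k G).toLinearMap)
    ((continuous_const_mul _).comp continuous_leftIncl)
    ((continuous_mul_const _).comp continuous_leftIncl) (fun x => ?_) a
  show of k ((1 : G), g) * leftIncl k G (of k x) = leftIncl k G (of k x) * of k ((1 : G), g)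
  rw [leftIncl_of, ← map_mul, ← map_mul]
  simp

/-- It translates the diagonal action into conjugation of the left factor, so that sums over
diagonal translates become traces. -/
theorem of_diag_mul_leftIncl (g : G) (a : CompletedGroupAlgebra k G) :
    of k (g, g) * leftIncl k G a = leftIncl k G (conj (of k) g a) * of k (g, g) := by
  have h1 : of k (g, g) = of k (g, (1 : G)) * of k ((1 : G), g) := by
    rw [← map_mul]
    simp
  have h2 : of k ((1 : G), g) = of k (g⁻¹, (1 : G)) * of k (g, g) := by
    rw [← map_mul]
    simp
  rw [conj_apply, map_mul, map_mul, leftIncl_of, leftIncl_of, mul_assoc _ (of k (g⁻¹, (1 : G))), ← h2,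
    mul_assoc, ← of_mul_leftIncl, h1, mul_assoc]

end Functoriality

/-! ## Relative projectivity of blocks -/

section Projective

variable {k : Type v} [Field k] {G : Type u} [Group G] [TopologicalSpace G]

theorem IsPseudocompactModule.t2Space {A : Type*} [Ring A] [Algebra k A] [TopologicalSpace A]
    {V : Type*} [AddCommGroup V] [Module k V] [Module A V] [IsScalarTower k A V]
    [TopologicalSpace V] (hV : IsPseudocompactModule k A V) : T2Space V := by
  have := hV.isTopologicalAddGroup
  refine IsTopologicalAddGroup.t2Space_of_zero_sep fun x hx => ?_
  by_contra! h
  exact hx (hV.separated x fun O hO => h O (hO.1.mem_nhds O.zero_mem))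

/-- Linear compactness of pseudocompact modules. -/
theorem IsPseudocompactModule.exists_forall_mem {A : Type*} [Ring A] [Algebra k A]
    [TopologicalSpace A] {V : Type*} [AddCommGroup V] [Module k V] [Module A V]
    [IsScalarTower k A V] [TopologicalSpace V] (hV : IsPseudocompactModule k A V)
    (S : Submodule A V → Set V) (hne : ∀ O, IsOpenCofinite k O → (S O).Nonempty)
    (haff : ∀ O, ∀ x ∈ S O, ∀ y ∈ S O, ∀ z ∈ S O, ∀ c : k, x + c • (y - z) ∈ S O)
    (hS : ∀ O, ∀ x ∈ S O, ∀ u ∈ O, x + u ∈ S O)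
    (hanti : ∀ O O', O ≤ O' → S O ⊆ S O') :
    ∃ y, ∀ O, IsOpenCofinite k O → y ∈ S O := by
  have hdir : ∀ i j : {O : Submodule A V // IsOpenCofinite k O}, ∃ l, l ≤ i ∧ l ≤ j := by
    rintro ⟨O, hO⟩ ⟨O', hO'⟩
    obtain ⟨L, hL, hLO⟩ := hV.basis _ (Filter.inter_mem (hO.1.mem_nhds O.zero_mem)
      (hO'.1.mem_nhds O'.zero_mem))
    exact ⟨⟨L, hL⟩, fun x hx => (hLO hx).1, fun x hx => (hLO hx).2⟩
  have : Nonempty {O : Submodule A V // IsOpenCofinite k O} := by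
    obtain ⟨L, hL, -⟩ := hV.basis _ Filter.univ_mem
    exact ⟨⟨L, hL⟩⟩
  have hfin : ∀ i : {O : Submodule A V // IsOpenCofinite k O}, Module.Finite k (V ⧸ i.1) :=
    fun i => i.2.2
  obtain ⟨y, hy⟩ := exists_forall_mem_of_complete hdir
    (fun i => (i.1.mkQ).restrictScalars k) (fun i => i.1.mkQ_surjective)
    (fun i j hij x hx => by
      have h1 : Submodule.Quotient.mk (p := i.1) x = 0 := hx
      exact (Submodule.Quotient.mk_eq_zero _).2 (hij ((Submodule.Quotient.mk_eq_zero _).1 h1)))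
    (fun x hx => by
      classical
      -- Completeness is formulated for families indexed by all submodules; only the open cofinite
      -- ones matter, hence the value 0 elsewhere.
      obtain ⟨y, hy⟩ := hV.complete (fun O => if h : IsOpenCofinite k O then x ⟨O, h⟩ else 0)
        (fun O O' h hO hO' => by
          rw [dif_pos hO, dif_pos hO']
          obtain ⟨v, hv⟩ := O.mkQ_surjective (x ⟨O, hO⟩)
          rw [← hv, ← hx ⟨O, hO⟩ ⟨O', hO'⟩ h v hv]
          rfl)
      refine ⟨y, fun i => ?_⟩
      have := hy i.1 i.2
      rwa [dif_pos i.2] at this)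
    (fun i => S i.1) (fun i => hne i.1 i.2) (fun i => haff i.1)
    (fun i x hx y hy => by
      have h1 : y - x ∈ i.1 := (Submodule.Quotient.eq _).1 hy
      have h2 := hS i.1 x hx _ h1
      rwa [add_sub_cancel] at h2)
    (fun i j hij => hanti i.1 j.1 hij)
  exact ⟨y, fun O hO => hy ⟨O, hO⟩⟩

/-- The block idempotent as an element of its block. -/
def blockOne {e : CompletedGroupAlgebra k G} (he : IsBlockIdempotent e) : block e he :=
  ⟨e, 1, (one_mul e).symm⟩

theorem of_diag_smul_blockOne {e : CompletedGroupAlgebra k G} (he : IsBlockIdempotent e) (g : G) :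
    of k (g, g) • blockOne he = blockOne he := by
  refine Subtype.ext ?_
  show of k (g, g) • e = e
  rw [of_smul]
  exact conj_eq_of_mem_center he.mem_center g

theorem leftIncl_smul_blockOne {e : CompletedGroupAlgebra k G} (he : IsBlockIdempotent e)
    (x : block e he) : leftIncl k G x.1 • blockOne he = x := by
  refine Subtype.ext ?_
  show leftIncl k G x.1 • e = x.1
  obtain ⟨_, a, rfl⟩ := x
  rw [leftIncl_smul, mul_assoc, he.idem]

/-- The homomorphism from a block to a pseudocompact module given by a fixed point of `δ(G)`. -/
def blockLift {e : CompletedGroupAlgebra k G} (he : IsBlockIdempotent e) {V : Type*}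
    [AddCommGroup V] [Module k V] [Module (CompletedGroupAlgebra k (G × G)) V]
    [IsScalarTower k (CompletedGroupAlgebra k (G × G)) V] [TopologicalSpace V]
    (hV : IsPseudocompactModule k (CompletedGroupAlgebra k (G × G)) V) (v : V)
    (hv : ∀ g : G, of k (g, g) • v = v) : block e he →L[CompletedGroupAlgebra k (G × G)] V :=
  have := hV.continuousSMul
  have := hV.t2Space
  { toFun := fun x => leftIncl k G x.1 • v
    map_add' := fun x y => by
      rw [show (x + y).1 = x.1 + y.1 from rfl, map_add, add_smul]
    map_smul' := fun c x => by
      let β : CompletedGroupAlgebra k G →ₗ[k] V :=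
        { toFun := fun x => leftIncl k G x • v
          map_add' := fun x y => by rw [map_add, add_smul]
          map_smul' := fun r x => by rw [map_smul, smul_assoc, RingHom.id_apply] }
      refine map_smul_of_map_of_smul β (continuous_leftIncl.smul continuous_const) ?_ c x.1
      rintro ⟨g₁, g₂⟩ x
      show leftIncl k G (of k (g₁, g₂) • x) • v = of k (g₁, g₂) • leftIncl k G x • v
      -- For a $\delta(G)$-fixed vector, right multiplication by $g_2^{-1}$ in the block turns into
      -- the action of $(1,g_2)$.
      have h1 : of k (g₂⁻¹, (1 : G)) • v = of k ((1 : G), g₂) • v := by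
        conv_lhs => rw [← hv g₂]
        rw [smul_smul, ← map_mul]
        simp
      have h2 : of k (g₁, g₂) = of k (g₁, (1 : G)) * of k ((1 : G), g₂) := by
        rw [← map_mul]
        simp
      rw [of_smul, map_mul, map_mul, leftIncl_of, leftIncl_of, mul_smul, mul_smul, h1, h2, mul_smul,
        smul_smul (leftIncl k G x), ← of_mul_leftIncl, mul_smul]
    cont := (continuous_leftIncl.comp continuous_subtype_val).smul continuous_const }

theorem blockLift_apply {e : CompletedGroupAlgebra k G} (he : IsBlockIdempotent e) {V : Type*}
    [AddCommGroup V] [Module k V] [Module (CompletedGroupAlgebra k (G × G)) V]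
    [IsScalarTower k (CompletedGroupAlgebra k (G × G)) V] [TopologicalSpace V]
    (hV : IsPseudocompactModule k (CompletedGroupAlgebra k (G × G)) V) (v : V)
    (hv : ∀ g : G, of k (g, g) • v = v) (x : block e he) :
    blockLift he hV v hv x = leftIncl k G x.1 • v := rfl

variable [IsTopologicalGroup G] [CompactSpace G] [TotallyDisconnectedSpace G]

/-- A form of Higman's criterion. The vector $v_0=\psi(e)$ is $\delta(D)$-fixed, and modulo an open
$O$ it is $\delta(DN)$-fixed for small $N$. If $e=\mathrm{Tr}_{DN}^G(a)$, then $v=\sum_{g\in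
G/DN}(g,g)(a\otimes1)v_0$ is $\delta(G)$-fixed modulo $O$ and $\beta(v)=ew=w$. Linear compactness of
`V` gives an exactly fixed $v$, and `blockLift` the homomorphism. -/
theorem isRelativelyProjective_of_mem_oTr {e : CompletedGroupAlgebra k G}
    (he : IsBlockIdempotent e) {D : ClosedSubgroup G} (hD : e ∈ oTr D.toSubgroup) :
    IsRelativelyProjective k (block e he) (diagonal D) := by
  intro V W _ _ _ _ _ _ _ _ _ _ hV hW β φ _ ⟨ψ, _, hψ, hβψ⟩
  have := hV.isTopologicalAddGroup
  have := hV.continuousSMul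
  set v₀ := ψ (blockOne he) with hv₀
  set w := φ (blockOne he) with hw
  have hv₀D : ∀ d ∈ D.toSubgroup, of k (d, d) • v₀ = v₀ := by
    intro d hd
    have h1 := hψ (of k ⟨(d, d), ⟨d, hd, rfl⟩⟩) (blockOne he)
    rw [incl_of, of_diag_smul_blockOne] at h1
    exact h1.symm
  have hwG : ∀ g : G, of k (g, g) • w = w := fun g => by
    rw [hw, ← map_smul, of_diag_smul_blockOne]
  obtain ⟨v, hv⟩ := hV.exists_forall_mem
    -- The equation $\beta(v)=w$ is required only modulo submodules $O'$ with
    -- $O\subseteq\beta^{-1}(O')$, so that the condition depends on $v$ modulo $O$ alone.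
    (fun O => {v | (∀ g : G, of k (g, g) • v - v ∈ O) ∧
      ∀ O' : Submodule (CompletedGroupAlgebra k (G × G)) W,
        O ≤ O'.comap β.toLinearMap → β v - w ∈ O'})
    (by
      intro O hO
      have hcont : Continuous fun g : G => of k (g, g) • v₀ - v₀ :=
        ((continuous_of.comp (continuous_id.prodMk continuous_id)).smul continuous_const).sub
          continuous_const
      obtain ⟨N, hN⟩ := ProfiniteGrp.exist_openNormalSubgroup_sub_open_nhds_of_one
        (hO.1.preimage hcont) (by
          show of k ((1 : G), (1 : G)) • v₀ - v₀ ∈ O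
          have h1 : of k ((1 : G), (1 : G)) = 1 := map_one (of k : G × G →* _)
          rw [h1, one_smul, sub_self]
          exact O.zero_mem)
      obtain ⟨a, ha, hae⟩ := mem_oTr_iff.1 hD N
      have hfix : ∀ h ∈ D.toSubgroup ⊔ N.toSubgroup, of k (h, h) • v₀ - v₀ ∈ O := by
        intro h hh
        obtain ⟨d, hd, n, hn, rfl⟩ := Subgroup.mem_sup_of_normal_right.1 hh
        have h1 : of k (d * n, d * n) = of k (d, d) * of k (n, n) := by
          rw [← map_mul]
          rfl
        have h2 : of k (d * n, d * n) • v₀ - v₀ = of k (d, d) • (of k (n, n) • v₀ - v₀) := by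
          rw [h1, mul_smul, smul_sub, hv₀D d hd]
        rw [h2]
        exact O.smul_mem _ (hN hn)
      let F (g : G) : V := of k (g, g) • leftIncl k G a • v₀
      have hF : ∀ g h, h ∈ D.toSubgroup ⊔ N.toSubgroup → F (g * h) - F g ∈ O := by
        intro g h hh
        have h1 : of k (g * h, g * h) = of k (g, g) * of k (h, h) := by
          rw [← map_mul]
          rfl
        have h2 : of k (h, h) • leftIncl k G a • v₀ = leftIncl k G a • of k (h, h) • v₀ := by
          rw [smul_smul, of_diag_mul_leftIncl, mem_fixedPoints_iff.1 ha h hh, mul_smul]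
        show of k (g * h, g * h) • leftIncl k G a • v₀ - of k (g, g) • leftIncl k G a • v₀ ∈ O
        rw [h1, mul_smul, h2, ← smul_sub, ← smul_sub]
        exact O.smul_mem _ (O.smul_mem _ (hfix h hh))
      have hindex : (D.toSubgroup ⊔ N.toSubgroup).FiniteIndex :=
        ⟨index_ne_zero_of_openNormal _ N⟩
      have := Fintype.ofFinite (G ⧸ (D.toSubgroup ⊔ N.toSubgroup))
      refine ⟨∑ x : G ⧸ (D.toSubgroup ⊔ N.toSubgroup), F x.out, fun g => ?_, fun O' hO' => ?_⟩
      · have h1 : ∀ x : G ⧸ (D.toSubgroup ⊔ N.toSubgroup),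
            of k (g, g) • F x.out - F ((g • x).out) ∈ O := by
          intro x
          have h2 : of k (g, g) • F x.out = F (g * x.out) := by
            show of k (g, g) • of k (x.out, x.out) • leftIncl k G a • v₀ =
              of k (g * x.out, g * x.out) • leftIncl k G a • v₀
            rw [smul_smul, ← map_mul]
            rfl
          have h3 : g • x = ((g * x.out : G) : G ⧸ (D.toSubgroup ⊔ N.toSubgroup)) := by
            conv_lhs => rw [← QuotientGroup.out_eq' x]
            rfl
          obtain ⟨h, hh⟩ := QuotientGroup.mk_out_eq_mul (D.toSubgroup ⊔ N.toSubgroup) (g * x.out)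
          rw [h2, h3, hh, ← neg_sub]
          exact O.neg_mem (hF _ _ h.2)
        have h4 : ∑ x : G ⧸ (D.toSubgroup ⊔ N.toSubgroup), F x.out =
            ∑ x : G ⧸ (D.toSubgroup ⊔ N.toSubgroup), F ((g • x).out) :=
          (Equiv.sum_comp (MulAction.toPerm g) fun x : G ⧸ (D.toSubgroup ⊔ N.toSubgroup) =>
            F x.out).symm
        have h5 : of k (g, g) • ∑ x : G ⧸ (D.toSubgroup ⊔ N.toSubgroup), F x.out -
            ∑ x : G ⧸ (D.toSubgroup ⊔ N.toSubgroup), F x.out =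
            ∑ x : G ⧸ (D.toSubgroup ⊔ N.toSubgroup),
              (of k (g, g) • F x.out - F ((g • x).out)) := by
          rw [Finset.sum_sub_distrib, ← h4, Finset.smul_sum]
        rw [h5]
        exact sum_mem fun x _ => h1 x
      · have h1 : ∀ g : G, β (F g) = leftIncl k G (conj (of k) g a) • w := by
          intro g
          show β (of k (g, g) • leftIncl k G a • v₀) = _
          rw [map_smul, map_smul, hv₀, hβψ, ← hw, smul_smul, of_diag_mul_leftIncl, mul_smul, hwG]
        have h2 : ∑ x : G ⧸ (D.toSubgroup ⊔ N.toSubgroup), conj (of k) x.out a = e := by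
          have h3 := trace_eq_finsum_coset ha (D.toSubgroup ⊔ N.toSubgroup) ⊤ fun _ _ => Iff.rfl
          rw [hae] at h3
          have h4 : {x : G ⧸ (D.toSubgroup ⊔ N.toSubgroup) |
              ∃ l ∈ (⊤ : Subgroup G), (l : G ⧸ (D.toSubgroup ⊔ N.toSubgroup)) = x} = Set.univ :=
            Set.eq_univ_of_forall fun x => ⟨x.out, trivial, QuotientGroup.out_eq' x⟩
          rw [h4, finsum_mem_univ, finsum_eq_sum_of_fintype] at h3
          exact h3.symm
        have h5 : leftIncl k G e • w = w := by
          rw [hw, ← map_smul]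
          exact congrArg φ (leftIncl_smul_blockOne he (blockOne he))
        rw [map_sum, Finset.sum_congr rfl fun x _ => h1 x.out, ← Finset.sum_smul, ← map_sum, h2, h5,
          sub_self]
        exact O'.zero_mem)
    (by
      rintro O x ⟨hx, hx'⟩ y ⟨hy, hy'⟩ z ⟨hz, hz'⟩ c
      refine ⟨fun g => ?_, fun O' hO' => ?_⟩
      · have h1 : of k (g, g) • (x + c • (y - z)) - (x + c • (y - z)) =
            (of k (g, g) • x - x) + c • ((of k (g, g) • y - y) - (of k (g, g) • z - z)) := by
          rw [smul_add, smul_comm, smul_sub]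
          simp only [smul_sub]
          abel
        rw [h1]
        exact O.add_mem (hx g) (O.smul_of_tower_mem c (O.sub_mem (hy g) (hz g)))
      · have h1 : β (x + c • (y - z)) - w = (β x - w) + c • ((β y - w) - (β z - w)) := by
          rw [map_add, show β (c • (y - z)) = c • β (y - z) from
            β.toLinearMap.map_smul_of_tower c (y - z), map_sub]
          simp only [smul_sub]
          abel
        rw [h1]
        exact O'.add_mem (hx' O' hO')
          (O'.smul_of_tower_mem c (O'.sub_mem (hy' O' hO') (hz' O' hO'))))
    (by
      rintro O x ⟨hx, hx'⟩ u hu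
      refine ⟨fun g => ?_, fun O' hO' => ?_⟩
      · have h1 : of k (g, g) • (x + u) - (x + u) =
            (of k (g, g) • x - x) + (of k (g, g) • u - u) := by
          rw [smul_add]
          abel
        rw [h1]
        exact O.add_mem (hx g) (O.sub_mem (O.smul_mem _ hu) hu)
      · rw [map_add, add_sub_right_comm]
        exact O'.add_mem (hx' O' hO') (hO' hu))
    (by
      rintro O O' h x ⟨hx, hx'⟩
      exact ⟨fun g => h (hx g), fun L hL => hx' L (h.trans hL)⟩)
  have hvG : ∀ g : G, of k (g, g) • v = v := fun g =>
    sub_eq_zero.1 (hV.separated _ fun O hO => (hv O hO).1 g)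
  have hβv : β v = w := by
    -- By continuity every open $O'$ of `W` is reached by some open cofinite $O$, so the relaxed
    -- conditions together give equality.
    refine sub_eq_zero.1 (hW.separated _ fun O' hO' => ?_)
    obtain ⟨O, hO, hOO'⟩ := hV.basis (β ⁻¹' O')
      ((hO'.1.preimage β.continuous).mem_nhds (by
        show β 0 ∈ O'
        rw [map_zero]
        exact O'.zero_mem))
    exact (hv O hO).2 O' hOO'
  refine ⟨blockLift he hV v hvG, fun x => ?_⟩
  rw [blockLift_apply, map_smul, hβv, hw, ← map_smul, leftIncl_smul_blockOne]

end Projective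

/-! ## Twisted functions -/

section Twisted

variable (k : Type v) [Field k] {G : Type u} [Group G] [TopologicalSpace G]
  (N : OpenNormalSubgroup G) (X : Type u)

/-- The functions from a `G/N`-set to `k[[G]]`, on which `(g₁, g₂) ∈ G × G` acts by
`f ↦ (x ↦ g₁ f(g₂⁻¹x) g₂⁻¹)`. -/
def TwistedFunctions (_ : OpenNormalSubgroup G) (X : Type u) : Type (max u v) :=
  X → CompletedGroupAlgebra k G

namespace TwistedFunctions

instance : AddCommGroup (TwistedFunctions k N X) :=
  inferInstanceAs (AddCommGroup (X → CompletedGroupAlgebra k G))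

instance : Module k (TwistedFunctions k N X) :=
  inferInstanceAs (Module k (X → CompletedGroupAlgebra k G))

variable {N X}

variable (N X) in
/-- The projection to the functions with values in `k[G/M]`. -/
def level (M : OpenNormalSubgroup G) :
    TwistedFunctions k N X →ₗ[k] (X → MonoidAlgebra k (G ⧸ M.toSubgroup)) where
  toFun f x := proj k M (f x)
  map_add' f f' := funext fun x => map_add (proj k M) (f x) (f' x)
  map_smul' c f := funext fun x => map_smul (proj k M) c (f x)

variable {k}

theorem ext_level {f f' : TwistedFunctions k N X} (h : ∀ M, level k N X M f = level k N X M f') :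
    f = f' :=
  funext fun x => CompletedGroupAlgebra.ext fun M => congrFun (h M) x

theorem level_surjective (M : OpenNormalSubgroup G) : Function.Surjective (level k N X M) := by
  intro f
  choose y hy using fun x => proj_surjective (k := k) M (f x)
  exact ⟨y, funext hy⟩

theorem level_eq_of_le {M M' : OpenNormalSubgroup G} (h : M ≤ M') {f f' : TwistedFunctions k N X}
    (hf : level k N X M f = level k N X M f') : level k N X M' f = level k N X M' f' := by
  funext x
  show proj k M' (f x) = proj k M' (f' x)
  rw [← transition_proj _ h, ← transition_proj _ h]
  exact congrArg (transition k h) (congrFun hf x)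

instance : TopologicalSpace (TwistedFunctions k N X) :=
  ⨅ M : OpenNormalSubgroup G, TopologicalSpace.induced (level k N X M) ⊥

theorem continuous_iff_level {Y : Type*} [TopologicalSpace Y] (f : Y → TwistedFunctions k N X) :
    Continuous f ↔ ∀ M, @Continuous _ _ _ ⊥ (fun a => level k N X M (f a)) := by
  refine continuous_iInf_rng.trans (forall_congr' fun M => ?_)
  exact continuous_induced_rng

theorem continuous_level (M : OpenNormalSubgroup G) :
    @Continuous (TwistedFunctions k N X) _ _ ⊥ (level k N X M) :=
  (continuous_iff_level _).1 continuous_id M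

theorem hasBasis_nhds_zero : (𝓝 (0 : TwistedFunctions k N X)).HasBasis (fun _ => True)
    (fun M : OpenNormalSubgroup G => {f | level k N X M f = 0}) :=
  hasBasis_nhds_zero_of_induced (fun M => (level k N X M).toAddMonoidHom) fun M M' =>
    ⟨M ⊓ M',
      fun _ hf => (level_eq_of_le inf_le_left (hf.trans (map_zero (level k N X _)).symm)).trans
        (map_zero (level k N X M)),
      fun _ hf => (level_eq_of_le inf_le_right (hf.trans (map_zero (level k N X _)).symm)).trans
        (map_zero (level k N X M'))⟩

instance : IsTopologicalAddGroup (TwistedFunctions k N X) :=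
  topologicalAddGroup_iInf fun M =>
    let _ : TopologicalSpace (X → MonoidAlgebra k (G ⧸ M.toSubgroup)) := ⊥
    have : DiscreteTopology (X → MonoidAlgebra k (G ⧸ M.toSubgroup)) := ⟨rfl⟩
    topologicalAddGroup_induced (level k N X M)

variable [MulAction (G ⧸ N.toSubgroup) X]

variable (k) in
/-- The action of `G × G` on the functions with values in `k[G/M]`. -/
def levelAction (M : OpenNormalSubgroup G) :
    G × G →* Module.End k (X → MonoidAlgebra k (G ⧸ M.toSubgroup)) where
  toFun g :=
    { toFun := fun f x => ofQ k M g.1 * f ((g.2⁻¹ : G ⧸ N.toSubgroup) • x) * ofQ k M g.2⁻¹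
      map_add' := fun f f' => by
        funext x
        simp only [Pi.add_apply, mul_add, add_mul]
      map_smul' := fun c f => by
        funext x
        simp only [Pi.smul_apply, mul_smul_comm, smul_mul_assoc, RingHom.id_apply] }
  map_one' := by
    refine LinearMap.ext fun f => funext fun x => ?_
    simp
  map_mul' g h := by
    refine LinearMap.ext fun f => funext fun x => ?_
    simp only [Prod.fst_mul, Prod.snd_mul, LinearMap.coe_mk, AddHom.coe_mk, Module.End.mul_apply,
      mul_inv_rev, map_mul, mul_assoc, QuotientGroup.mk_mul, mul_smul]

variable (k N X) in
/-- The action of `k[(G × G)/(M ∩ N)²]` on the functions with values in `k[G/M]`. -/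
def levelHom (M : OpenNormalSubgroup G) :
    MonoidAlgebra k ((G × G) ⧸ (square (M ⊓ N)).toSubgroup) →ₐ[k]
      Module.End k (X → MonoidAlgebra k (G ⧸ M.toSubgroup)) :=
  MonoidAlgebra.lift k _ _ (QuotientGroup.lift _ (levelAction k (N := N) (X := X) M) (by
    rintro ⟨g, h⟩ ⟨hg, hh⟩
    refine LinearMap.ext fun f => funext fun x => ?_
    show ofQ k M g * f ((h⁻¹ : G ⧸ N.toSubgroup) • x) * ofQ k M h⁻¹ = f x
    -- Membership in $M$ trivializes the multiplications on the values, membership in $N$ the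
    -- translation on `X`; this is why the level $M\cap N$ is needed.
    rw [ofQ_eq_one (N := M) hg.1, ofQ_eq_one (N := M) (inv_mem hh.1), one_mul, mul_one,
      (QuotientGroup.eq_one_iff h).2 hh.2, inv_one, one_smul]))

variable (k) in
theorem levelHom_ofQ (M : OpenNormalSubgroup G) (g : G × G)
    (f : X → MonoidAlgebra k (G ⧸ M.toSubgroup)) (x : X) :
    levelHom k N X M (ofQ k (square (M ⊓ N)) g) f x =
      ofQ k M g.1 * f ((g.2⁻¹ : G ⧸ N.toSubgroup) • x) * ofQ k M g.2⁻¹ := by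
  rw [ofQ_apply, levelHom, MonoidAlgebra.lift_of]
  rfl

theorem square_le {M M' : OpenNormalSubgroup G} (h : M ≤ M') (N : OpenNormalSubgroup G) :
    square (M ⊓ N) ≤ square (M' ⊓ N) :=
  fun _ hg => ⟨⟨h hg.1.1, hg.1.2⟩, ⟨h hg.2.1, hg.2.2⟩⟩

variable (k) in
theorem levelHom_transition {M M' : OpenNormalSubgroup G} (h : M ≤ M')
    (a : MonoidAlgebra k ((G × G) ⧸ (square (M ⊓ N)).toSubgroup))
    (f : X → MonoidAlgebra k (G ⧸ M.toSubgroup)) (x : X) :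
    transition k h (levelHom k N X M a f x) =
      levelHom k N X M' (transition k (square_le h N) a) (fun y => transition k h (f y)) x := by
  induction a using induction_ofQ with
  | hof g =>
    rw [transition_ofQ, levelHom_ofQ, levelHom_ofQ, map_mul, map_mul, transition_ofQ, transition_ofQ]
  | hadd a b ha hb =>
    simp only [map_add, LinearMap.add_apply, Pi.add_apply, ha, hb]
  | hsmul r a ha => simp only [map_smul, LinearMap.smul_apply, Pi.smul_apply, ha]

instance : SMul (CompletedGroupAlgebra k (G × G)) (TwistedFunctions k N X) where
  smul a f := fun x => CompletedGroupAlgebra.mk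
    (fun M => levelHom k N X M (proj k (square (M ⊓ N)) a) (level k N X M f) x) (by
      intro M M' h
      have hf : (fun y => transition k h (level k N X M f y)) = level k N X M' f :=
        funext fun y => transition_proj (f y) h
      rw [levelHom_transition k h, transition_proj, hf])

theorem level_smul (M : OpenNormalSubgroup G) (a : CompletedGroupAlgebra k (G × G))
    (f : TwistedFunctions k N X) :
    level k N X M (a • f) = levelHom k N X M (proj k (square (M ⊓ N)) a) (level k N X M f) := rfl

instance : Module (CompletedGroupAlgebra k (G × G)) (TwistedFunctions k N X) where
  one_smul f := ext_level fun M => by rw [level_smul, map_one, map_one, Module.End.one_apply]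
  mul_smul a b f := ext_level fun M => by
    rw [level_smul, map_mul, map_mul, Module.End.mul_apply, level_smul, level_smul]
  smul_zero a := ext_level fun M => by rw [level_smul, map_zero, map_zero]
  smul_add a f f' := ext_level fun M => by
    rw [level_smul, map_add, map_add, map_add, level_smul, level_smul]
  add_smul a b f := ext_level fun M => by
    rw [level_smul, map_add, map_add, LinearMap.add_apply, map_add, level_smul, level_smul]
  zero_smul f := ext_level fun M => by
    rw [level_smul, map_zero, map_zero, LinearMap.zero_apply, map_zero]

instance : IsScalarTower k (CompletedGroupAlgebra k (G × G)) (TwistedFunctions k N X) where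
  smul_assoc r a f := ext_level fun M => by
    rw [level_smul, map_smul, map_smul, LinearMap.smul_apply, map_smul, level_smul]

theorem of_smul_apply (g : G × G) (f : TwistedFunctions k N X) (x : X) :
    (of k g • f) x = of k g.1 * f ((g.2⁻¹ : G ⧸ N.toSubgroup) • x) * of k g.2⁻¹ := by
  refine CompletedGroupAlgebra.ext fun M => ?_
  rw [map_mul, map_mul]
  exact levelHom_ofQ k M g (level k N X M f) x

variable (k N X) in
/-- The kernel of the projection to the functions with values in `k[G/M]`. -/
def levelKer (M : OpenNormalSubgroup G) :
    Submodule (CompletedGroupAlgebra k (G × G)) (TwistedFunctions k N X) where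
  carrier := {f | level k N X M f = 0}
  add_mem' {f f'} hf hf' := by
    show level k N X M (f + f') = 0
    rw [map_add, show level k N X M f = 0 from hf, show level k N X M f' = 0 from hf', add_zero]
  zero_mem' := map_zero _
  smul_mem' a f hf := by
    show level k N X M (a • f) = 0
    rw [level_smul, show level k N X M f = 0 from hf, map_zero]

instance : ContinuousSMul (CompletedGroupAlgebra k (G × G)) (TwistedFunctions k N X) where
  continuous_smul := by
    refine (continuous_iff_level _).2 fun M => ?_
    let _ : TopologicalSpace (MonoidAlgebra k ((G × G) ⧸ (square (M ⊓ N)).toSubgroup)) := ⊥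
    have : DiscreteTopology (MonoidAlgebra k ((G × G) ⧸ (square (M ⊓ N)).toSubgroup)) := ⟨rfl⟩
    let _ : TopologicalSpace (X → MonoidAlgebra k (G ⧸ M.toSubgroup)) := ⊥
    have : DiscreteTopology (X → MonoidAlgebra k (G ⧸ M.toSubgroup)) := ⟨rfl⟩
    let m (z : MonoidAlgebra k ((G × G) ⧸ (square (M ⊓ N)).toSubgroup) ×
        (X → MonoidAlgebra k (G ⧸ M.toSubgroup))) : X → MonoidAlgebra k (G ⧸ M.toSubgroup) :=
      levelHom k N X M z.1 z.2
    have hm : Continuous m := continuous_of_discreteTopology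
    have h₁ : Continuous (proj k (square (M ⊓ N))) := continuous_proj (square (M ⊓ N))
    have h₂ : Continuous (level k N X M) := continuous_level M
    have h₃ : Continuous fun z : CompletedGroupAlgebra k (G × G) × TwistedFunctions k N X =>
        m (proj k (square (M ⊓ N)) z.1, level k N X M z.2) :=
      hm.comp ((h₁.comp continuous_fst).prodMk (h₂.comp continuous_snd))
    have h₄ : (fun z : CompletedGroupAlgebra k (G × G) × TwistedFunctions k N X =>
        m (proj k (square (M ⊓ N)) z.1, level k N X M z.2)) =
        fun z => level k N X M (z.1 • z.2) := by
      funext z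
      rw [level_smul]
    rw [h₄] at h₃
    exact h₃

variable [IsTopologicalGroup G] [CompactSpace G]

theorem isOpenCofinite_levelKer [Finite X] (M : OpenNormalSubgroup G) :
    IsOpenCofinite k (levelKer k N X M) := by
  constructor
  · let _ : TopologicalSpace (X → MonoidAlgebra k (G ⧸ M.toSubgroup)) := ⊥
    have : DiscreteTopology (X → MonoidAlgebra k (G ⧸ M.toSubgroup)) := ⟨rfl⟩
    exact (isOpen_discrete {0}).preimage (continuous_level M)
  · obtain ⟨s, hs⟩ := (level k N X M).exists_rightInverse_of_surjective
      (LinearMap.range_eq_top.2 (level_surjective M))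
    refine Module.Finite.of_surjective (((levelKer k N X M).mkQ.restrictScalars k) ∘ₗ s) fun x => ?_
    obtain ⟨f, rfl⟩ := (levelKer k N X M).mkQ_surjective x
    refine ⟨level k N X M f, (Submodule.Quotient.eq _).2 ?_⟩
    show level k N X M (s (level k N X M f) - f) = 0
    rw [map_sub, ← LinearMap.comp_apply (level k N X M) s, hs, LinearMap.id_apply, sub_self]

theorem isPseudocompactModule [Finite X] :
    IsPseudocompactModule k (CompletedGroupAlgebra k (G × G)) (TwistedFunctions k N X) where
  isTopologicalAddGroup := inferInstance
  continuousSMul := inferInstance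
  basis s hs := by
    obtain ⟨M, -, hM⟩ := hasBasis_nhds_zero.mem_iff.1 hs
    exact ⟨levelKer k N X M, isOpenCofinite_levelKer M, hM⟩
  separated f hf := ext_level fun M => by
    rw [map_zero]
    exact hf _ (isOpenCofinite_levelKer M)
  complete x hx := by
    choose r hr using fun M => (levelKer k N X M).mkQ_surjective (x (levelKer k N X M))
    have hle : ∀ {M M' : OpenNormalSubgroup G}, M ≤ M' → levelKer k N X M ≤ levelKer k N X M' :=
      fun h f hf => (level_eq_of_le h (hf.trans (map_zero (level k N X _)).symm)).trans
        (map_zero (level k N X _))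
    have hcompat : ∀ (M M' : OpenNormalSubgroup G), M ≤ M' →
        level k N X M' (r M) = level k N X M' (r M') := by
      intro M M' h
      have h1 := hx _ _ (hle h) (isOpenCofinite_levelKer M) (isOpenCofinite_levelKer M')
      rw [← hr M, ← hr M'] at h1
      have h2 : level k N X M' (r M - r M') = 0 := (Submodule.Quotient.eq _).1 h1
      rwa [map_sub, sub_eq_zero] at h2
    let f : TwistedFunctions k N X := fun y => CompletedGroupAlgebra.mk (fun M => proj k M (r M y))
      fun M M' h => by
        rw [transition_proj]
        exact congrFun (hcompat M M' h) y
    refine ⟨f, fun O hO => ?_⟩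
    obtain ⟨M, -, hM⟩ := hasBasis_nhds_zero.mem_iff.1 (hO.1.mem_nhds O.zero_mem)
    have hMO : levelKer k N X M ≤ O := hM
    rw [← hx _ _ hMO (isOpenCofinite_levelKer M) hO, ← hr M]
    refine (Submodule.Quotient.eq _).2 (hMO ?_)
    show level k N X M (f - r M) = 0
    rw [map_sub, sub_eq_zero]
    rfl

end TwistedFunctions

end Twisted

/-! ## Blocks and vertices -/

section VertexOfBlock

variable {k : Type v} [Field k] {G : Type u} [Group G] [TopologicalSpace G]

namespace TwistedFunctions

variable {N : OpenNormalSubgroup G} {X : Type u}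

variable (k N) in
/-- The value at `x`. -/
def eval (x : X) : TwistedFunctions k N X →ₗ[k] CompletedGroupAlgebra k G where
  toFun f := f x
  map_add' _ _ := rfl
  map_smul' _ _ := rfl

theorem ext_eval {f f' : TwistedFunctions k N X} (h : ∀ x, eval k N x f = eval k N x f') : f = f' :=
  funext h

theorem continuous_eval (x : X) : Continuous (eval k N x) := by
  refine (continuous_iff_proj _).2 fun M => ?_
  let _ : TopologicalSpace (MonoidAlgebra k (G ⧸ M.toSubgroup)) := ⊥
  let _ : TopologicalSpace (X → MonoidAlgebra k (G ⧸ M.toSubgroup)) := ⊥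
  have : DiscreteTopology (X → MonoidAlgebra k (G ⧸ M.toSubgroup)) := ⟨rfl⟩
  exact (continuous_of_discreteTopology (f := fun b : X → MonoidAlgebra k (G ⧸ M.toSubgroup) =>
    b x)).comp (continuous_level M)

open Classical in
variable (k N) in
/-- The function with the single value `a` at `x₀`. -/
def single (x₀ : X) : CompletedGroupAlgebra k G →ₗ[k] TwistedFunctions k N X :=
  LinearMap.single k (fun _ : X => CompletedGroupAlgebra k G) x₀

theorem eval_single (x₀ : X) (a : CompletedGroupAlgebra k G) :
    eval k N x₀ (single k N x₀ a) = a := by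
  classical exact Pi.single_eq_same (M := fun _ : X => CompletedGroupAlgebra k G) x₀ a

theorem eval_single_of_ne {x x₀ : X} (h : x ≠ x₀) (a : CompletedGroupAlgebra k G) :
    eval k N x (single k N x₀ a) = 0 := by
  classical exact Pi.single_eq_of_ne (M := fun _ : X => CompletedGroupAlgebra k G) h a

theorem sum_eval_single [Fintype X] (x₀ : X) (a : CompletedGroupAlgebra k G) :
    ∑ x, eval k N x (single k N x₀ a) = a := by
  rw [Fintype.sum_eq_single x₀ fun x hx => eval_single_of_ne hx a, eval_single]

theorem continuous_single (x₀ : X) : Continuous (single k N x₀) := by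
  refine (continuous_iff_level _).2 fun M => ?_
  let _ : TopologicalSpace (MonoidAlgebra k (G ⧸ M.toSubgroup)) := ⊥
  have : DiscreteTopology (MonoidAlgebra k (G ⧸ M.toSubgroup)) := ⟨rfl⟩
  let _ : TopologicalSpace (X → MonoidAlgebra k (G ⧸ M.toSubgroup)) := ⊥
  classical
  let s : MonoidAlgebra k (G ⧸ M.toSubgroup) → X → MonoidAlgebra k (G ⧸ M.toSubgroup) :=
    fun b => Pi.single x₀ b
  have h : (fun a => level k N X M (single k N x₀ a)) = s ∘ proj k M := by
    funext a x
    by_cases hx : x = x₀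
    · subst hx
      show proj k M (eval k N x (single k N x a)) = _
      rw [eval_single]
      exact (Pi.single_eq_same (M := fun _ : X => MonoidAlgebra k (G ⧸ M.toSubgroup)) x _).symm
    · show proj k M (eval k N x (single k N x₀ a)) = _
      rw [eval_single_of_ne hx, map_zero]
      exact (Pi.single_eq_of_ne (M := fun _ : X => MonoidAlgebra k (G ⧸ M.toSubgroup)) hx _).symm
  rw [h]
  exact continuous_of_discreteTopology.comp (continuous_proj M)

variable [MulAction (G ⧸ N.toSubgroup) X]

theorem eval_of_smul (g : G × G) (f : TwistedFunctions k N X) (x : X) :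
    eval k N x (of k g • f) =
      of k g.1 * eval k N (((g.2⁻¹ : G) : G ⧸ N.toSubgroup) • x) f * of k g.2⁻¹ :=
  of_smul_apply g f x

theorem of_smul_single {x₀ : X} {g : G × G} (hg : (g.2 : G ⧸ N.toSubgroup) • x₀ = x₀)
    (a : CompletedGroupAlgebra k G) :
    of k g • single k N x₀ a = single k N x₀ (of k g • a) := by
  refine ext_eval fun x => ?_
  rw [eval_of_smul, of_smul]
  have h : ((g.2⁻¹ : G) : G ⧸ N.toSubgroup) • x = x₀ ↔ x = x₀ := by
    rw [QuotientGroup.mk_inv, inv_smul_eq_iff, hg]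
  by_cases hx : x = x₀
  · rw [h.2 hx, hx, eval_single, eval_single]
  · rw [eval_single_of_ne hx, eval_single_of_ne (mt h.1 hx), mul_zero, zero_mul]

variable [IsTopologicalGroup G] [CompactSpace G]

variable (k N X) in
/-- The homomorphism from the functions on a `G/N`-set to `k[[G]]` given by summation. -/
def sum [Fintype X] : TwistedFunctions k N X →L[CompletedGroupAlgebra k (G × G)]
    TwistedFunctions k N PUnit.{u + 1} :=
  let β : TwistedFunctions k N X →ₗ[k] TwistedFunctions k N PUnit.{u + 1} :=
    single k N PUnit.unit ∘ₗ ∑ x, eval k N x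
  have hβ : Continuous β := by
    refine (continuous_single _).comp ?_
    rw [LinearMap.coe_sum]
    have h := continuous_finsetSum Finset.univ
      fun x _ => continuous_eval (k := k) (N := N) (X := X) x
    simpa only [← Finset.sum_apply] using h
  have := (isPseudocompactModule (k := k) (N := N) (X := PUnit.{u + 1})).t2Space
  { toFun := β
    map_add' := map_add β
    map_smul' := map_smul_of_map_of_smul β hβ fun g f => by
      show single k N PUnit.unit ((∑ x, eval k N x) _) =
        of k g • single k N PUnit.unit ((∑ x, eval k N x) f)
      rw [of_smul_single rfl, of_smul, LinearMap.sum_apply, LinearMap.sum_apply, Finset.mul_sum,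
        Finset.sum_mul, ← Equiv.sum_comp (MulAction.toPerm ((g.2⁻¹ : G) : G ⧸ N.toSubgroup))
          fun x => of k g.1 * eval k N x f * of k g.2⁻¹]
      exact congrArg _ (Finset.sum_congr rfl fun x _ => eval_of_smul g f x)
    cont := hβ }

theorem sum_apply [Fintype X] (f : TwistedFunctions k N X) :
    TwistedFunctions.sum k N X f = single k N PUnit.unit (∑ x, eval k N x f) := by
  rw [← LinearMap.sum_apply]
  rfl

end TwistedFunctions

open TwistedFunctions

variable [IsTopologicalGroup G] [CompactSpace G]

/-- The homomorphism from a block to the constant functions. -/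
def blockConst {e : CompletedGroupAlgebra k G} (he : IsBlockIdempotent e)
    (N : OpenNormalSubgroup G) :
    block e he →L[CompletedGroupAlgebra k (G × G)] TwistedFunctions k N PUnit.{u + 1} :=
  have := (isPseudocompactModule (k := k) (N := N) (X := PUnit.{u + 1})).t2Space
  { toFun := fun x => single k N PUnit.unit x.1
    map_add' := fun x y => map_add (single k N PUnit.unit) x.1 y.1
    map_smul' := fun a x => map_smul_of_map_of_smul (single k N PUnit.unit) (TwistedFunctions.continuous_single _)
      (fun _ x => (of_smul_single rfl x).symm) a x.1
    cont := (TwistedFunctions.continuous_single _).comp continuous_subtype_val }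

theorem blockConst_apply {e : CompletedGroupAlgebra k G} (he : IsBlockIdempotent e)
    (N : OpenNormalSubgroup G) (x : block e he) :
    blockConst he N x = single k N PUnit.unit x.1 := rfl

variable [TotallyDisconnectedSpace G]

/-- The module $k[[G]]$ is realized as the functions on one point. Summation from functions on $X$
onto it splits over $\delta(D)$ by placing the value at the $D$-fixed point $x_0$. Relative
projectivity then lifts the inclusion $B\to k[[G]]$, and the image of the $\delta(G)$-fixed element
$e$ is the equivariant function sought. -/
theorem exists_conj_of_isRelativelyProjective {e : CompletedGroupAlgebra k G}
    (he : IsBlockIdempotent e) {D : ClosedSubgroup G}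
    (h : IsRelativelyProjective k (block e he) (diagonal D)) (N : OpenNormalSubgroup G)
    (X : Type u) [Fintype X] [MulAction (G ⧸ N.toSubgroup) X] (x₀ : X)
    (hx₀ : ∀ d ∈ D.toSubgroup, (d : G ⧸ N.toSubgroup) • x₀ = x₀) :
    ∃ f : X → CompletedGroupAlgebra k G, ∑ x, f x = e ∧
      ∀ (g : G) (x : X), f ((g : G ⧸ N.toSubgroup) • x) = conj (of k) g (f x) := by
  have hV : IsPseudocompactModule k (CompletedGroupAlgebra k (G × G)) (TwistedFunctions k N X) :=
    isPseudocompactModule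
  have := hV.t2Space
  obtain ⟨ψ, hψ⟩ := h (TwistedFunctions k N X) (TwistedFunctions k N PUnit.{u + 1}) hV
    isPseudocompactModule (TwistedFunctions.sum k N X) (blockConst he N)
    (fun f => ⟨single k N x₀ (eval k N PUnit.unit f), by
      rw [TwistedFunctions.sum_apply, sum_eval_single]
      exact ext_eval fun _ => eval_single _ _⟩)
    ⟨(single k N x₀).toAddMonoidHom.comp (block e he).subtype.toAddMonoidHom,
      (TwistedFunctions.continuous_single x₀).comp continuous_subtype_val, fun a x => by
        let f₁ : CompletedGroupAlgebra k (diagonal D).toSubgroup →ₗ[k] TwistedFunctions k N X :=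
          { toFun := fun a => single k N x₀ (incl k (diagonal D).toSubgroup a • x.1)
            map_add' := fun a b => by rw [map_add, add_smul, map_add]
            map_smul' := fun c a => by
              rw [map_smul (incl k (diagonal D).toSubgroup), smul_assoc, map_smul (single k N x₀),
                RingHom.id_apply] }
        let f₂ : CompletedGroupAlgebra k (diagonal D).toSubgroup →ₗ[k] TwistedFunctions k N X :=
          { toFun := fun a => incl k (diagonal D).toSubgroup a • single k N x₀ x.1
            map_add' := fun a b => by rw [map_add, add_smul]
            map_smul' := fun c a => by rw [map_smul, smul_assoc, RingHom.id_apply] }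
        refine linearMap_ext f₁ f₂
          ((TwistedFunctions.continuous_single x₀).comp ((continuous_incl _).smul continuous_const))
          ((continuous_incl _).smul continuous_const) ?_ a
        rintro ⟨_, d, hd, rfl⟩
        show single k N x₀ (incl k (diagonal D).toSubgroup (of k _) • x.1) =
          incl k (diagonal D).toSubgroup (of k _) • single k N x₀ x.1
        rw [incl_of]
        exact (of_smul_single (hx₀ d hd) x.1).symm,
      fun x => by
        rw [TwistedFunctions.sum_apply, blockConst_apply]
        exact congrArg _ (sum_eval_single x₀ x.1)⟩
  refine ⟨fun x => eval k N x (ψ (blockOne he)), ?_, fun g x => ?_⟩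
  · have h1 := congrArg (eval k N PUnit.unit) (hψ (blockOne he))
    rwa [TwistedFunctions.sum_apply, blockConst_apply, eval_single, eval_single] at h1
  · have h1 : of k (g, g) • ψ (blockOne he) = ψ (blockOne he) := by
      rw [← map_smul, of_diag_smul_blockOne]
    show eval k N ((g : G ⧸ N.toSubgroup) • x) (ψ (blockOne he)) =
      conj (of k) g (eval k N x (ψ (blockOne he)))
    conv_lhs => rw [← h1]
    rw [eval_of_smul, QuotientGroup.mk_inv, inv_smul_smul, conj_apply]

/-- With $X=G/DN$, an equivariant function with sum $e$ says exactly that $e$ is the trace from $DN$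
of its value at the base point. -/
theorem mem_oTr_of_isRelativelyProjective {e : CompletedGroupAlgebra k G}
    (he : IsBlockIdempotent e) {D : ClosedSubgroup G}
    (h : IsRelativelyProjective k (block e he) (diagonal D)) : e ∈ oTr D.toSubgroup := by
  refine mem_oTr_iff.2 fun N => ?_
  let H : Subgroup (G ⧸ N.toSubgroup) := D.toSubgroup.map (QuotientGroup.mk' N.toSubgroup)
  let x₀ : (G ⧸ N.toSubgroup) ⧸ H := ((1 : G ⧸ N.toSubgroup) : (G ⧸ N.toSubgroup) ⧸ H)
  have := Fintype.ofFinite ((G ⧸ N.toSubgroup) ⧸ H)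
  obtain ⟨f, hf, hfg⟩ := exists_conj_of_isRelativelyProjective he h N _ x₀
    fun d hd => (smul_coset_one_eq_iff _).2 ⟨d, hd, rfl⟩
  let _ : MulAction G ((G ⧸ N.toSubgroup) ⧸ H) :=
    MulAction.compHom _ (QuotientGroup.mk' N.toSubgroup)
  have hstab : ∀ l : G, l • x₀ = x₀ ↔ l ∈ D.toSubgroup ⊔ N.toSubgroup := fun l => by
    have h1 : D.toSubgroup ⊔ N.toSubgroup = H.comap (QuotientGroup.mk' N.toSubgroup) := by
      rw [Subgroup.comap_map_eq, QuotientGroup.ker_mk']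
    rw [h1]
    exact smul_coset_one_eq_iff (QuotientGroup.mk' N.toSubgroup l)
  refine ⟨f x₀, mem_fixedPoints_iff.2 fun g hg => ?_, ?_⟩
  · rw [← hfg]
    exact congrArg f ((hstab g).2 hg)
  · rw [trace_eq_finsum (of k) (D.toSubgroup ⊔ N.toSubgroup) x₀ f (fun l => hfg l x₀) hstab,
      finsum_eq_sum_of_fintype, hf]
    intro x
    obtain ⟨y, rfl⟩ := QuotientGroup.mk_surjective x
    obtain ⟨g, rfl⟩ := QuotientGroup.mk_surjective y
    refine ⟨g, ?_⟩
    show (g : G ⧸ N.toSubgroup) • x₀ = _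
    rw [MulAction.Quotient.smul_coe, smul_eq_mul, mul_one]

theorem isRelativelyProjective_iff_mem_oTr {e : CompletedGroupAlgebra k G}
    (he : IsBlockIdempotent e) {D : ClosedSubgroup G} :
    IsRelativelyProjective k (block e he) (diagonal D) ↔ e ∈ oTr D.toSubgroup :=
  ⟨mem_oTr_of_isRelativelyProjective he, isRelativelyProjective_of_mem_oTr he⟩

omit [CompactSpace G] in
theorem diagonal_le_diagonal_iff {D R : ClosedSubgroup G} : diagonal R ≤ diagonal D ↔ R ≤ D :=
  Subgroup.map_le_map_iff_of_injective (f := (MonoidHom.id G).prod (MonoidHom.id G))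
    fun _ _ h => congrArg Prod.fst h

omit [CompactSpace G] in
theorem exists_diagonal_eq {D : ClosedSubgroup G} {R : ClosedSubgroup (G × G)}
    (h : R ≤ diagonal D) : ∃ R' : ClosedSubgroup G, diagonal R' = R := by
  refine ⟨⟨R.toSubgroup.comap ((MonoidHom.id G).prod (MonoidHom.id G)),
    R.isClosed'.preimage (continuous_id.prodMk continuous_id)⟩, ?_⟩
  refine SetLike.ext fun g => ⟨?_, fun hg => ?_⟩
  · rintro ⟨d, hd, rfl⟩
    exact hd
  · obtain ⟨d, -, rfl⟩ := h hg
    exact ⟨d, hg, rfl⟩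

/-- Every closed subgroup of $\delta(D)$ is $\delta(R)$ for a closed $R\le D$, so testing proper
subgroups of $\delta(D)$ amounts to testing proper subgroups of $D$. -/
theorem minimal_mem_oTr_iff_isVertex {e : CompletedGroupAlgebra k G} (he : IsBlockIdempotent e)
    {D : ClosedSubgroup G} : Minimal (fun R : ClosedSubgroup G => e ∈ oTr R.toSubgroup) D ↔
      IsVertex k (block e he) (diagonal D) := by
  rw [minimal_iff_forall_lt, IsVertex, isRelativelyProjective_iff_mem_oTr]
  refine and_congr_right fun _ => ⟨fun h R hR hproj => ?_, fun h R hR hmem => ?_⟩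
  · obtain ⟨R', rfl⟩ := exists_diagonal_eq hR.le
    exact h (lt_iff_le_not_ge.2 ⟨diagonal_le_diagonal_iff.1 hR.le,
      fun h' => hR.not_ge (diagonal_le_diagonal_iff.2 h')⟩)
      (mem_oTr_of_isRelativelyProjective he hproj)
  · exact h (diagonal R) (lt_iff_le_not_ge.2 ⟨diagonal_le_diagonal_iff.2 hR.le,
      fun h' => hR.not_ge (diagonal_le_diagonal_iff.1 h')⟩)
      (isRelativelyProjective_of_mem_oTr he hmem)

end VertexOfBlock

end ProfiniteBlock
end

/-! ### The equivalent characterizations of defect groups -/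

theorem mainTheorem2 {p : ℕ} [Fact p.Prime] {k : Type v} [Field k] [CharP k p]
    {G : Type u} [Group G] [TopologicalSpace G] [IsTopologicalGroup G] [CompactSpace G]
    [TotallyDisconnectedSpace G]
    (e : CompletedGroupAlgebra k G) (he : IsBlockIdempotent e) (D : ClosedSubgroup G) :
    List.TFAE [
      Minimal (fun R : ClosedSubgroup G => e ∈ oTr R.toSubgroup) D,
      Minimal (fun R : ClosedSubgroup G =>
        indexExponent p R.toSubgroup ≠ ⊤ ∧ e ∈ modifiedTraceImage p R.toSubgroup) D,
      IsVertex k (block e he) (diagonal D),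
      IsProP p D.toSubgroup ∧ e ∈ oTr D.toSubgroup ∧ brauer D he ≠ 0,
      Maximal (fun R : ClosedSubgroup G => IsProP p R.toSubgroup ∧ brauer R he ≠ 0) D] := by
  have h := tfae_brauer (p := p) he D
  -- As $e\ne0$, the two conditions on a subgroup coincide, and so do their minimal elements.
  tfae_have 1 ↔ 2 := by
    rw [funext fun R : ClosedSubgroup G =>
      propext (mem_oTr_iff_mem_modifiedTraceImage (p := p) (R := R.toSubgroup) he.ne_zero)]
  tfae_have 1 ↔ 3 := minimal_mem_oTr_iff_isVertex he
  tfae_have 1 ↔ 4 := h.out 0 1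
  tfae_have 1 ↔ 5 := h.out 0 2
  tfae_finish
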